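/- **Setting.** Let $\Omega\subset\mathbb R^3$ be a bounded open set with $C^1$ boundary and unit outward normal $\mathbf n$. For $t\in(0,T)$ it contains two immiscible fluids occupying disjoint open sets $\Omega_\pm(t)\subset\Omega$, given by a $C^2$ level set function $\varphi(t,\mathbf x)$ as $\Omega_+(t)=\{\mathbf x\in\Omega:\varphi(t,\mathbf x)>0\}$ and $\Omega_-(t)=\{\mathbf x\in\Omega:\varphi(t,\mathbf x)<0\}$, where $\nabla\varphi(t,\mathbf x)\ne0$ whenever $\mathbf x\in\overline\Omega$ and $\varphi(t,\mathbf x)=0$. Let $\Gamma(t)=\Omega\cap\partial\Omega_+(t)\cap\partial\Omega_-(t)$ be the interface, with unit normal $\mathbf n_\Gamma=\nabla\varphi/|\nabla\varphi|$ (pointing into $\Omega_+$), normal velocity $V_\Gamma=-\partial_t\varphi/|\nabla\varphi|$ and mean curvature $\kappa=-\nabla\cdot\mathbf n_\Gamma$ (the sum of the principal curvatures). Contact of the interface with $\partial\Omega$ is allowed. For a quantity $\chi$ with traces $\chi_\pm$ from $\Omega_\pm$ on $\Gamma$ write $[\![\chi]\!]=\chi_+-\chi_-$. Let $\rho_\pm,\eta_\pm,\sigma_\pm>0$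 (densities, viscosities, conductivities), $g>0$ and $\lambda\in\mathbb R$ (surface tension) be constants, $\mathbf g=(0,0,-g)^\top$, $\mathbf B=\mathbf B(\mathbf x)$ a steady external magnetic field, $\mathbf D(\mathbf u)=\frac12(\nabla\mathbf u+(\nabla\mathbf u)^\top)$, and write $\eta=\eta_+\mathbf 1_{\Omega_+}+\eta_-\mathbf 1_{\Omega_-}$, and likewise $\rho,\sigma$. Let $(\mathbf u,p,\mathbf J,V)$ be smooth up to the boundary in each phase: in $\Omega_\pm(t)$, $0<t<T$, $\mathbf u$ is the restriction of a $C^2$ function, and $p,\mathbf J,V$ are restrictions of $C^1$ functions, on $(0,T)\times\mathbb R^3$. Assume that for $0<t<T$ they satisfy, in $\Omega_\pm(t)$, $$\rho_\pm(\partial_t\mathbf u+\mathbf u\cdot\nabla\mathbf u)=\nabla\cdot(2\eta_\pm\mathbf D(\mathbf u)-p\mathbf I)+\mathbf J\times\mathbf B+\rho_\pm\mathbf g,\quad \nabla\cdot\mathbf u=0,\quad \mathbf J=\sigma_\pm(-\nabla V+\mathbf u\times\mathbf B),\quad \nabla\cdot\mathbf J=0;$$ on $\Gamma(t)$, $$[\![2\eta\mathbf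 D(\mathbf u)-p\mathbf I]\!]\mathbf n_\Gamma=-\lambda\kappa\mathbf n_\Gamma,\quad [\![\mathbf u]\!]=0,\quad V_\Gamma=\mathbf u\cdot\mathbf n_\Gamma,\quad [\![\mathbf J\cdot\mathbf n_\Gamma]\!]=0,\quad [\![V]\!]=0;$$ and, on $\partial\Omega$, $\mathbf u=0$ and $\mathbf J\cdot\mathbf n=0$ (for the trace from each phase whose closure contains the boundary point). **Theorem.** For every $t\in(0,T)$ the interface $\Gamma(t)$ has finite area (two-dimensional Hausdorff measure $\mathcal H^2$), the mass of each phase and the total energy are differentiable at $t$, and, with $\mathbf x=(x,y,z)^\top$, $$\frac{d}{dt}\int_{\Omega_\pm(t)}\rho_\pm\,d\mathbf x=0,$$ $$\frac{d}{dt}\Big(\int_\Omega\tfrac12\rho|\mathbf u|^2\,d\mathbf x+\lambda\,\mathcal H^2(\Gamma(t))+\int_\Omega\rho g z\,d\mathbf x\Big)=-\int_\Omega2\eta|\mathbf D(\mathbf u)|^2\,d\mathbf x-\int_\Omega\sigma^{-1}|\mathbf J|^2\,d\mathbf x\le0 .$$ -/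

import Mathlib

open MeasureTheory Set
open scoped Matrix

noncomputable section

namespace TwoPhaseMHD

/-- Physical space `ℝ³` with its Euclidean norm. -/
abbrev E3 : Type := EuclideanSpace ℝ (Fin 3)

/-! ### Vector calculus on `ℝ³` -/

/-- The partial derivative `∂ᵢ f (x)`. -/
def pderiv {F : Type*} [NormedAddCommGroup F] [NormedSpace ℝ F]
    (i : Fin 3) (f : E3 → F) (x : E3) : F :=
  fderiv ℝ f x (EuclideanSpace.single i 1)

/-- The divergence `∇ · F` of a vector field. -/
def divergence (F : E3 → E3) (x : E3) : ℝ := ∑ i, pderiv i F x i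

/-- The (row-wise) divergence `(∇ · S)ᵢ = ∑ⱼ ∂ⱼ Sᵢⱼ` of a tensor field. -/
def tensorDivergence (S : E3 → Matrix (Fin 3) (Fin 3) ℝ) (x : E3) : E3 :=
  WithLp.toLp 2 fun i => ∑ j, pderiv j (fun y => S y i j) x

/-- The deformation tensor `D(u) = (∇u + (∇u)ᵀ) / 2`. -/
def deformation (u : E3 → E3) (x : E3) : Matrix (Fin 3) (Fin 3) ℝ :=
  Matrix.of fun i j => (pderiv j u x i + pderiv i u x j) / 2

/-- The squared Frobenius norm `|A|² = ∑ᵢⱼ Aᵢⱼ²`. -/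
def frobeniusSq (A : Matrix (Fin 3) (Fin 3) ℝ) : ℝ := ∑ i, ∑ j, A i j ^ 2

/-- The vector product `a × b`. -/
def cross (a b : E3) : E3 := WithLp.toLp 2 (a.ofLp ⨯₃ b.ofLp)

/-- The tensor `A` applied to the vector `v`. -/
def applyTensor (A : Matrix (Fin 3) (Fin 3) ℝ) (v : E3) : E3 := WithLp.toLp 2 (A *ᵥ v.ofLp)

/-- The normalized gradient `∇f / |∇f|`, i.e. the unit normal of the level sets of `f` pointing
in the direction in which `f` increases. -/
def unitGradient (f : E3 → ℝ) (x : E3) : E3 := ‖gradient f x‖⁻¹ • gradient f x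

/-! ### Data of the two-phase problem -/

/-- The two fluids. -/
inductive Phase : Type
  | plus
  | minus

/-- All quantities occurring in the two-phase system: no relation between them is imposed here.
The container and the moving interface are described by defining functions, and each unknown is a
pair of fields, the field with index `s` being relevant only on the closure of the region occupied
by phase `s` (its values elsewhere are an arbitrary extension). -/
structure Data where
  /-- densities -/
  ρ : Phase → ℝ
  /-- dynamic viscosities -/
  η : Phase → ℝ
  /-- electrical conductivities -/
  σ : Phase → ℝ
  /-- surface tension -/
  surfTension : ℝ
  /-- gravitational acceleration -/
  g : ℝ
  /-- length of the time interval `(0, T)` -/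
  T : ℝ
  /-- steady external magnetic field -/
  B : E3 → E3
  /-- defining function of the container `Ω = {wall < 0}` -/
  wall : E3 → ℝ
  /-- level set function: `φ t > 0` in the phase `plus` and `φ t < 0` in the phase `minus` -/
  φ : ℝ → E3 → ℝ
  /-- velocity -/
  u : Phase → ℝ → E3 → E3
  /-- pressure -/
  p : Phase → ℝ → E3 → ℝ
  /-- current density -/
  J : Phase → ℝ → E3 → E3
  /-- electric potential -/
  V : Phase → ℝ → E3 → ℝ

namespace Data

variable (S : Data)

/-- The container `Ω`. -/
def Ω : Set E3 := {x | S.wall x < 0}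

/-- The region `Ω₊(t)` or `Ω₋(t)` occupied by a phase at time `t`. -/
def region : Phase → ℝ → Set E3
  | .plus, t => {x | x ∈ S.Ω ∧ 0 < S.φ t x}
  | .minus, t => {x | x ∈ S.Ω ∧ S.φ t x < 0}

/-- The interface `Γ(t) = ∂Ω₊(t) ∩ ∂Ω₋(t)` inside the container. -/
def Γ (t : ℝ) : Set E3 :=
  S.Ω ∩ (frontier (S.region .plus t) ∩ frontier (S.region .minus t))

/-- The unit outward normal of `Ω` (on `∂Ω`). -/
def wallNormal (x : E3) : E3 := unitGradient S.wall x

/-- The unit normal `n_Γ` of `Γ(t)` pointing into `Ω₊(t)`. -/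
def normal (t : ℝ) (x : E3) : E3 := unitGradient (S.φ t) x

/-- The velocity `V_Γ` of `Γ(t)` in the direction of `n_Γ`. -/
def normalVelocity (t : ℝ) (x : E3) : ℝ :=
  -deriv (fun τ => S.φ τ x) t / ‖gradient (S.φ t) x‖

/-- The mean curvature (sum of the principal curvatures) `κ = -∇ · n_Γ` of `Γ(t)`; it is
negative for a ball-shaped region `Ω₋(t)`. -/
def curvature (t : ℝ) (x : E3) : ℝ := -divergence (S.normal t) x

/-- The gravitational acceleration vector `(0, 0, -g)`. -/
def gravity : E3 := EuclideanSpace.single 2 (-S.g)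

/-- The stress tensor `2 η D(u) - p I` of each phase. -/
def stress (s : Phase) (t : ℝ) (x : E3) : Matrix (Fin 3) (Fin 3) ℝ :=
  (2 * S.η s) • deformation (S.u s t) x - S.p s t x • (1 : Matrix (Fin 3) (Fin 3) ℝ)

/-- The jump `⟦f⟧ = f₊ - f₋` of a quantity (across the interface). -/
def jump {F : Type*} [Sub F] (f : Phase → ℝ → E3 → F) (t : ℝ) (x : E3) : F :=
  f .plus t x - f .minus t x

/-- The quantity `f₊ 𝟙_{Ω₊(t)} + f₋ 𝟙_{Ω₋(t)}` on the container. -/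
def glue {F : Type*} [AddMonoid F] (f : Phase → ℝ → E3 → F) (t : ℝ) (x : E3) : F :=
  (S.region .plus t).indicator (f .plus t) x + (S.region .minus t).indicator (f .minus t) x

/-- The density `ρ` on the container. -/
def density : ℝ → E3 → ℝ := S.glue fun s _ _ => S.ρ s

/-- The viscosity `η` on the container. -/
def viscosity : ℝ → E3 → ℝ := S.glue fun s _ _ => S.η s

/-- The conductivity `σ` on the container. -/
def conductivity : ℝ → E3 → ℝ := S.glue fun s _ _ => S.σ s

/-- The velocity `u` on the container. -/
def velocity : ℝ → E3 → E3 := S.glue S.u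

/-- The current density `J` on the container. -/
def current : ℝ → E3 → E3 := S.glue S.J

/-- The deformation tensor `D(u)` on the container (computed in each phase). -/
def strain : ℝ → E3 → Matrix (Fin 3) (Fin 3) ℝ := S.glue fun s t => deformation (S.u s t)

/-- The mass of a phase. -/
def mass (s : Phase) (t : ℝ) : ℝ := ∫ _x in S.region s t, S.ρ s

/-- The surface area of the interface, as its two-dimensional Hausdorff measure (normalized to
agree with Lebesgue measure on planes). -/
def area (t : ℝ) : ℝ := (Measure.euclideanHausdorffMeasure 2 (S.Γ t)).toReal

/-- Kinetic energy plus interfacial energy plus gravitational potential energy. -/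
def energy (t : ℝ) : ℝ :=
  (∫ x in S.Ω, 1 / 2 * S.density t x * ‖S.velocity t x‖ ^ 2)
    + S.surfTension * S.area t
    + ∫ x in S.Ω, S.density t x * S.g * x 2

/-- The viscous dissipation `∫ 2 η |D(u)|²`. -/
def viscousDissipation (t : ℝ) : ℝ :=
  ∫ x in S.Ω, 2 * S.viscosity t x * frobeniusSq (S.strain t x)

/-- The Joule dissipation `∫ σ⁻¹ |J|²`. -/
def jouleDissipation (t : ℝ) : ℝ :=
  ∫ x in S.Ω, (S.conductivity t x)⁻¹ * ‖S.current t x‖ ^ 2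

/-- A classical solution, smooth up to the boundary in each phase, of the sharp-interface
inductionless two-phase MHD system with no-slip and insulating walls on `(0, T)`. -/
structure IsSmoothSolution : Prop where
  -- physical constants
  density_pos : ∀ s, 0 < S.ρ s
  viscosity_pos : ∀ s, 0 < S.η s
  conductivity_pos : ∀ s, 0 < S.σ s
  gravity_pos : 0 < S.g
  -- a bounded container with `C¹` boundary
  bounded : Bornology.IsBounded S.Ω
  wall_smooth : ContDiff ℝ 1 S.wall
  wall_regular : ∀ x, S.wall x = 0 → gradient S.wall x ≠ 0
  -- an evolving interface of class `C²`
  φ_smooth : ContDiffOn ℝ 2 (fun q : ℝ × E3 => S.φ q.1 q.2) (Ioo 0 S.T ×ˢ univ)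
  φ_regular : ∀ t ∈ Ioo 0 S.T, ∀ x ∈ closure S.Ω, S.φ t x = 0 → gradient (S.φ t) x ≠ 0
  -- the unknowns are smooth up to the boundary in each phase
  u_smooth : ∀ s, ContDiffOn ℝ 2 (fun q : ℝ × E3 => S.u s q.1 q.2) (Ioo 0 S.T ×ˢ univ)
  p_smooth : ∀ s, ContDiffOn ℝ 1 (fun q : ℝ × E3 => S.p s q.1 q.2) (Ioo 0 S.T ×ˢ univ)
  J_smooth : ∀ s, ContDiffOn ℝ 1 (fun q : ℝ × E3 => S.J s q.1 q.2) (Ioo 0 S.T ×ˢ univ)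
  V_smooth : ∀ s, ContDiffOn ℝ 1 (fun q : ℝ × E3 => S.V s q.1 q.2) (Ioo 0 S.T ×ˢ univ)
  -- the bulk equations
  momentum : ∀ s, ∀ t ∈ Ioo 0 S.T, ∀ x ∈ S.region s t,
    S.ρ s • (deriv (fun τ => S.u s τ x) t + fderiv ℝ (S.u s t) x (S.u s t x))
      = tensorDivergence (S.stress s t) x + cross (S.J s t x) (S.B x) + S.ρ s • S.gravity
  incompressible : ∀ s, ∀ t ∈ Ioo 0 S.T, ∀ x ∈ S.region s t, divergence (S.u s t) x = 0
  ohm : ∀ s, ∀ t ∈ Ioo 0 S.T, ∀ x ∈ S.region s t,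
    S.J s t x = S.σ s • (-gradient (S.V s t) x + cross (S.u s t x) (S.B x))
  charge : ∀ s, ∀ t ∈ Ioo 0 S.T, ∀ x ∈ S.region s t, divergence (S.J s t) x = 0
  -- the interface conditions
  jump_stress : ∀ t ∈ Ioo 0 S.T, ∀ x ∈ S.Γ t,
    applyTensor (jump S.stress t x) (S.normal t x)
      = -(S.surfTension * S.curvature t x) • S.normal t x
  jump_velocity : ∀ t ∈ Ioo 0 S.T, ∀ x ∈ S.Γ t, jump S.u t x = 0
  kinematic : ∀ s, ∀ t ∈ Ioo 0 S.T, ∀ x ∈ S.Γ t,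
    S.normalVelocity t x = inner ℝ (S.u s t x) (S.normal t x)
  jump_current : ∀ t ∈ Ioo 0 S.T, ∀ x ∈ S.Γ t,
    jump (fun s τ y => inner ℝ (S.J s τ y) (S.normal τ y)) t x = 0
  jump_potential : ∀ t ∈ Ioo 0 S.T, ∀ x ∈ S.Γ t, jump S.V t x = 0
  -- the boundary conditions on the walls
  no_slip : ∀ s, ∀ t ∈ Ioo 0 S.T, ∀ x ∈ frontier S.Ω ∩ closure (S.region s t), S.u s t x = 0
  insulating : ∀ s, ∀ t ∈ Ioo 0 S.T, ∀ x ∈ frontier S.Ω ∩ closure (S.region s t),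
    inner ℝ (S.J s t x) (S.wallNormal x) = 0

end Data

end TwoPhaseMHD

end

/-!
The theorem is the energy law of two-phase flow: multiply the momentum equation by the velocity,
integrate over each phase, and add. The Lorentz force takes from the fluid the Joule heat `|J|² / σ`
and the power `J · ∇V`, which is the divergence of `V J` because `∇ · J = 0`
(`Data.divergence_flux`). The energy density of a phase is therefore carried along by the fluid up
to the divergence of the energy flux `S u - V J` (with `S` the stress tensor) and the dissipation.
The divergence theorem leaves only interface terms, which the jump conditions reduce to the power
`λ κ V_Γ` of the surface tension (`Data.IsSolutionOn.integral_divergence_flux_add`), and this is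
compensated by the first variation of area. Everything is proved in integrated form,
`E(b) - E(a) = -∫ₐᵇ (dissipation)` (`Data.IsSolutionOn.bulkEnergy_add_area_sub`); since the
dissipation is a continuous function of time, the energy is differentiable. Mass conservation is
the transport theorem for a constant density.

The regions have no smooth boundary, because the interface may meet the wall at any angle, even
tangentially. Transport, divergence theorem and first variation of area are therefore obtained from
volume integrals over the whole space, in which the indicator function of a phase is replaced by a
smooth function `step n` of `φ` and the container by a cutoff.

* `tendsto_integral_delta_surface`: with `delta n` approximating the Dirac mass,
  `∫ delta n (φ x) F x dx` tends to the integral of `F / |∇φ|` over `{φ = 0}` with respect to the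
  Hausdorff measure. Locally the level set is a graph over its tangent plane, whose parametrization
  changes areas by a factor as close to `1` as desired.
* The integrals of `delta n ∘ φ` over the container are bounded, uniformly in time and for large
  `n` (`exists_integral_delta_le`), by integration by parts against `∇φ`. This gives domination for
  limits under time integrals, and a uniform bound for the area.
* Integration by parts is carried out for `step n ∘ φ`, or for `delta n ∘ φ` times `|∇φ|` in the
  case of area (`integral_deriv_delta_norm`), multiplied by a cutoff that vanishes near the wall.
  The error due to the cutoff disappears in the limit for two reasons. The energy flux is tangential
  to the wall, and the layers in which the cutoffs vary have volume `O(1/n)`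
  (`tendsto_integral_fderiv_cutoff`). The velocity satisfies `|u| ≤ C |wall|`
  (`IsMovingDomain.exists_velocity_bound`), so transport through the layers is bounded and
  dominated convergence applies. This bound holds in spite of contact lines: a segment from a point
  of one phase to the wall may end in the other phase, but the velocities agree where it crosses the
  interface.

The resulting tools are `IsMovingDomain.transport`, `IsMovingDomain.integral_divergence` and
`IsMovingDomain.area_evolution`. They are stated for fields that are smooth on the whole space-time;
composing all fields with a smooth map of the time axis into `(0, T)` that is the identity near the
given time reduces the theorem to this case.
-/

noncomputable section

namespace TwoPhaseMHD

open Filter Topology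

/-! ### Divergence and integration by parts -/

lemma pderiv_apply {F : Type*} [NormedAddCommGroup F] [NormedSpace ℝ F] (i : Fin 3) (f : E3 → F)
    (x : E3) : pderiv i f x = fderiv ℝ f x (EuclideanSpace.single i 1) := rfl

lemma sum_smul_single (v : E3) : ∑ i, v i • (EuclideanSpace.single i (1 : ℝ) : E3) = v := by
  ext j
  fin_cases j <;> simp [Fin.sum_univ_three]

/-- A linear form evaluated on a vector, through the values on the standard basis. -/
lemma clm_apply_eq_sum {F : Type*} [NormedAddCommGroup F] [NormedSpace ℝ F] (L : E3 →L[ℝ] F)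
    (v : E3) : L v = ∑ i, v i • L (EuclideanSpace.single i 1) := by
  conv_lhs => rw [← sum_smul_single v]
  simp

lemma fderiv_coord {F : E3 → E3} {x : E3} (hF : DifferentiableAt ℝ F x) (i : Fin 3) (v : E3) :
    fderiv ℝ (fun y => F y i) x v = fderiv ℝ F x v i := by
  have h := ((EuclideanSpace.proj i : E3 →L[ℝ] ℝ).hasFDerivAt.comp x hF.hasFDerivAt).fderiv
  have : (fun y => F y i) = (EuclideanSpace.proj i : E3 →L[ℝ] ℝ) ∘ F := rfl
  rw [this, h]; rfl

lemma divergence_smul {ψ : E3 → ℝ} {F : E3 → E3} {x : E3} (hψ : DifferentiableAt ℝ ψ x)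
    (hF : DifferentiableAt ℝ F x) :
    divergence (fun y => ψ y • F y) x = ψ x * divergence F x + fderiv ℝ ψ x (F x) := by
  unfold divergence
  rw [clm_apply_eq_sum (fderiv ℝ ψ x) (F x), Finset.mul_sum, ← Finset.sum_add_distrib]
  refine Finset.sum_congr rfl fun i _ => ?_
  rw [pderiv_apply, pderiv_apply, fderiv_fun_smul hψ hF]
  simp [mul_comm]

lemma divergence_sub {F G : E3 → E3} {x : E3} (hF : DifferentiableAt ℝ F x)
    (hG : DifferentiableAt ℝ G x) :
    divergence (fun y => F y - G y) x = divergence F x - divergence G x := by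
  unfold divergence
  rw [← Finset.sum_sub_distrib]
  refine Finset.sum_congr rfl fun i _ => ?_
  rw [pderiv_apply, fderiv_fun_sub hF hG]; rfl

lemma continuous_divergence {F : E3 → E3} (hF : ContDiff ℝ 1 F) :
    Continuous (divergence F) := by
  have h := hF.continuous_fderiv one_ne_zero
  unfold divergence pderiv
  fun_prop

lemma hasCompactSupport_divergence {F : E3 → E3} (hF : HasCompactSupport F) :
    HasCompactSupport (divergence F) := by
  refine (hF.fderiv (𝕜 := ℝ)).mono ?_
  intro x hx h
  apply hx
  simp only [divergence, pderiv, h]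
  simp

lemma integral_fderiv_apply_eq_zero {f : E3 → ℝ} (hf : ContDiff ℝ 1 f) (hc : HasCompactSupport f)
    (v : E3) : ∫ x, fderiv ℝ f x v = 0 := by
  have hcont := hf.continuous_fderiv one_ne_zero
  have h := integral_mul_fderiv_eq_neg_fderiv_mul_of_integrable (μ := (volume : Measure E3))
    (f := fun _ => (1 : ℝ)) (g := f) (v := v) (by simp)
    (by
      simp only [one_mul]
      refine Continuous.integrable_of_hasCompactSupport (by fun_prop) ?_
      refine (hc.fderiv (𝕜 := ℝ)).mono fun x hx h => hx ?_
      simp [h])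
    (by simpa using hf.continuous.integrable_of_hasCompactSupport hc)
    (fun x _ => by fun_prop) (fun x _ => (hf.differentiable one_ne_zero).differentiableAt)
  simpa using h

/-- The divergence theorem for compactly supported fields. -/
lemma integral_divergence_eq_zero {F : E3 → E3} (hF : ContDiff ℝ 1 F) (hc : HasCompactSupport F) :
    ∫ x, divergence F x = 0 := by
  have hcont := hF.continuous_fderiv one_ne_zero
  have hd : Differentiable ℝ F := hF.differentiable one_ne_zero
  have hi : ∀ i : Fin 3, HasCompactSupport fun y => F y i := fun i =>
    hc.mono fun x hx h => hx (by simp [h])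
  have hs : ∀ i : Fin 3, ContDiff ℝ 1 fun y => F y i := fun i => by fun_prop
  simp only [divergence, pderiv]
  rw [integral_finsetSum]
  · refine Finset.sum_eq_zero fun i _ => ?_
    rw [← integral_fderiv_apply_eq_zero (hs i) (hi i) (EuclideanSpace.single i 1)]
    simp_rw [fderiv_coord hd.differentiableAt]
  · intro i _
    refine Continuous.integrable_of_hasCompactSupport (by fun_prop) ?_
    refine (hc.fderiv (𝕜 := ℝ)).mono fun x hx h => hx ?_
    simp [h]

/-- Integration by parts of a directional derivative against a compactly supported field. -/
lemma integral_fderiv_apply_field {a : E3 → ℝ} {F : E3 → E3} (ha : ContDiff ℝ 1 a)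
    (hF : ContDiff ℝ 1 F) (hc : HasCompactSupport F) :
    ∫ x, fderiv ℝ a x (F x) = -∫ x, a x * divergence F x := by
  have h := integral_divergence_eq_zero (ha.smul hF) (hc.smul_left (f := a))
  have hac := ha.continuous_fderiv one_ne_zero
  have hpt : ∀ x, divergence (a • F) x
      = a x * divergence F x + fderiv ℝ a x (F x) := fun x =>
    divergence_smul (ha.differentiable one_ne_zero x) (hF.differentiable one_ne_zero x)
  have h1 : Integrable fun x => a x * divergence F x :=
    (ha.continuous.mul (continuous_divergence hF)).integrable_of_hasCompactSupport
      (hasCompactSupport_divergence hc).mul_left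
  have h2 : Integrable fun x => fderiv ℝ a x (F x) := by
    refine (hac.clm_apply hF.continuous).integrable_of_hasCompactSupport ?_
    refine hc.mono fun x hx h => hx ?_
    simp [h]
  rw [integral_congr_ae (Eventually.of_forall hpt), integral_add h1 h2] at h
  exact eq_neg_of_add_eq_zero_right h

/-! ### Mollified Dirac masses and Heaviside functions -/

/-- Smooth bumps on the line with support `[-1/(n+1), 1/(n+1)]`. -/
def bumpAt (n : ℕ) : ContDiffBump (0 : ℝ) where
  rIn := 1 / (2 * (n + 1))
  rOut := 1 / (n + 1)
  rIn_pos := by positivity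
  rIn_lt_rOut := by
    apply one_div_lt_one_div_of_lt <;> nlinarith [(Nat.cast_nonneg n : (0 : ℝ) ≤ n)]

/-- An even smooth approximation of the Dirac mass at `0`, supported in `[-1/(n+1), 1/(n+1)]`. -/
def delta (n : ℕ) (s : ℝ) : ℝ := (bumpAt n).normed volume s

/-- The primitive of `delta n`, a smooth approximation of the Heaviside function. -/
def step (n : ℕ) (s : ℝ) : ℝ := ∫ y in (-1)..s, delta n y

lemma delta_nonneg (n : ℕ) (s : ℝ) : 0 ≤ delta n s := (bumpAt n).nonneg_normed s

lemma contDiff_delta (n : ℕ) {m : ℕ∞} : ContDiff ℝ m (delta n) := (bumpAt n).contDiff_normed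

lemma continuous_delta (n : ℕ) : Continuous (delta n) := (bumpAt n).continuous_normed

lemma delta_neg (n : ℕ) (s : ℝ) : delta n (-s) = delta n s := (bumpAt n).normed_neg s

lemma delta_eq_zero {n : ℕ} {s : ℝ} (h : 1 / ((n : ℝ) + 1) ≤ |s|) : delta n s = 0 := by
  have : s ∉ Function.support ((bumpAt n).normed volume) := by
    rw [ContDiffBump.support_normed_eq]
    simpa [bumpAt] using h
  rw [Function.notMem_support] at this
  exact this

/-- The mass of `delta n` is spread over an interval of length `2 / (n + 1)`, so its peak value is
at least the mean. -/
lemma le_delta_zero (n : ℕ) : ((n : ℝ) + 1) / 2 ≤ delta n 0 := by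
  have h1 := (bumpAt n).integral_le_measure_closedBall (μ := volume)
  have h2 := (bumpAt n).integral_pos (μ := volume)
  have h3 : (bumpAt n) 0 = 1 :=
    (bumpAt n).one_of_mem_closedBall (by simpa using (bumpAt n).rIn_pos.le)
  have h4 : volume.real (Metric.closedBall (0 : ℝ) (bumpAt n).rOut) = 2 / (n + 1) := by
    rw [Real.volume_real_closedBall (bumpAt n).rOut_pos.le]; simp [bumpAt]; ring
  rw [h4] at h1
  rw [delta, ContDiffBump.normed_def, h3]
  rw [show ((n : ℝ) + 1) / 2 = 1 / (2 / (n + 1)) by field_simp]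
  exact one_div_le_one_div_of_le h2 h1

lemma hasDerivAt_step (n : ℕ) (s : ℝ) : HasDerivAt (step n) (delta n s) s :=
  intervalIntegral.integral_hasDerivAt_right ((continuous_delta n).intervalIntegrable _ _)
    ((continuous_delta n).stronglyMeasurableAtFilter _ _) (continuous_delta n).continuousAt

lemma contDiff_step (n : ℕ) : ContDiff ℝ 2 (step n) := by
  rw [show (2 : WithTop ℕ∞) = 1 + 1 by norm_num, contDiff_succ_iff_deriv]
  refine ⟨fun s => (hasDerivAt_step n s).differentiableAt, by simp, ?_⟩
  rw [funext fun s => (hasDerivAt_step n s).deriv]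
  exact contDiff_delta n (m := 1)

lemma continuous_step (n : ℕ) : Continuous (step n) := (contDiff_step n).continuous

lemma monotone_step (n : ℕ) : Monotone (step n) :=
  monotone_of_deriv_nonneg (fun s => (hasDerivAt_step n s).differentiableAt) fun s => by
    rw [(hasDerivAt_step n s).deriv]; exact delta_nonneg n s

lemma step_one (n : ℕ) : step n 1 = 1 := by
  rw [step, intervalIntegral.integral_eq_integral_of_support_subset]
  · exact (bumpAt n).integral_normed
  · intro s hs
    by_contra h
    apply hs
    apply delta_eq_zero
    have h1 : 1 / ((n : ℝ) + 1) ≤ 1 := by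
      rw [div_le_one (by positivity)]; linarith [(Nat.cast_nonneg n : (0 : ℝ) ≤ n)]
    refine h1.trans ?_
    by_contra h2
    have := abs_lt.1 (not_le.1 h2)
    exact h ⟨this.1, this.2.le⟩

/-- `step n - 1 / 2` is odd, because `delta n` is even. -/
lemma step_add_step_neg (n : ℕ) (s : ℝ) : step n s + step n (-s) = 1 := by
  have hd : ∀ s, HasDerivAt (fun s => step n s + step n (-s)) 0 s := fun s => by
    have h := (hasDerivAt_step n s).add ((hasDerivAt_step n (-s)).comp s (hasDerivAt_neg s))
    have h' : delta n s + delta n (-s) * -1 = 0 := by rw [delta_neg]; ring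
    rw [h'] at h
    exact h
  have h := is_const_of_deriv_eq_zero (fun s => (hd s).differentiableAt) (fun s => (hd s).deriv) s 1
  refine h.trans ?_
  rw [step_one, step]
  simp

lemma step_eq_one {n : ℕ} {s : ℝ} (h : 1 / ((n : ℝ) + 1) ≤ s) : step n s = 1 := by
  have h1 : 1 / ((n : ℝ) + 1) ≤ 1 := by
    rw [div_le_one (by positivity)]; linarith [(Nat.cast_nonneg n : (0 : ℝ) ≤ n)]
  have : ∫ y in s..1, delta n y = 0 := by
    rw [intervalIntegral.integral_congr (g := fun _ => 0), intervalIntegral.integral_zero]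
    intro y hy
    apply delta_eq_zero
    have : 1 / ((n : ℝ) + 1) ≤ y := (le_min h h1).trans hy.1
    exact this.trans (le_abs_self y)
  have h2 := intervalIntegral.integral_add_adjacent_intervals
    ((continuous_delta n).intervalIntegrable (-1) s (μ := volume))
    ((continuous_delta n).intervalIntegrable s 1)
  have h3 := step_one n
  unfold step at h3 ⊢
  linarith

lemma step_eq_zero {n : ℕ} {s : ℝ} (h : s ≤ -(1 / ((n : ℝ) + 1))) : step n s = 0 := by
  have := step_add_step_neg n s
  rw [step_eq_one (s := -s) (by linarith)] at this
  linarith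

lemma step_nonneg (n : ℕ) (s : ℝ) : 0 ≤ step n s := by
  have h := monotone_step n (min_le_left s (-(1 / ((n : ℝ) + 1))))
  rwa [step_eq_zero (min_le_right _ _)] at h

lemma step_le_one (n : ℕ) (s : ℝ) : step n s ≤ 1 := by
  linarith [step_add_step_neg n s, step_nonneg n (-s)]

lemma tendsto_inv_nat_succ : Tendsto (fun n : ℕ => 1 / ((n : ℝ) + 1)) atTop (𝓝 0) :=
  tendsto_one_div_add_atTop_nhds_zero_nat

lemma eventually_inv_lt {r : ℝ} (hr : 0 < r) : ∀ᶠ n : ℕ in atTop, 1 / ((n : ℝ) + 1) < r :=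
  tendsto_inv_nat_succ.eventually_lt_const hr

/-! ### Integrals depending on time -/

lemma continuous_integral_of_support {G : ℝ → E3 → ℝ} (hG : Continuous fun q : ℝ × E3 => G q.1 q.2)
    {K : Set E3} (hK : IsCompact K) (h0 : ∀ τ, ∀ x ∉ K, G τ x = 0) :
    Continuous fun τ => ∫ x, G τ x := by
  have h := continuous_parametric_integral_of_continuous (μ := (volume : Measure E3)) (f := G) hG hK
  refine h.congr fun τ => ?_
  exact setIntegral_eq_integral_of_forall_compl_eq_zero fun x hx => h0 τ x hx

/-- The time derivative of a slice is a derivative of the function on space-time. -/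
lemma deriv_slice {F : Type*} [NormedAddCommGroup F] [NormedSpace ℝ F] {f : ℝ → E3 → F} {τ : ℝ}
    {x : E3} (hf : DifferentiableAt ℝ (fun q : ℝ × E3 => f q.1 q.2) (τ, x)) :
    HasDerivAt (fun τ => f τ x) (fderiv ℝ (fun q : ℝ × E3 => f q.1 q.2) (τ, x) (1, 0)) τ := by
  have h2 : HasDerivAt (fun τ : ℝ => (τ, x)) (1, 0) τ :=
    (hasDerivAt_id τ).prodMk (hasDerivAt_const τ x)
  exact hf.hasFDerivAt.comp_hasDerivAt τ h2

lemma fderiv_slice {F : Type*} [NormedAddCommGroup F] [NormedSpace ℝ F] {f : ℝ → E3 → F} {τ : ℝ}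
    {x : E3} (hf : DifferentiableAt ℝ (fun q : ℝ × E3 => f q.1 q.2) (τ, x)) :
    HasFDerivAt (f τ) ((fderiv ℝ (fun q : ℝ × E3 => f q.1 q.2) (τ, x)).comp
      (ContinuousLinearMap.inr ℝ ℝ E3)) x := by
  have h2 : HasFDerivAt (fun x : E3 => (τ, x)) (ContinuousLinearMap.inr ℝ ℝ E3) x :=
    hasFDerivAt_prodMk_right τ x
  exact hf.hasFDerivAt.comp x h2

lemma contDiff_slice {F : Type*} [NormedAddCommGroup F] [NormedSpace ℝ F] {f : ℝ → E3 → F}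
    {m : WithTop ℕ∞} (hf : ContDiff ℝ m fun q : ℝ × E3 => f q.1 q.2) (τ : ℝ) :
    ContDiff ℝ m (f τ) :=
  hf.comp (contDiff_prodMk_right τ)

lemma contDiff_deriv_slice {F : Type*} [NormedAddCommGroup F] [NormedSpace ℝ F] {f : ℝ → E3 → F}
    {m n : WithTop ℕ∞} (hf : ContDiff ℝ n fun q : ℝ × E3 => f q.1 q.2) (hmn : m + 1 ≤ n) :
    ContDiff ℝ m fun q : ℝ × E3 => deriv (fun τ => f τ q.2) q.1 := by
  have hn : n ≠ 0 := by rintro rfl; simp at hmn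
  have h : (fun q : ℝ × E3 => deriv (fun τ => f τ q.2) q.1) = fun q =>
      fderiv ℝ (fun q : ℝ × E3 => f q.1 q.2) q (1, 0) :=
    funext fun q => (deriv_slice (hf.differentiable hn (q.1, q.2))).deriv
  rw [h]
  exact (hf.fderiv_right hmn).clm_apply contDiff_const

lemma contDiff_fderiv_slice {F : Type*} [NormedAddCommGroup F] [NormedSpace ℝ F] {f : ℝ → E3 → F}
    {m n : WithTop ℕ∞} (hf : ContDiff ℝ n fun q : ℝ × E3 => f q.1 q.2) (hmn : m + 1 ≤ n) :
    ContDiff ℝ m fun q : ℝ × E3 => fderiv ℝ (f q.1) q.2 := by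
  have hn : n ≠ 0 := by rintro rfl; simp at hmn
  have h : (fun q : ℝ × E3 => fderiv ℝ (f q.1) q.2) = fun q =>
      (fderiv ℝ (fun q : ℝ × E3 => f q.1 q.2) q).comp (ContinuousLinearMap.inr ℝ ℝ E3) :=
    funext fun q => (fderiv_slice (hf.differentiable hn (q.1, q.2))).fderiv
  rw [h]
  exact (hf.fderiv_right hmn).clm_comp contDiff_const

lemma continuous_divergence_slice {F : ℝ → E3 → E3}
    (hF : ContDiff ℝ 1 fun q : ℝ × E3 => F q.1 q.2) :
    Continuous fun q : ℝ × E3 => divergence (F q.1) q.2 := by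
  have h := (contDiff_fderiv_slice (m := 0) hF (by simp)).continuous
  unfold divergence pderiv
  fun_prop

lemma continuous_deriv_slice {F : Type*} [NormedAddCommGroup F] [NormedSpace ℝ F] {f : ℝ → E3 → F}
    (hf : ContDiff ℝ 1 fun q : ℝ × E3 => f q.1 q.2) :
    Continuous fun q : ℝ × E3 => deriv (fun τ => f τ q.2) q.1 :=
  (contDiff_deriv_slice (m := 0) hf (by simp)).continuous

lemma continuous_fderiv_slice {F : Type*} [NormedAddCommGroup F] [NormedSpace ℝ F] {f : ℝ → E3 → F}
    (hf : ContDiff ℝ 1 fun q : ℝ × E3 => f q.1 q.2) :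
    Continuous fun q : ℝ × E3 => fderiv ℝ (f q.1) q.2 :=
  (contDiff_fderiv_slice (m := 0) hf (by simp)).continuous

/-- The increment of `∫ F τ` between two times, by differentiation under the integral sign. -/
lemma integral_sub_integral_eq {F : ℝ → E3 → ℝ} (hF : ContDiff ℝ 1 fun q : ℝ × E3 => F q.1 q.2)
    {K : Set E3} (hK : IsCompact K) (h0 : ∀ τ, ∀ x ∉ K, F τ x = 0) (a b : ℝ) :
    (∫ x, F b x) - ∫ x, F a x = ∫ τ in a..b, ∫ x, deriv (fun τ => F τ x) τ := by
  have hFc := continuous_deriv_slice hF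
  have hd0 : ∀ τ, ∀ x ∉ K, deriv (fun τ => F τ x) τ = 0 := fun τ x hx => by
    rw [show (fun τ => F τ x) = fun _ => 0 from funext fun τ => h0 τ x hx]; simp
  have hcont := continuous_integral_of_support hFc hK hd0
  refine (intervalIntegral.integral_eq_sub_of_hasDerivAt (f := fun τ => ∫ x, F τ x)
    (fun τ _ => ?_) (hcont.intervalIntegrable _ _)).symm
  obtain ⟨C, hC⟩ := ((isCompact_Icc (a := τ - 1) (b := τ + 1)).prod hK).exists_bound_of_continuousOn
    hFc.continuousOn
  have hint : ∀ f : E3 → ℝ, Continuous f → (∀ x ∉ K, f x = 0) → Integrable f := fun f hf h =>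
    hf.integrable_of_hasCompactSupport (HasCompactSupport.intro hK h)
  refine (hasDerivAt_integral_of_dominated_loc_of_deriv_le (bound := K.indicator fun _ => C)
    (F := F) (F' := fun τ x => deriv (fun τ => F τ x) τ)
    (s := Icc (τ - 1) (τ + 1)) (Icc_mem_nhds (by linarith) (by linarith)) ?_ ?_ ?_ ?_ ?_ ?_).2
  · exact Eventually.of_forall fun τ => (contDiff_slice hF τ).continuous.aestronglyMeasurable
  · exact hint _ (contDiff_slice hF τ).continuous (h0 τ)
  · exact (hFc.comp (by fun_prop : Continuous fun x : E3 => (τ, x))).aestronglyMeasurable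
  · refine Eventually.of_forall fun x σ hσ => ?_
    by_cases hx : x ∈ K
    · rw [indicator_of_mem hx]; exact hC (σ, x) ⟨hσ, hx⟩
    · rw [indicator_of_notMem hx, hd0 σ x hx, norm_zero]
  · exact (integrable_indicator_iff hK.measurableSet).2
      (integrableOn_const hK.measure_lt_top.ne)
  · refine Eventually.of_forall fun x σ _ => ?_
    exact (deriv_slice (f := F) (hF.differentiable one_ne_zero (σ, x))).differentiableAt.hasDerivAt

/-! ### Dirac masses along a monotone function of one variable -/

section OneDim

variable {f f' G : ℝ → ℝ} {α β γ c : ℝ}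

lemma integral_delta_comp_mul_deriv (hαβ : α ≤ β)
    (hf : ∀ s ∈ Icc α β, HasDerivAt f (f' s) s) (hf' : ContinuousOn f' (Icc α β)) (n : ℕ) :
    ∫ s in α..β, delta n (f s) * f' s = step n (f β) - step n (f α) := by
  rw [← uIcc_of_le hαβ] at hf hf'
  refine intervalIntegral.integral_eq_sub_of_hasDerivAt (f := fun s => step n (f s))
    (fun s hs => ?_) ?_
  · exact (hasDerivAt_step n (f s)).comp s (hf s hs)
  · refine ContinuousOn.intervalIntegrable (ContinuousOn.mul ?_ hf')
    exact (continuous_delta n).comp_continuousOn fun s hs =>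
      (hf s hs).continuousAt.continuousWithinAt

lemma abs_integral_delta_comp_le (hαβ : α ≤ β)
    (hf : ∀ s ∈ Icc α β, HasDerivAt f (f' s) s) (hf' : ContinuousOn f' (Icc α β))
    (hc : ∀ s ∈ Icc α β, 0 ≤ f' s) (n : ℕ) {M : ℝ} (hM : 0 ≤ M)
    (hG : ∀ s ∈ Icc α β, delta n (f s) ≠ 0 → |G s| ≤ M) :
    |∫ s in α..β, delta n (f s) * f' s * G s| ≤ M := by
  have hcont : ContinuousOn (fun s => delta n (f s) * f' s) (Icc α β) :=
    ((continuous_delta n).comp_continuousOn fun s hs =>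
      (hf s hs).continuousAt.continuousWithinAt).mul hf'
  have h1 : ‖∫ s in α..β, delta n (f s) * f' s * G s‖
      ≤ ∫ s in α..β, delta n (f s) * f' s * M := by
    refine intervalIntegral.norm_integral_le_of_norm_le hαβ (Eventually.of_forall fun s hs => ?_) ?_
    · have hs' := Ioc_subset_Icc_self hs
      rw [Real.norm_eq_abs, abs_mul, abs_of_nonneg (mul_nonneg (delta_nonneg _ _) (hc s hs'))]
      by_cases h : delta n (f s) = 0
      · simp [h]
      · exact mul_le_mul_of_nonneg_left (hG s hs' h) (mul_nonneg (delta_nonneg _ _) (hc s hs'))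
    · exact (hcont.mul continuousOn_const).intervalIntegrable_of_Icc hαβ
  rw [intervalIntegral.integral_mul_const, integral_delta_comp_mul_deriv hαβ hf hf'] at h1
  refine h1.trans ?_
  have := step_nonneg n (f α)
  have := step_le_one n (f β)
  nlinarith

/-- Along a function with positive derivative and a zero `γ`, the mollified Dirac masses
concentrate at `γ`. -/
lemma tendsto_integral_delta_comp (hγ : γ ∈ Ioo α β)
    (hf : ∀ s ∈ Icc α β, HasDerivAt f (f' s) s) (hf' : ContinuousOn f' (Icc α β))
    (hc0 : 0 < c) (hc : ∀ s ∈ Icc α β, c ≤ f' s) (hz : f γ = 0)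
    (hG : ContinuousOn G (Icc α β)) :
    Tendsto (fun n => ∫ s in α..β, delta n (f s) * f' s * G s) atTop (𝓝 (G γ)) := by
  have hαβ : α ≤ β := (hγ.1.trans hγ.2).le
  have hγ' : γ ∈ Icc α β := Ioo_subset_Icc_self hγ
  have hcf : ContinuousOn f (Icc α β) := fun s hs => (hf s hs).continuousAt.continuousWithinAt
  have hmv : ∀ s ∈ Icc α β, ∀ t ∈ Icc α β, s ≤ t → c * (t - s) ≤ f t - f s := by
    refine (convex_Icc α β).mul_sub_le_image_sub_of_le_deriv hcf ?_ ?_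
    · exact fun s hs => (hf s (interior_subset hs)).differentiableAt.differentiableWithinAt
    · intro s hs
      rw [(hf s (interior_subset hs)).deriv]
      exact hc s (interior_subset hs)
  have hdist : ∀ s ∈ Icc α β, c * |s - γ| ≤ |f s| := by
    intro s hs
    rcases le_total s γ with h | h
    · have := hmv s hs γ hγ' h
      rw [hz] at this
      rw [abs_of_nonpos (by linarith)]
      have := neg_abs_le (f s)
      linarith
    · have := hmv γ hγ' s hs h
      rw [hz] at this
      rw [abs_of_nonneg (by linarith)]
      have := le_abs_self (f s)
      linarith
  have hβ : 0 < f β := by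
    have := hmv γ hγ' β (right_mem_Icc.2 hαβ) hγ.2.le
    nlinarith [hγ.2]
  have hα : f α < 0 := by
    have := hmv α (left_mem_Icc.2 hαβ) γ hγ' hγ.1.le
    nlinarith [hγ.1]
  rw [Metric.tendsto_atTop']
  intro ε hε
  obtain ⟨r, hr, hrG⟩ := Metric.continuousWithinAt_iff.1 (hG γ hγ') (ε / 2) (by linarith)
  obtain ⟨N, hN⟩ := eventually_atTop.1 ((eventually_inv_lt (mul_pos hc0 hr)).and
    ((eventually_inv_lt hβ).and (eventually_inv_lt (neg_pos.2 hα))))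
  refine ⟨N, fun n hn => ?_⟩
  obtain ⟨h1, h2, h3⟩ := hN n hn.le
  have hcd : ContinuousOn (fun s => delta n (f s) * f' s) (Icc α β) :=
    ((continuous_delta n).comp_continuousOn hcf).mul hf'
  have hone : ∫ s in α..β, delta n (f s) * f' s = 1 := by
    rw [integral_delta_comp_mul_deriv hαβ hf hf', step_eq_one h2.le, step_eq_zero (by linarith)]
    ring
  have hdiff : (∫ s in α..β, delta n (f s) * f' s * G s) - G γ
      = ∫ s in α..β, delta n (f s) * f' s * (G s - G γ) := by
    simp_rw [mul_sub]
    rw [intervalIntegral.integral_sub, intervalIntegral.integral_mul_const, hone, one_mul]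
    · exact (hcd.mul hG).intervalIntegrable_of_Icc hαβ
    · exact (hcd.mul continuousOn_const).intervalIntegrable_of_Icc hαβ
  rw [Real.dist_eq, hdiff]
  refine (abs_integral_delta_comp_le hαβ hf hf' (fun s hs => hc0.le.trans (hc s hs)) n
    (M := ε / 2) (by linarith) fun s hs hd => ?_).trans_lt (by linarith)
  have hlt : |f s| < 1 / ((n : ℝ) + 1) := by
    by_contra h
    exact hd (delta_eq_zero (not_lt.1 h))
  have := hdist s hs
  have hsr : |s - γ| < r := by
    by_contra h
    nlinarith
  exact (hrG hs hsr).le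

end OneDim

/-! ### Hausdorff measure of Lipschitz images -/

lemma euclideanHausdorffMeasure_image_le {X Y : Type*} [EMetricSpace X] [MeasurableSpace X]
    [BorelSpace X] [EMetricSpace Y] [MeasurableSpace Y] [BorelSpace Y] {K : NNReal} {f : X → Y}
    {s : Set X} (hf : LipschitzOnWith K f s) (d : ℕ) :
    Measure.euclideanHausdorffMeasure d (f '' s)
      ≤ (K : ENNReal) ^ d * Measure.euclideanHausdorffMeasure d s := by
  rw [Measure.euclideanHausdorffMeasure_def, Measure.euclideanHausdorffMeasure_def]
  have h := hf.hausdorffMeasure_image_le (d := d) (Nat.cast_nonneg d)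
  rw [ENNReal.rpow_natCast] at h
  simp only [Measure.smul_apply, ENNReal.smul_def, smul_eq_mul]
  rw [mul_left_comm]
  gcongr

/-! ### Coordinates adapted to a unit vector -/

/-- The Euclidean plane. -/
abbrev E2 : Type := EuclideanSpace ℝ (Fin 2)

lemma exists_linearIsometryEquiv_prod {ν : E3} (hν : ‖ν‖ = 1) :
    ∃ e : WithLp 2 (ℝ × E2) ≃ₗᵢ[ℝ] E3, e (WithLp.toLp 2 (1, 0)) = ν := by
  have hdim : Module.finrank ℝ (WithLp 2 (ℝ × E2)) = Module.finrank ℝ E3 := by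
    rw [(WithLp.linearEquiv 2 ℝ (ℝ × E2)).finrank_eq]; simp
  let e₀ : WithLp 2 (ℝ × E2) ≃ₗᵢ[ℝ] E3 :=
    (stdOrthonormalBasis ℝ _).equiv (stdOrthonormalBasis ℝ _) (finCongr hdim)
  have h1 : ‖e₀ (WithLp.toLp 2 (1, 0))‖ = ‖ν‖ := by
    rw [LinearIsometryEquiv.norm_map, hν, WithLp.prod_norm_eq_of_L2]
    simp
  refine ⟨e₀.trans (ℝ ∙ (e₀ (WithLp.toLp 2 (1, 0)) - ν))ᗮ.reflection, ?_⟩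
  exact Submodule.reflection_sub h1

/-- Cartesian coordinates `(s, y)` centred at `x₀`, with `s` measured in the direction `ν`. -/
lemma exists_adapted_coordinates (x₀ : E3) {ν : E3} (hν : ‖ν‖ = 1) :
    ∃ Ψ : ℝ × E2 ≃ₜ E3, MeasurePreserving Ψ ∧ Ψ (0, 0) = x₀ ∧
      (∀ s y, Ψ (s, y) = Ψ (0, y) + s • ν) ∧
      (∀ p q, ‖Ψ p - Ψ q‖ ^ 2 = (p.1 - q.1) ^ 2 + ‖p.2 - q.2‖ ^ 2) ∧
      ∀ p q, inner ℝ ν (Ψ p - Ψ q) = p.1 - q.1 := by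
  obtain ⟨e, he⟩ := exists_linearIsometryEquiv_prod hν
  let Ψ : ℝ × E2 ≃ₜ E3 := (WithLp.homeomorphProd 2 ℝ E2).symm.trans
    (e.toHomeomorph.trans (Homeomorph.addLeft x₀))
  have hΨ : ∀ p, Ψ p = x₀ + e (WithLp.toLp 2 p) := fun p => rfl
  have hsub : ∀ p q, Ψ p - Ψ q = e (WithLp.toLp 2 (p - q)) := fun p q => by
    rw [hΨ, hΨ, add_sub_add_left_eq_sub, ← map_sub]; rfl
  refine ⟨Ψ, ?_, ?_, ?_, ?_, ?_⟩
  · have h1 : MeasurePreserving (WithLp.toLp 2 : ℝ × E2 → WithLp 2 (ℝ × E2)) := by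
      have h := WithLp.volume_preserving_ofLp ℝ E2
      exact h.symm (WithLp.homeomorphProd 2 ℝ E2).toMeasurableEquiv
    exact ((measurePreserving_add_left volume x₀).comp e.measurePreserving).comp h1
  · rw [hΨ, show WithLp.toLp 2 ((0 : ℝ), (0 : E2)) = 0 from rfl]; simp
  · intro s y
    rw [hΨ, hΨ, ← he, ← map_smul, add_assoc, ← map_add]
    congr 2
    rw [← WithLp.toLp_smul, ← WithLp.toLp_add]
    congr 1
    ext <;> simp
  · intro p q
    rw [hsub, LinearIsometryEquiv.norm_map, WithLp.prod_norm_sq_eq_of_L2]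
    simp
  · intro p q
    rw [hsub, ← he, LinearIsometryEquiv.inner_map_map, WithLp.prod_inner_apply]
    simp

/-! ### The surface measure of a level set as a limit of volume integrals -/

/-- Two-dimensional Hausdorff measure on a Lipschitz graph compared with Lebesgue measure on the
base: `P` is a contraction and a left inverse on `B` of the `K`-Lipschitz parametrization `g`. -/
lemma graph_measure_comparison {B : Set E2} (hB : MeasurableSet B) {g : E2 → E3} {K : NNReal}
    (hg : LipschitzOnWith K g B) {P : E3 → E2} (hP : LipschitzWith 1 P)
    (hPg : ∀ y ∈ B, P (g y) = y) :
    ((volume.restrict B).map g ≤ (Measure.euclideanHausdorffMeasure 2).restrict (g '' B)) ∧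
    (Measure.euclideanHausdorffMeasure 2).restrict (g '' B)
      ≤ (K : ENNReal) ^ 2 • (volume.restrict B).map g := by
  have hgm : AEMeasurable g (volume.restrict B) := hg.continuousOn.aemeasurable hB
  constructor
  · refine Measure.le_iff.2 fun S hS => ?_
    rw [Measure.map_apply_of_aemeasurable hgm hS, Measure.restrict_apply' hB,
      Measure.restrict_apply hS, ← EuclideanSpace.euclideanHausdorffMeasure_eq_volume]
    have hsub : g ⁻¹' S ∩ B ⊆ P '' (S ∩ g '' B) := fun y hy =>
      ⟨g y, ⟨hy.1, mem_image_of_mem g hy.2⟩, hPg y hy.2⟩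
    refine (measure_mono hsub).trans ?_
    have h := euclideanHausdorffMeasure_image_le (hP.lipschitzOnWith (s := S ∩ g '' B)) 2
    simpa using h
  · refine Measure.le_iff.2 fun S hS => ?_
    rw [Measure.smul_apply, Measure.map_apply_of_aemeasurable hgm hS, Measure.restrict_apply' hB,
      Measure.restrict_apply hS, ← EuclideanSpace.euclideanHausdorffMeasure_eq_volume]
    have hsub : S ∩ g '' B ⊆ g '' (g ⁻¹' S ∩ B) := by
      rintro _ ⟨hxS, y, hy, rfl⟩
      exact ⟨y, ⟨hxS, hy⟩, rfl⟩
    refine (measure_mono hsub).trans ?_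
    exact euclideanHausdorffMeasure_image_le (hg.mono inter_subset_right) 2

/-- Fubini in adapted coordinates, and the one-dimensional limit on every line parallel to the
axis of a cylinder in which the level set is a graph. -/
lemma tendsto_integral_delta_cylinder {φ : E3 → ℝ} (hφ : ContDiff ℝ 1 φ) {ν : E3}
    {Ψ : ℝ × E2 ≃ₜ E3} (hmp : MeasurePreserving Ψ)
    (hline : ∀ s y, Ψ (s, y) = Ψ (0, y) + s • ν) {r c : ℝ} (hc0 : 0 < c) {B : Set E2}
    (hB : MeasurableSet B) (hBfin : volume B ≠ ⊤)
    (hc : ∀ s ∈ Icc (-r) r, ∀ y ∈ B, c ≤ fderiv ℝ φ (Ψ (s, y)) ν) {γ : E2 → ℝ}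
    (hγ : ∀ y ∈ B, γ y ∈ Ioo (-r) r) (hγ0 : ∀ y ∈ B, φ (Ψ (γ y, y)) = 0)
    {F : E3 → ℝ} (hF : Continuous F) (hFc : HasCompactSupport F)
    (hsupp : ∀ s y, ¬ (s ∈ Ioo (-r) r ∧ y ∈ B) → F (Ψ (s, y)) = 0) :
    Tendsto (fun n => ∫ x, delta n (φ x) * F x) atTop
      (𝓝 (∫ y in B, F (Ψ (γ y, y)) / fderiv ℝ φ (Ψ (γ y, y)) ν)) := by
  have hdφ := hφ.continuous_fderiv one_ne_zero
  have hΨ := Ψ.continuous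
  obtain ⟨M, hM⟩ := hF.bounded_above_of_compact_support hFc
  have hM0 : 0 ≤ M := (norm_nonneg _).trans (hM 0)
  have hcontn : ∀ n, Continuous fun x => delta n (φ x) * F x := fun n =>
    ((continuous_delta n).comp hφ.continuous).mul hF
  have hfub : ∀ n, ∫ x, delta n (φ x) * F x
      = ∫ y in B, ∫ s in (-r)..r, delta n (φ (Ψ (s, y))) * F (Ψ (s, y)) := by
    intro n
    rw [← hmp.integral_comp Ψ.measurableEmbedding, Measure.volume_eq_prod, integral_prod_symm]
    · rw [← setIntegral_eq_integral_of_forall_compl_eq_zero (s := B)]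
      · refine setIntegral_congr_fun hB fun y hy => ?_
        refine (intervalIntegral.integral_eq_integral_of_support_subset fun s hs => ?_).symm
        by_contra h
        apply hs
        change delta n (φ (Ψ (s, y))) * F (Ψ (s, y)) = 0
        rw [hsupp s y fun h' => h (Ioo_subset_Ioc_self h'.1), mul_zero]
      · intro y hy
        have : ∀ s, F (Ψ (s, y)) = 0 := fun s => hsupp s y fun h => hy h.2
        simp [this]
    · rw [← Measure.volume_eq_prod]
      refine Continuous.integrable_of_hasCompactSupport ((hcontn n).comp hΨ) ?_
      exact (hFc.mul_left (f := fun x => delta n (φ x))).comp_homeomorph Ψ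
  simp_rw [hfub]
  have hder : ∀ y s, HasDerivAt (fun s => φ (Ψ (s, y))) (fderiv ℝ φ (Ψ (s, y)) ν) s := by
    intro y s
    have h1 : HasDerivAt (fun s : ℝ => Ψ (s, y)) ν s := by
      rw [show (fun s : ℝ => Ψ (s, y)) = fun s => Ψ (0, y) + s • ν from funext fun s => hline s y]
      simpa using ((hasDerivAt_id s).smul_const ν).const_add (Ψ (0, y))
    exact (hφ.differentiable one_ne_zero (Ψ (s, y))).hasFDerivAt.comp_hasDerivAt s h1
  have hdc : Continuous fun q : ℝ × E2 => fderiv ℝ φ (Ψ q) ν := by fun_prop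
  -- the factor `∂_ν φ` needed for the substitution is inserted by hand
  have hrew : ∀ n, ∀ y ∈ B, (∫ s in (-r)..r, delta n (φ (Ψ (s, y))) * F (Ψ (s, y)))
      = ∫ s in (-r)..r, delta n (φ (Ψ (s, y))) * fderiv ℝ φ (Ψ (s, y)) ν
        * (F (Ψ (s, y)) / fderiv ℝ φ (Ψ (s, y)) ν) := by
    intro n y hy
    have hr : -r ≤ r := ((hγ y hy).1.trans (hγ y hy).2).le
    refine intervalIntegral.integral_congr fun s hs => ?_
    rw [uIcc_of_le hr] at hs
    have := hc0.trans_le (hc s hs y hy)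
    field_simp
  refine tendsto_integral_filter_of_dominated_convergence (fun _ => M / c) ?_ ?_ ?_ ?_
  · refine Eventually.of_forall fun n => ?_
    have : Continuous fun y : E2 => ∫ s in (-r)..r, delta n (φ (Ψ (s, y))) * F (Ψ (s, y)) := by
      refine intervalIntegral.continuous_parametric_intervalIntegral_of_continuous' ?_ _ _
      exact (hcontn n).comp (hΨ.comp continuous_swap)
    exact this.aestronglyMeasurable
  · refine Eventually.of_forall fun n =>
      (ae_restrict_iff' hB).2 (Eventually.of_forall fun y hy => ?_)
    have hr : -r ≤ r := ((hγ y hy).1.trans (hγ y hy).2).le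
    rw [hrew n y hy]
    refine abs_integral_delta_comp_le hr (fun s _ => hder y s)
      (hdc.comp (Continuous.prodMk_left y)).continuousOn
      (fun s hs => hc0.le.trans (hc s hs y hy)) n (by positivity) fun s hs _ => ?_
    rw [abs_div, abs_of_pos (hc0.trans_le (hc s hs y hy))]
    exact div_le_div₀ hM0 (hM _) hc0 (hc s hs y hy)
  · exact integrableOn_const hBfin
  · refine (ae_restrict_iff' hB).2 (Eventually.of_forall fun y hy => ?_)
    refine (tendsto_integral_delta_comp (hγ y hy) (fun s _ => hder y s)
      (hdc.comp (Continuous.prodMk_left y)).continuousOn hc0 (fun s hs => hc s hs y hy) (hγ0 y hy)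
      (G := fun s => F (Ψ (s, y)) / fderiv ℝ φ (Ψ (s, y)) ν) ?_).congr fun n => (hrew n y hy).symm
    refine ContinuousOn.div ?_ ?_ fun s hs => (hc0.trans_le (hc s hs y hy)).ne'
    · exact (hF.comp (hΨ.comp (Continuous.prodMk_left y))).continuousOn
    · exact (hdc.comp (Continuous.prodMk_left y)).continuousOn

lemma norm_gradient_eq (f : E3 → ℝ) (x : E3) : ‖gradient f x‖ = ‖fderiv ℝ f x‖ := by
  simp [gradient]

lemma inner_gradient_eq (f : E3 → ℝ) (x v : E3) : inner ℝ (gradient f x) v = fderiv ℝ f x v := by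
  simp [gradient]

/-- Near a regular point the level set is a graph over its tangent plane, in a cylinder on which
the gradient is nearly constant and the parametrization nearly isometric (up to a factor
`C > 1`). -/
lemma exists_local_graph {φ : E3 → ℝ} (hφ : ContDiff ℝ 1 φ) {x₀ : E3} (h0 : φ x₀ = 0)
    (hreg : fderiv ℝ φ x₀ ≠ 0) {C : ℝ} (hC : 1 < C) :
    ∃ (ν : E3) (Ψ : ℝ × E2 ≃ₜ E3) (r' r c : ℝ) (γ : E2 → ℝ), ‖ν‖ = 1 ∧ MeasurePreserving Ψ ∧
      Ψ (0, 0) = x₀ ∧ (∀ s y, Ψ (s, y) = Ψ (0, y) + s • ν) ∧ 0 < r' ∧ 0 < r ∧ 0 < c ∧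
      (∀ s ∈ Icc (-r') r', ∀ y ∈ Metric.ball (0 : E2) r, c ≤ fderiv ℝ φ (Ψ (s, y)) ν ∧
        ‖fderiv ℝ φ (Ψ (s, y))‖ ≤ C * fderiv ℝ φ (Ψ (s, y)) ν) ∧
      (∀ y ∈ Metric.ball (0 : E2) r, γ y ∈ Ioo (-r') r' ∧ φ (Ψ (γ y, y)) = 0) ∧
      {x | φ x = 0} ∩ Ψ '' (Ioo (-r') r' ×ˢ Metric.ball (0 : E2) r)
        = (fun y => Ψ (γ y, y)) '' Metric.ball (0 : E2) r ∧
      LipschitzOnWith (Real.toNNReal (√C)) (fun y => Ψ (γ y, y)) (Metric.ball (0 : E2) r) ∧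
      LipschitzWith 1 fun x => (Ψ.symm x).2 := by
  have hdφ := hφ.continuous_fderiv one_ne_zero
  set m := ‖fderiv ℝ φ x₀‖ with hm
  have hm0 : 0 < m := norm_pos_iff.2 hreg
  -- `δ` is the relative oscillation of `∇φ` for which `(1 + δ) / (1 - δ) = C`
  set δ := (C - 1) / (C + 1) with hδ
  have hδ0 : 0 < δ := div_pos (by linarith) (by linarith)
  have hδ1 : δ < 1 := by rw [hδ, div_lt_one (by linarith)]; linarith
  have hδC : 1 + δ = C * (1 - δ) := by rw [hδ]; field_simp; ring
  set ν : E3 := m⁻¹ • gradient φ x₀ with hν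
  have hν1 : ‖ν‖ = 1 := by
    rw [hν, norm_smul, norm_gradient_eq, ← hm, norm_inv, Real.norm_of_nonneg hm0.le,
      inv_mul_cancel₀ hm0.ne']
  have hL : ∀ v, fderiv ℝ φ x₀ v = m * inner ℝ ν v := fun v => by
    rw [hν, inner_smul_left, inner_gradient_eq]; simp; field_simp
  obtain ⟨Ψ, hmp, hΨ0, hline, hdist, hinner⟩ := exists_adapted_coordinates x₀ hν1
  obtain ⟨R, hR, hosc⟩ : ∃ R > 0, ∀ z ∈ Metric.ball x₀ R,
      ‖fderiv ℝ φ z - fderiv ℝ φ x₀‖ ≤ δ * m := by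
    obtain ⟨R, hR, h⟩ := Metric.continuousAt_iff.1 hdφ.continuousAt (δ * m) (by positivity)
    exact ⟨R, hR, fun z hz => by simpa [dist_eq_norm] using (h hz).le⟩
  have hmean : ∀ x ∈ Metric.ball x₀ R, ∀ y ∈ Metric.ball x₀ R,
      |φ y - φ x - m * inner ℝ ν (y - x)| ≤ δ * m * ‖y - x‖ := fun x hx y hy => by
    have h := (convex_ball x₀ R).norm_image_sub_le_of_norm_fderiv_le' (f := φ)
      (φ := fderiv ℝ φ x₀) (fun z _ => hφ.differentiable one_ne_zero z) hosc hx hy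
    rwa [hL] at h
  have hlow : ∀ z ∈ Metric.ball x₀ R, (1 - δ) * m ≤ fderiv ℝ φ z ν := fun z hz => by
    have h1 := (fderiv ℝ φ z - fderiv ℝ φ x₀).le_opNorm ν
    rw [hν1, mul_one] at h1
    have h2 := (abs_le.1 (h1.trans (hosc z hz))).1
    rw [sub_apply, hL, real_inner_self_eq_norm_sq, hν1] at h2
    linarith
  have hup : ∀ z ∈ Metric.ball x₀ R, ‖fderiv ℝ φ z‖ ≤ (1 + δ) * m := fun z hz => by
    have h1 := norm_le_norm_add_norm_sub' (fderiv ℝ φ z) (fderiv ℝ φ x₀)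
    have h2 := hosc z hz
    linarith
  -- on the level set, distances are controlled by the distances of the tangential coordinates
  have hkey : ∀ p q, Ψ p ∈ Metric.ball x₀ R → Ψ q ∈ Metric.ball x₀ R → φ (Ψ p) = 0 →
      φ (Ψ q) = 0 → ‖Ψ p - Ψ q‖ ^ 2 ≤ C * ‖p.2 - q.2‖ ^ 2 := by
    intro p q hp hq hp0 hq0
    have h1 := hmean _ hq _ hp
    rw [hp0, hq0, hinner, sub_zero, zero_sub, abs_neg, abs_mul, abs_of_pos hm0] at h1
    have h2 : |p.1 - q.1| ≤ δ * ‖Ψ p - Ψ q‖ := by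
      refine le_of_mul_le_mul_left ?_ hm0
      linarith
    have h3 : (p.1 - q.1) ^ 2 ≤ (δ * ‖Ψ p - Ψ q‖) ^ 2 := by
      rw [← sq_abs (p.1 - q.1)]; gcongr
    have h4 := hdist p q
    have h5 : (1 - δ ^ 2) * ‖Ψ p - Ψ q‖ ^ 2 ≤ ‖p.2 - q.2‖ ^ 2 := by nlinarith
    have h6 : 1 ≤ C * (1 - δ ^ 2) := by
      have : C * (1 - δ ^ 2) = (1 + δ) * (1 + δ) := by rw [hδC]; nlinarith [hδC]
      rw [this]; nlinarith
    calc ‖Ψ p - Ψ q‖ ^ 2 ≤ (C * (1 - δ ^ 2)) * ‖Ψ p - Ψ q‖ ^ 2 :=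
          le_mul_of_one_le_left (sq_nonneg _) h6
      _ = C * ((1 - δ ^ 2) * ‖Ψ p - Ψ q‖ ^ 2) := by ring
      _ ≤ C * ‖p.2 - q.2‖ ^ 2 := by gcongr
  set r' := R / 2 with hr'
  have hr'0 : 0 < r' := by positivity
  have hball : ∀ s ∈ Icc (-r') r', ∀ y, ‖y‖ < r' → Ψ (s, y) ∈ Metric.ball x₀ R := by
    intro s hs y hy
    rw [mem_ball_iff_norm]
    have h := hdist (s, y) (0, 0)
    rw [hΨ0] at h
    simp only [sub_zero] at h
    have h1 : s ^ 2 ≤ r' ^ 2 := sq_le_sq' hs.1 hs.2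
    have h2 : ‖y‖ ^ 2 < r' ^ 2 := by gcongr
    refine lt_of_pow_lt_pow_left₀ 2 hR.le ?_
    rw [h]
    nlinarith
  have hφΨ : Continuous fun q : ℝ × E2 => φ (Ψ q) := hφ.continuous.comp Ψ.continuous
  have hends : ∀ s : ℝ, |φ (Ψ (s, 0)) - m * s| ≤ δ * m * |s| ∨ r' < |s| := by
    intro s
    by_cases hs : r' < |s|
    · exact Or.inr hs
    · left
      have hs' := hball s (abs_le.1 (not_lt.1 hs)) 0 (by simpa using hr'0)
      have h := hmean x₀ (Metric.mem_ball_self hR) _ hs'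
      have h2 : Ψ (s, 0) - x₀ = s • ν := by rw [hline s 0, hΨ0]; simp
      rw [h0, h2, inner_smul_right, real_inner_self_eq_norm_sq, hν1, norm_smul, hν1] at h
      simpa using h
  have hpos : 0 < φ (Ψ (r', 0)) := by
    have h := (hends r').resolve_right (by rw [abs_of_pos hr'0]; exact lt_irrefl _)
    rw [abs_of_pos hr'0] at h
    nlinarith [(abs_le.1 h).1, mul_pos hm0 hr'0]
  have hneg : φ (Ψ (-r', 0)) < 0 := by
    have h := (hends (-r')).resolve_right (by rw [abs_neg, abs_of_pos hr'0]; exact lt_irrefl _)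
    rw [abs_neg, abs_of_pos hr'0] at h
    nlinarith [(abs_le.1 h).2, mul_pos hm0 hr'0]
  obtain ⟨r, hr, hrr, hrsign⟩ : ∃ r > 0, r ≤ r' ∧ ∀ y ∈ Metric.ball (0 : E2) r,
      φ (Ψ (-r', y)) < 0 ∧ 0 < φ (Ψ (r', y)) := by
    have h1 : ∀ᶠ y in 𝓝 (0 : E2), 0 < φ (Ψ (r', y)) :=
      (hφΨ.comp (Continuous.prodMk_right r')).continuousAt.eventually_const_lt hpos
    have h2 : ∀ᶠ y in 𝓝 (0 : E2), φ (Ψ (-r', y)) < 0 :=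
      (hφΨ.comp (Continuous.prodMk_right (-r'))).continuousAt.eventually_lt_const hneg
    obtain ⟨r, hr, h⟩ := Metric.eventually_nhds_iff_ball.1 (h2.and h1)
    exact ⟨min r r', lt_min hr hr'0, min_le_right _ _, fun y hy =>
      h y (Metric.ball_subset_ball (min_le_left _ _) hy)⟩
  set B := Metric.ball (0 : E2) r with hB
  have hBball : ∀ s ∈ Icc (-r') r', ∀ y ∈ B, Ψ (s, y) ∈ Metric.ball x₀ R := fun s hs y hy =>
    hball s hs y ((mem_ball_zero_iff.1 hy).trans_le hrr)
  have hex : ∀ y : E2, ∃ s : ℝ, y ∈ B → s ∈ Ioo (-r') r' ∧ φ (Ψ (s, y)) = 0 := by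
    intro y
    by_cases hy : y ∈ B
    · obtain ⟨s, hs, hs0⟩ := intermediate_value_Ioo (by linarith : -r' ≤ r')
        (hφΨ.comp (Continuous.prodMk_left y)).continuousOn (hrsign y hy)
      exact ⟨s, fun _ => ⟨hs, hs0⟩⟩
    · exact ⟨0, fun h => absurd h hy⟩
  choose γ hγ using hex
  set g : E2 → E3 := fun y => Ψ (γ y, y) with hg
  have hgball : ∀ y ∈ B, g y ∈ Metric.ball x₀ R := fun y hy =>
    hBball _ (Ioo_subset_Icc_self (hγ y hy).1) y hy
  have hgraph : {x | φ x = 0} ∩ Ψ '' (Ioo (-r') r' ×ˢ B) = g '' B := by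
    apply Subset.antisymm
    · rintro _ ⟨hx0, ⟨⟨s, y⟩, ⟨hs, hy⟩, rfl⟩⟩
      refine ⟨y, hy, ?_⟩
      have h := hkey (γ y, y) (s, y) (hgball y hy) (hBball s (Ioo_subset_Icc_self hs) y hy)
        (hγ y hy).2 hx0
      rw [show (γ y, y).2 - (s, y).2 = 0 from sub_self y, norm_zero, zero_pow two_ne_zero,
        mul_zero] at h
      exact sub_eq_zero.1 (norm_eq_zero.1 (pow_eq_zero_iff two_ne_zero |>.1
        (le_antisymm h (sq_nonneg _))))
    · rintro _ ⟨y, hy, rfl⟩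
      exact ⟨(hγ y hy).2, mem_image_of_mem Ψ ⟨(hγ y hy).1, hy⟩⟩
  have hgLip : LipschitzOnWith (Real.toNNReal (√C)) g B := by
    refine LipschitzOnWith.of_dist_le_mul fun y hy z hz => ?_
    have h := hkey (γ y, y) (γ z, z) (hgball y hy) (hgball z hz) (hγ y hy).2 (hγ z hz).2
    rw [dist_eq_norm, dist_eq_norm, Real.coe_toNNReal _ (Real.sqrt_nonneg _)]
    refine (pow_le_pow_iff_left₀ (norm_nonneg _) (by positivity) two_ne_zero).1 ?_
    rw [mul_pow, Real.sq_sqrt (by linarith)]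
    exact h
  have hP : LipschitzWith 1 fun x => (Ψ.symm x).2 := by
    refine LipschitzWith.of_dist_le_mul fun x y => ?_
    have h := hdist (Ψ.symm x) (Ψ.symm y)
    rw [Ψ.apply_symm_apply, Ψ.apply_symm_apply] at h
    rw [dist_eq_norm, dist_eq_norm, NNReal.coe_one, one_mul]
    exact (pow_le_pow_iff_left₀ (norm_nonneg _) (norm_nonneg _) two_ne_zero).1
      (by nlinarith [sq_nonneg ((Ψ.symm x).1 - (Ψ.symm y).1)])
  refine ⟨ν, Ψ, r', r, (1 - δ) * m, γ, hν1, hmp, hΨ0, hline, hr'0, hr, mul_pos (by linarith) hm0,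
    fun s hs y hy => ?_, hγ, hgraph, hgLip, hP⟩
  have hz := hBball s hs y hy
  refine ⟨hlow _ hz, ?_⟩
  calc _ ≤ (1 + δ) * m := hup _ hz
    _ = C * ((1 - δ) * m) := by rw [hδC]; ring
    _ ≤ _ := by have := hlow _ hz; gcongr

/-- Near a regular point the level set is a graph over its tangent plane, with constants as close
to those of the plane as desired: the limit of the mollified Dirac masses and the surface integral
agree up to a factor `C > 1`. -/
lemma exists_local_surface_estimate {φ : E3 → ℝ} (hφ : ContDiff ℝ 1 φ) {x₀ : E3} (h0 : φ x₀ = 0)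
    (hreg : fderiv ℝ φ x₀ ≠ 0) {C : ℝ} (hC : 1 < C) :
    ∃ U : Set E3, IsOpen U ∧ x₀ ∈ U ∧
      Measure.euclideanHausdorffMeasure 2 ({x | φ x = 0} ∩ U) < ⊤ ∧
      ∀ F : E3 → ℝ, Continuous F → HasCompactSupport F → (∀ x, 0 ≤ F x) → (∀ x ∉ U, F x = 0) →
        Integrable (fun x => F x / ‖fderiv ℝ φ x‖)
          ((Measure.euclideanHausdorffMeasure 2).restrict {x | φ x = 0}) ∧
        ∃ J, Tendsto (fun n => ∫ x, delta n (φ x) * F x) atTop (𝓝 J) ∧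
          (∫ x in {x | φ x = 0}, F x / ‖fderiv ℝ φ x‖
            ∂Measure.euclideanHausdorffMeasure 2) ≤ C * J ∧
          J ≤ C * ∫ x in {x | φ x = 0}, F x / ‖fderiv ℝ φ x‖
            ∂Measure.euclideanHausdorffMeasure 2 := by
  have hdφ := hφ.continuous_fderiv one_ne_zero
  obtain ⟨ν, Ψ, r', r, c, γ, hν1, hmp, hΨ0, hline, hr'0, hr, hc0, hgrad, hγ, hgraph, hgLip, hP⟩ :=
    exists_local_graph hφ h0 hreg hC
  set B := Metric.ball (0 : E2) r with hB
  set g : E2 → E3 := fun y => Ψ (γ y, y) with hg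
  set U : Set E3 := Ψ '' (Ioo (-r') r' ×ˢ B) with hU
  have hnn : ∀ z, fderiv ℝ φ z ν ≤ ‖fderiv ℝ φ z‖ := fun z => by
    have h1 := (fderiv ℝ φ z).le_opNorm ν
    rw [hν1, mul_one] at h1
    exact (le_abs_self _).trans h1
  have hgI : ∀ y ∈ B, γ y ∈ Icc (-r') r' := fun y hy => Ioo_subset_Icc_self (hγ y hy).1
  have hK2 : (Real.toNNReal (√C) : ENNReal) ^ 2 = ENNReal.ofReal C := by
    rw [← ENNReal.ofReal, ← ENNReal.ofReal_pow (Real.sqrt_nonneg _), Real.sq_sqrt (by linarith)]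
  have hBm : MeasurableSet B := Metric.isOpen_ball.measurableSet
  have hBfin : volume B ≠ ⊤ := measure_ball_lt_top.ne
  obtain ⟨hle, hge⟩ := graph_measure_comparison hBm hgLip hP (fun y _ => by simp [hg])
  have hgm : AEMeasurable g (volume.restrict B) := hgLip.continuousOn.aemeasurable hBm
  have hfin : Measure.euclideanHausdorffMeasure 2 (g '' B) < ⊤ := by
    refine (euclideanHausdorffMeasure_image_le hgLip 2).trans_lt ?_
    rw [hK2, EuclideanSpace.euclideanHausdorffMeasure_eq_volume]
    exact ENNReal.mul_lt_top ENNReal.ofReal_lt_top hBfin.lt_top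
  have hUo : IsOpen U := Ψ.isOpenMap _ (isOpen_Ioo.prod Metric.isOpen_ball)
  have hUc : ∀ x ∈ U, c ≤ fderiv ℝ φ x ν := by
    rintro _ ⟨⟨s, y⟩, ⟨hs, hy⟩, rfl⟩
    exact (hgrad s (Ioo_subset_Icc_self hs) y hy).1
  have hzm : MeasurableSet {x | φ x = 0} :=
    (isClosed_eq hφ.continuous continuous_const).measurableSet
  refine ⟨U, hUo, ⟨(0, 0), ⟨⟨by linarith, hr'0⟩, Metric.mem_ball_self hr⟩, hΨ0⟩,
    by rw [hgraph]; exact hfin, fun F hF hFc hF0 hFU => ?_⟩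
  obtain ⟨M, hM⟩ := hF.bounded_above_of_compact_support hFc
  set W : E3 → ℝ := fun x => F x / ‖fderiv ℝ φ x‖ with hW
  have hWm : Measurable W := hF.measurable.div hdφ.norm.measurable
  have hWb : ∀ x, ‖W x‖ ≤ M / c := by
    intro x
    by_cases hx : x ∈ U
    · rw [hW, norm_div, norm_norm]
      exact div_le_div₀ ((norm_nonneg _).trans (hM x)) (hM x) hc0
        ((hUc x hx).trans (hnn x))
    · simp only [hW, hFU x hx, zero_div, norm_zero]
      exact div_nonneg ((norm_nonneg _).trans (hM x)) hc0.le
  have hW0 : ∀ x, 0 ≤ W x := fun x => div_nonneg (hF0 x) (norm_nonneg _)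
  have hWint : ∀ μ : Measure E3, IsFiniteMeasure μ → Integrable W μ := fun μ _ =>
    Integrable.of_bound hWm.aestronglyMeasurable _ (Eventually.of_forall hWb)
  have hfin' : IsFiniteMeasure ((Measure.euclideanHausdorffMeasure 2).restrict (g '' B)) :=
    isFiniteMeasure_restrict.2 hfin.ne
  have hBfin' : IsFiniteMeasure (volume.restrict B) := isFiniteMeasure_restrict.2 hBfin
  have hWint1 := hWint _ hfin'
  have hI : ∫ x in {x | φ x = 0}, W x ∂Measure.euclideanHausdorffMeasure 2
      = ∫ x in g '' B, W x ∂Measure.euclideanHausdorffMeasure 2 := by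
    rw [← hgraph]
    refine setIntegral_eq_of_subset_of_forall_sdiff_eq_zero hzm inter_subset_left fun x hx => ?_
    have : x ∉ U := fun h => hx.2 ⟨hx.1, h⟩
    simp [hW, hFU x this]
  have hIint : IntegrableOn W {x | φ x = 0} (Measure.euclideanHausdorffMeasure 2) := by
    have h1 : IntegrableOn W ({x | φ x = 0} ∩ U) (Measure.euclideanHausdorffMeasure 2) := by
      rw [hgraph]; exact hWint1
    refine h1.of_forall_sdiff_eq_zero hzm fun x hx => ?_
    have : x ∉ U := fun h => hx.2 ⟨hx.1, h⟩
    simp [hW, hFU x this]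
  refine ⟨hIint, _, tendsto_integral_delta_cylinder hφ hmp hline hc0 hBm hBfin
    (fun s hs y hy => (hgrad s hs y hy).1) (fun y hy => (hγ y hy).1)
    (fun y hy => (hγ y hy).2) hF hFc ?_, ?_⟩
  · intro s y h
    refine hFU _ fun h' => h ?_
    obtain ⟨p, hp, hpe⟩ := h'
    rw [Ψ.injective hpe] at hp
    exact hp
  have hWg : Integrable (fun y => W (g y)) (volume.restrict B) :=
    Integrable.of_bound (hWm.comp_aemeasurable hgm).aestronglyMeasurable _
      (Eventually.of_forall fun y => hWb _)
  have hWmap : ∫ x, W x ∂((volume.restrict B).map g) = ∫ y in B, W (g y) :=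
    integral_map hgm hWm.aestronglyMeasurable
  have hJlow : ∀ y ∈ B, W (g y) ≤ F (g y) / fderiv ℝ φ (g y) ν := fun y hy =>
    div_le_div_of_nonneg_left (hF0 _) (hc0.trans_le (hgrad _ (hgI y hy) y hy).1) (hnn _)
  have hJup : ∀ y ∈ B, F (g y) / fderiv ℝ φ (g y) ν ≤ C * W (g y) := fun y hy => by
    obtain ⟨h1, h5⟩ := hgrad _ (hgI y hy) y hy
    have h3 := hc0.trans_le h1
    have h4 := h3.trans_le (hnn (g y))
    rw [hW, div_le_iff₀ h3]
    calc F (g y) = F (g y) / ‖fderiv ℝ φ (g y)‖ * ‖fderiv ℝ φ (g y)‖ := by field_simp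
      _ ≤ F (g y) / ‖fderiv ℝ φ (g y)‖ * (C * fderiv ℝ φ (g y) ν) := by
          gcongr; exact hW0 (g y)
      _ = _ := by ring
  have hJint : Integrable (fun y => F (g y) / fderiv ℝ φ (g y) ν) (volume.restrict B) := by
    refine (hWg.const_mul C).mono' ?_
      ((ae_restrict_iff' hBm).2 (Eventually.of_forall fun y hy => ?_))
    · have hq : Measurable fun x => F x / fderiv ℝ φ x ν :=
        hF.measurable.div (hdφ.clm_apply continuous_const).measurable
      exact (hq.comp_aemeasurable hgm).aestronglyMeasurable
    · rw [Real.norm_of_nonneg ((hW0 _).trans (hJlow y hy))]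
      exact hJup y hy
  rw [hI]
  constructor
  · calc ∫ x in g '' B, W x ∂Measure.euclideanHausdorffMeasure 2
        ≤ ∫ x, W x ∂((Real.toNNReal (√C) : ENNReal) ^ 2 • (volume.restrict B).map g) := by
          have : IsFiniteMeasure
              ((Real.toNNReal (√C) : ENNReal) ^ 2 • (volume.restrict B).map g) := by
            rw [hK2]
            exact Measure.smul_finite _ ENNReal.ofReal_ne_top
          exact integral_mono_measure hge (Eventually.of_forall hW0) (hWint _ this)
      _ = C * ∫ y in B, W (g y) := by
          rw [integral_smul_measure, hK2, ENNReal.toReal_ofReal (by linarith), hWmap, smul_eq_mul]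
      _ ≤ _ := by
          refine mul_le_mul_of_nonneg_left ?_ (by linarith)
          exact setIntegral_mono_on hWg hJint hBm hJlow
  · calc ∫ y in B, F (g y) / fderiv ℝ φ (g y) ν ≤ ∫ y in B, C * W (g y) :=
          setIntegral_mono_on hJint (hWg.const_mul C) hBm hJup
      _ = C * ∫ x, W x ∂((volume.restrict B).map g) := by rw [integral_const_mul, hWmap]
      _ ≤ _ := by
          refine mul_le_mul_of_nonneg_left ?_ (by linarith)
          exact integral_mono_measure hle (Eventually.of_forall hW0) hWint1

/-- The local estimate at a point that need not lie on the level set; off the level set both sides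
vanish. -/
lemma exists_surface_estimate_nhds {φ : E3 → ℝ} (hφ : ContDiff ℝ 1 φ) {x₀ : E3}
    (hreg : φ x₀ = 0 → fderiv ℝ φ x₀ ≠ 0) {C : ℝ} (hC : 1 < C) :
    ∃ U : Set E3, IsOpen U ∧ x₀ ∈ U ∧
      Measure.euclideanHausdorffMeasure 2 ({x | φ x = 0} ∩ U) < ⊤ ∧
      ∀ F : E3 → ℝ, Continuous F → HasCompactSupport F → (∀ x, 0 ≤ F x) → (∀ x ∉ U, F x = 0) →
        Integrable (fun x => F x / ‖fderiv ℝ φ x‖)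
          ((Measure.euclideanHausdorffMeasure 2).restrict {x | φ x = 0}) ∧
        ∃ J, Tendsto (fun n => ∫ x, delta n (φ x) * F x) atTop (𝓝 J) ∧
          (∫ x in {x | φ x = 0}, F x / ‖fderiv ℝ φ x‖
            ∂Measure.euclideanHausdorffMeasure 2) ≤ C * J ∧
          J ≤ C * ∫ x in {x | φ x = 0}, F x / ‖fderiv ℝ φ x‖
            ∂Measure.euclideanHausdorffMeasure 2 := by
  by_cases h0 : φ x₀ = 0
  · exact exists_local_surface_estimate hφ h0 (hreg h0) hC
  · have hzm : MeasurableSet {x | φ x = 0} :=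
      (isClosed_eq hφ.continuous continuous_const).measurableSet
    have hr : 0 < |φ x₀| / 2 := by positivity
    refine ⟨{x | |φ x₀| / 2 < |φ x|}, isOpen_lt continuous_const hφ.continuous.abs, ?_, ?_, ?_⟩
    · change |φ x₀| / 2 < |φ x₀|; linarith
    · have : {x | φ x = 0} ∩ {x | |φ x₀| / 2 < |φ x|} = ∅ := by
        ext x
        simp only [mem_inter_iff, mem_ofPred_eq, mem_empty_iff_false, iff_false, not_and, not_lt]
        intro h; rw [h, abs_zero]; exact hr.le
      rw [this, measure_empty]; exact ENNReal.zero_lt_top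
    · intro F hF hFc hF0 hFU
      have hz : ∀ x ∈ {x | φ x = 0}, F x / ‖fderiv ℝ φ x‖ = 0 := by
        intro x hx
        rw [hFU x, zero_div]
        simp only [mem_ofPred_eq] at hx ⊢
        rw [hx, abs_zero]; exact not_lt.2 hr.le
      have hI : ∫ x in {x | φ x = 0}, F x / ‖fderiv ℝ φ x‖
        ∂Measure.euclideanHausdorffMeasure 2 = 0 :=
        setIntegral_eq_zero_of_forall_eq_zero hz
      refine ⟨?_, 0, ?_, by rw [hI, mul_zero], by rw [hI, mul_zero]⟩
      · exact (integrableOn_zero (s := {x | φ x = 0})).congr_fun (fun x hx => (hz x hx).symm) hzm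
      · refine tendsto_const_nhds.congr' ?_
        filter_upwards [eventually_inv_lt hr] with n hn
        refine (integral_eq_zero_of_ae (Eventually.of_forall fun x => ?_)).symm
        by_cases hx : |φ x₀| / 2 < |φ x|
        · simp [delta_eq_zero (hn.trans hx).le]
        · simp [hFU x hx]

/-- The zero set of a function with nonvanishing gradient has locally finite area. -/
lemma measure_levelSet_inter_compact_lt_top {φ : E3 → ℝ} (hφ : ContDiff ℝ 1 φ) {K : Set E3}
    (hK : IsCompact K) (hreg : ∀ x ∈ K, φ x = 0 → fderiv ℝ φ x ≠ 0) :
    Measure.euclideanHausdorffMeasure 2 ({x | φ x = 0} ∩ K) < ⊤ := by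
  refine hK.induction_on (p := fun S =>
    Measure.euclideanHausdorffMeasure 2 ({x | φ x = 0} ∩ S) < ⊤) (by simp) ?_ ?_ ?_
  · intro s t hst ht
    exact (measure_mono (inter_subset_inter_right _ hst)).trans_lt ht
  · intro s t hs ht
    rw [inter_union_distrib_left]
    exact (measure_union_le _ _).trans_lt (ENNReal.add_lt_top.2 ⟨hs, ht⟩)
  · intro x hx
    obtain ⟨U, hU, hxU, hfin, -⟩ := exists_surface_estimate_nhds hφ (hreg x hx) one_lt_two
    exact ⟨U, mem_nhdsWithin_of_mem_nhds (hU.mem_nhds hxU), hfin⟩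

/-- The local estimates assembled by a partition of unity. -/
lemma exists_surface_estimate {φ : E3 → ℝ} (hφ : ContDiff ℝ 1 φ) {F : E3 → ℝ} (hF : Continuous F)
    (hFc : HasCompactSupport F) (hF0 : ∀ x, 0 ≤ F x)
    (hreg : ∀ x ∈ tsupport F, φ x = 0 → fderiv ℝ φ x ≠ 0) {C : ℝ} (hC : 1 < C) :
    Integrable (fun x => F x / ‖fderiv ℝ φ x‖)
      ((Measure.euclideanHausdorffMeasure 2).restrict {x | φ x = 0}) ∧
    ∃ J, Tendsto (fun n => ∫ x, delta n (φ x) * F x) atTop (𝓝 J) ∧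
      (∫ x in {x | φ x = 0}, F x / ‖fderiv ℝ φ x‖ ∂Measure.euclideanHausdorffMeasure 2) ≤ C * J ∧
      J ≤ C * ∫ x in {x | φ x = 0}, F x / ‖fderiv ℝ φ x‖ ∂Measure.euclideanHausdorffMeasure 2 := by
  have hK : IsCompact (tsupport F) := hFc
  have hloc : ∀ x : tsupport F, φ x = 0 → fderiv ℝ φ x ≠ 0 := fun x => hreg x x.2
  choose U hUo hxU _ hU using fun x : tsupport F => exists_surface_estimate_nhds hφ (hloc x) hC
  obtain ⟨t, ht⟩ := hK.elim_finite_subcover U hUo fun x hx => mem_iUnion.2 ⟨⟨x, hx⟩, hxU _⟩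
  obtain ⟨p, hpU, hp1, hp01, hpc⟩ := exists_continuous_sum_one_of_isOpen_isCompact
    (s := fun i : Fin t.card => U (t.equivFin.symm i)) (fun i => hUo _) hK (by
      intro x hx
      obtain ⟨i, hi, hxi⟩ := mem_iUnion₂.1 (ht hx)
      exact mem_iUnion.2 ⟨t.equivFin ⟨i, hi⟩, by simpa using hxi⟩)
  have hsum : ∀ x, F x = ∑ i, p i x * F x := by
    intro x
    rw [← Finset.sum_mul]
    by_cases hx : x ∈ tsupport F
    · have h := hp1 hx
      simp only [Finset.sum_apply, Pi.one_apply] at h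
      rw [h, one_mul]
    · rw [image_eq_zero_of_notMem_tsupport hx, mul_zero]
  have hpi : ∀ i, Continuous fun x => p i x * F x := fun i => (p i).continuous.mul hF
  have key := fun i => hU (t.equivFin.symm i) (fun x => p i x * F x) (hpi i) hFc.mul_left
    (fun x => mul_nonneg (hp01 i x).1 (hF0 x)) fun x hx => by
      rw [image_eq_zero_of_notMem_tsupport fun h => hx (hpU i h), zero_mul]
  choose hint J hJ hJ1 hJ2 using key
  have hW : (fun x => F x / ‖fderiv ℝ φ x‖)
      = fun x => ∑ i, p i x * F x / ‖fderiv ℝ φ x‖ := by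
    funext x
    rw [← Finset.sum_div, ← hsum]
  have hIsum : ∫ x in {x | φ x = 0}, F x / ‖fderiv ℝ φ x‖ ∂Measure.euclideanHausdorffMeasure 2
      = ∑ i, ∫ x in {x | φ x = 0}, p i x * F x / ‖fderiv ℝ φ x‖
        ∂Measure.euclideanHausdorffMeasure 2 := by
    rw [hW, integral_finsetSum _ fun i _ => hint i]
  refine ⟨by rw [hW]; exact integrable_finsetSum _ fun i _ => hint i, ∑ i, J i, ?_, ?_, ?_⟩
  · refine (tendsto_finsetSum _ fun i _ => hJ i).congr fun n => ?_
    rw [← integral_finsetSum]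
    · refine integral_congr_ae (Eventually.of_forall fun x => ?_)
      change ∑ i, delta n (φ x) * (p i x * F x) = delta n (φ x) * F x
      rw [← Finset.mul_sum, ← hsum]
    · intro i _
      refine Continuous.integrable_of_hasCompactSupport ?_ ?_
      · exact ((continuous_delta n).comp hφ.continuous).mul (hpi i)
      · exact (hFc.mul_left (f := p i)).mul_left
  · rw [hIsum, Finset.mul_sum]
    exact Finset.sum_le_sum fun i _ => hJ1 i
  · rw [hIsum, Finset.mul_sum]
    exact Finset.sum_le_sum fun i _ => hJ2 i

lemma le_of_forall_one_lt_mul {a b : ℝ} (h : ∀ C, 1 < C → a ≤ C * b) : a ≤ b := by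
  have ht : Tendsto (fun C : ℝ => C * b) (𝓝[>] 1) (𝓝 (1 * b)) :=
    ((continuous_id.mul continuous_const).tendsto' _ _ rfl).mono_left nhdsWithin_le_nhds
  rw [one_mul] at ht
  exact ge_of_tendsto ht (eventually_mem_nhdsWithin.mono h)

/-- The coarea principle at a single level: mollified Dirac masses of `φ` converge to the surface
measure of `{φ = 0}` divided by `|∇φ|`. -/
theorem tendsto_integral_delta_surface {φ : E3 → ℝ} (hφ : ContDiff ℝ 1 φ) {F : E3 → ℝ}
    (hF : Continuous F) (hFc : HasCompactSupport F)
    (hreg : ∀ x ∈ tsupport F, φ x = 0 → fderiv ℝ φ x ≠ 0) :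
    IntegrableOn (fun x => F x / ‖fderiv ℝ φ x‖) {x | φ x = 0}
      (Measure.euclideanHausdorffMeasure 2) ∧
    Tendsto (fun n => ∫ x, delta n (φ x) * F x) atTop
      (𝓝 (∫ x in {x | φ x = 0}, F x / ‖fderiv ℝ φ x‖ ∂Measure.euclideanHausdorffMeasure 2)) := by
  have hnonneg : ∀ G : E3 → ℝ, Continuous G → HasCompactSupport G → (∀ x, 0 ≤ G x) →
      tsupport G ⊆ tsupport F → IntegrableOn (fun x => G x / ‖fderiv ℝ φ x‖) {x | φ x = 0}
      (Measure.euclideanHausdorffMeasure 2) ∧ Tendsto (fun n => ∫ x, delta n (φ x) * G x) atTop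
      (𝓝 (∫ x in {x | φ x = 0}, G x / ‖fderiv ℝ φ x‖ ∂Measure.euclideanHausdorffMeasure 2)) := by
    intro G hG hGc hG0 hGF
    have key := fun C hC => exists_surface_estimate hφ hG hGc hG0 (fun x hx => hreg x (hGF hx))
      (C := C) hC
    obtain ⟨hint, J, hJ, -, -⟩ := key 2 one_lt_two
    refine ⟨hint, ?_⟩
    set I := ∫ x in {x | φ x = 0}, G x / ‖fderiv ℝ φ x‖ ∂Measure.euclideanHausdorffMeasure 2
    have hle : ∀ C : ℝ, 1 < C → I ≤ C * J ∧ J ≤ C * I := fun C hC => by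
      obtain ⟨-, J', hJ', h12⟩ := key C hC
      rwa [tendsto_nhds_unique hJ' hJ] at h12
    rwa [le_antisymm (le_of_forall_one_lt_mul fun C hC => (hle C hC).1)
      (le_of_forall_one_lt_mul fun C hC => (hle C hC).2)]
  have hsupp : ∀ G : E3 → ℝ, (∀ x, F x = 0 → G x = 0) → Function.support G ⊆ Function.support F :=
    fun G h x hx hF => hx (h x hF)
  have h1 := hnonneg (fun x => max (F x) 0) (hF.max continuous_const)
    (hFc.mono (hsupp _ fun x h => by simp [h])) (fun x => le_max_right _ _)
    (closure_mono (hsupp _ fun x h => by simp [h]))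
  have h2 := hnonneg (fun x => max (-F x) 0) (hF.neg.max continuous_const)
    (hFc.mono (hsupp _ fun x h => by simp [h])) (fun x => le_max_right _ _)
    (closure_mono (hsupp _ fun x h => by simp [h]))
  have hF' : ∀ x, F x = max (F x) 0 - max (-F x) 0 := fun x => by
    rcases le_total (F x) 0 with h | h
    · rw [max_eq_right h, max_eq_left (by linarith)]; ring
    · rw [max_eq_left h, max_eq_right (by linarith)]; ring
  have hW : (fun x => F x / ‖fderiv ℝ φ x‖) = fun x => max (F x) 0 / ‖fderiv ℝ φ x‖
      - max (-F x) 0 / ‖fderiv ℝ φ x‖ := by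
    funext x; rw [← sub_div, ← hF']
  have hint : ∀ n, ∀ G : E3 → ℝ, Continuous G → HasCompactSupport G →
      Integrable fun x => delta n (φ x) * G x := fun n G hG hGc =>
    Continuous.integrable_of_hasCompactSupport
      (((continuous_delta n).comp hφ.continuous).mul hG) hGc.mul_left
  constructor
  · rw [hW]; exact h1.1.sub h2.1
  · rw [hW, integral_sub h1.1 h2.1]
    refine (h1.2.sub h2.2).congr fun n => ?_
    rw [← integral_sub (hint n (fun x => max (F x) 0) (hF.max continuous_const)
        (hFc.mono (hsupp _ fun x h => by simp [h])))
      (hint n (fun x => max (-F x) 0) (hF.neg.max continuous_const)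
        (hFc.mono (hsupp _ fun x h => by simp [h])))]
    refine integral_congr_ae (Eventually.of_forall fun x => ?_)
    change delta n (φ x) * max (F x) 0 - delta n (φ x) * max (-F x) 0 = delta n (φ x) * F x
    rw [← mul_sub, ← hF']

/-! ### Moving regions: bounds uniform in time, and limits of volume integrals -/

/-- The sign of the level set function in a phase. -/
def Phase.sgn : Phase → ℝ
  | .plus => 1
  | .minus => -1

lemma Phase.delta_sgn_mul (s : Phase) (n : ℕ) (y : ℝ) : delta n (s.sgn * y) = delta n y := by
  cases s <;> simp [Phase.sgn, delta_neg]

/-- The part of `O` on which `f` has the sign of the phase `s`. -/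
def signRegion (O : Set E3) (f : E3 → ℝ) (s : Phase) : Set E3 := {x | x ∈ O ∧ 0 < s.sgn * f x}

lemma signRegion_subset (O : Set E3) (f : E3 → ℝ) (s : Phase) : signRegion O f s ⊆ O :=
  fun _ h => h.1

lemma isOpen_signRegion {O : Set E3} (hO : IsOpen O) {f : E3 → ℝ} (hf : Continuous f) (s : Phase) :
    IsOpen (signRegion O f s) :=
  hO.inter (isOpen_lt continuous_const (continuous_const.mul hf))

lemma contDiff_gradient_slice {f : ℝ → E3 → ℝ} (hf : ContDiff ℝ 2 fun q : ℝ × E3 => f q.1 q.2) :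
    ContDiff ℝ 1 fun q : ℝ × E3 => gradient (f q.1) q.2 :=
  (InnerProductSpace.toDual ℝ E3).symm.contDiff.comp (contDiff_fderiv_slice hf (by norm_num))

section Moving

variable {O : Set E3} {φ : ℝ → E3 → ℝ} {a b : ℝ}

/-- Regularity of the level set persists, uniformly in time, on the slab `|φ| ≤ r`. -/
lemma exists_gradient_lower_bound (hO : Bornology.IsBounded O)
    (hφ : ContDiff ℝ 2 fun q : ℝ × E3 => φ q.1 q.2)
    (hreg : ∀ τ ∈ Icc a b, ∀ x ∈ closure O, φ τ x = 0 → fderiv ℝ (φ τ) x ≠ 0) :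
    ∃ c > 0, ∃ r > 0, ∀ τ ∈ Icc a b, ∀ x ∈ closure O, |φ τ x| ≤ r → c ≤ ‖fderiv ℝ (φ τ) x‖ := by
  have hK : IsCompact (Icc a b ×ˢ closure O) := isCompact_Icc.prod hO.isCompact_closure
  have hd := continuous_fderiv_slice (hφ.of_le one_le_two)
  obtain ⟨m, hm, h⟩ := hK.exists_forall_le' (f := fun q : ℝ × E3 =>
    max |φ q.1 q.2| ‖fderiv ℝ (φ q.1) q.2‖) (hφ.continuous.abs.max hd.norm).continuousOn (a := 0)
    (by
      rintro ⟨τ, x⟩ ⟨hτ, hx⟩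
      by_cases h0 : φ τ x = 0
      · exact lt_max_of_lt_right (norm_pos_iff.2 (hreg τ hτ x hx h0))
      · exact lt_max_of_lt_left (abs_pos.2 h0))
  refine ⟨m, hm, m / 2, by linarith, fun τ hτ x hx hr => ?_⟩
  rcases le_max_iff.1 (h (τ, x) ⟨hτ, hx⟩) with h' | h'
  · simp only at h'; linarith
  · exact h'

lemma exists_cutoff_of_bounded (hO : Bornology.IsBounded O) :
    ∃ ζ : E3 → ℝ, ContDiff ℝ 2 ζ ∧ HasCompactSupport ζ ∧ (∀ x, 0 ≤ ζ x) ∧ ∀ x ∈ O, ζ x = 1 := by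
  obtain ⟨R, hR⟩ := hO.subset_closedBall (0 : E3)
  let f : ContDiffBump (0 : E3) := ⟨max R 1, max R 1 + 1, by positivity, by linarith⟩
  exact ⟨f, f.contDiff, f.hasCompactSupport, fun x => f.nonneg, fun x hx =>
    f.one_of_mem_closedBall (Metric.closedBall_subset_closedBall (le_max_left _ _) (hR hx))⟩

/-- The mass of the mollified Dirac masses is bounded uniformly in time, by integration by parts
against `ζ ∇φ`. -/
lemma exists_integral_delta_le (hOo : IsOpen O) (hO : Bornology.IsBounded O)
    (hφ : ContDiff ℝ 2 fun q : ℝ × E3 => φ q.1 q.2)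
    (hreg : ∀ τ ∈ Icc a b, ∀ x ∈ closure O, φ τ x = 0 → fderiv ℝ (φ τ) x ≠ 0) :
    ∃ C, 0 ≤ C ∧ ∀ᶠ n in atTop, ∀ τ ∈ Icc a b, ∫ x in O, delta n (φ τ x) ≤ C := by
  obtain ⟨c, hc, r, hr, hlow⟩ := exists_gradient_lower_bound hO hφ hreg
  obtain ⟨ζ, hζ, hζc, hζ0, hζ1⟩ := exists_cutoff_of_bounded hO
  set F : ℝ → E3 → E3 := fun τ x => ζ x • gradient (φ τ) x with hF
  have hFs : ContDiff ℝ 1 fun q : ℝ × E3 => F q.1 q.2 :=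
    ((hζ.of_le one_le_two).comp contDiff_snd).smul (contDiff_gradient_slice hφ)
  have hFc : ∀ τ, HasCompactSupport (F τ) := fun τ => hζc.smul_right
  have hdiv := continuous_divergence_slice hFs
  obtain ⟨M, hM⟩ := ((isCompact_Icc (a := a) (b := b)).prod hζc).exists_bound_of_continuousOn
    hdiv.continuousOn
  have hdiv0 : ∀ τ, ∀ x ∉ tsupport ζ, divergence (F τ) x = 0 := by
    intro τ x hx
    have : F τ =ᶠ[𝓝 x] fun _ => 0 := by
      filter_upwards [(isClosed_tsupport ζ).isOpen_compl.mem_nhds hx] with y hy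
      simp only [hF, image_eq_zero_of_notMem_tsupport hy, zero_smul]
    simp only [divergence, pderiv, this.fderiv_eq]
    simp
  set V := volume.real (tsupport ζ) with hV
  have hbound : ∀ n, ∀ τ ∈ Icc a b,
      ∫ x, delta n (φ τ x) * (ζ x * ‖fderiv ℝ (φ τ) x‖ ^ 2) ≤ |M| * V := by
    intro n τ hτ
    have hstep : ContDiff ℝ 1 fun x => step n (φ τ x) :=
      ((contDiff_step n).of_le one_le_two).comp ((contDiff_slice hφ τ).of_le one_le_two)
    have h1 : ∀ x, fderiv ℝ (fun x => step n (φ τ x)) x (F τ x)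
        = delta n (φ τ x) * (ζ x * ‖fderiv ℝ (φ τ) x‖ ^ 2) := by
      intro x
      have h2 := ((hasDerivAt_step n (φ τ x)).comp_hasFDerivAt x
        ((contDiff_slice hφ τ).differentiable two_ne_zero x).hasFDerivAt).fderiv
      change fderiv ℝ (step n ∘ φ τ) x (F τ x) = _
      rw [h2, smul_apply, hF, smul_eq_mul]
      simp only [map_smul, smul_eq_mul]
      rw [← inner_gradient_eq, real_inner_self_eq_norm_sq, norm_gradient_eq]
    have h2 := integral_fderiv_apply_field hstep (contDiff_slice hFs τ) (hFc τ)
    simp_rw [h1] at h2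
    rw [h2, ← integral_neg, ← setIntegral_eq_integral_of_forall_compl_eq_zero (s := tsupport ζ)
      (fun x hx => by rw [hdiv0 τ x hx]; simp)]
    refine (le_abs_self _).trans ?_
    rw [hV, ← Real.norm_eq_abs]
    refine norm_setIntegral_le_of_norm_le_const hζc.measure_lt_top fun x hx => ?_
    rw [norm_neg, norm_mul, Real.norm_of_nonneg (step_nonneg _ _)]
    have := hM (τ, x) ⟨hτ, hx⟩
    have h3 := step_le_one n (φ τ x)
    have h4 := norm_nonneg (divergence (F τ) x)
    have h5 := le_abs_self M
    calc _ ≤ 1 * ‖divergence (F τ) x‖ := by gcongr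
      _ ≤ |M| := by rw [one_mul]; exact this.trans h5
  have hV0 : 0 ≤ V := measureReal_nonneg
  refine ⟨|M| * V / c ^ 2, by positivity, ?_⟩
  filter_upwards [eventually_inv_lt hr] with n hn τ hτ
  have hd := (contDiff_slice hφ τ).continuous_fderiv two_ne_zero
  have hcφ := (contDiff_slice hφ τ).continuous
  have hcont : Continuous fun x => delta n (φ τ x) * (ζ x * ‖fderiv ℝ (φ τ) x‖ ^ 2) :=
    ((continuous_delta n).comp hcφ).mul (hζ.continuous.mul (hd.norm.pow 2))
  have hint : Integrable fun x => delta n (φ τ x) * (ζ x * ‖fderiv ℝ (φ τ) x‖ ^ 2) :=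
    hcont.integrable_of_hasCompactSupport hζc.mul_right.mul_left
  rw [le_div_iff₀ (by positivity)]
  refine le_trans ?_ (hbound n τ hτ)
  calc (∫ x in O, delta n (φ τ x)) * c ^ 2 = ∫ x in O, delta n (φ τ x) * c ^ 2 :=
        (integral_mul_const _ _).symm
    _ ≤ ∫ x in O, delta n (φ τ x) * (ζ x * ‖fderiv ℝ (φ τ) x‖ ^ 2) := by
        refine setIntegral_mono_on ?_ hint.integrableOn hOo.measurableSet fun x hx => ?_
        · have hc1 : Continuous fun x => delta n (φ τ x) * c ^ 2 :=
            ((continuous_delta n).comp hcφ).mul continuous_const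
          exact (hc1.continuousOn.integrableOn_compact hO.isCompact_closure).mono_set subset_closure
        · rw [hζ1 x hx, one_mul]
          by_cases h0 : delta n (φ τ x) = 0
          · simp [h0]
          · have hlt : |φ τ x| ≤ r := by
              by_contra h
              exact h0 (delta_eq_zero (hn.le.trans (not_le.1 h).le))
            have := hlow τ hτ x (subset_closure hx) hlt
            have := delta_nonneg n (φ τ x)
            gcongr
    _ ≤ ∫ x, delta n (φ τ x) * (ζ x * ‖fderiv ℝ (φ τ) x‖ ^ 2) := by
        refine setIntegral_le_integral hint (Eventually.of_forall fun x => ?_)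
        exact mul_nonneg (delta_nonneg _ _) (mul_nonneg (hζ0 x) (sq_nonneg _))

lemma integrableOn_of_continuous (hO : Bornology.IsBounded O) {f : E3 → ℝ} (hf : Continuous f) :
    IntegrableOn f O :=
  (hf.continuousOn.integrableOn_compact hO.isCompact_closure).mono_set subset_closure

/-- The interface is a null set: on it `delta n` is of size `n`, while its integral stays bounded.
-/
lemma volume_levelSet_eq_zero (hOo : IsOpen O) (hO : Bornology.IsBounded O)
    (hφ : ContDiff ℝ 2 fun q : ℝ × E3 => φ q.1 q.2)
    (hreg : ∀ τ ∈ Icc a b, ∀ x ∈ closure O, φ τ x = 0 → fderiv ℝ (φ τ) x ≠ 0) {τ : ℝ}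
    (hτ : τ ∈ Icc a b) : volume (O ∩ {x | φ τ x = 0}) = 0 := by
  obtain ⟨C, -, hC⟩ := exists_integral_delta_le hOo hO hφ hreg
  have hcφ := (contDiff_slice hφ τ).continuous
  have hZm : MeasurableSet (O ∩ {x | φ τ x = 0}) :=
    hOo.measurableSet.inter (isClosed_eq hcφ continuous_const).measurableSet
  have hfin : volume (O ∩ {x | φ τ x = 0}) ≠ ⊤ :=
    ((measure_mono inter_subset_left).trans_lt hO.measure_lt_top).ne
  have h1 : ∀ᶠ n : ℕ in atTop, volume.real (O ∩ {x | φ τ x = 0}) ≤ 2 * C * (1 / ((n : ℝ) + 1)) := by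
    filter_upwards [hC] with n hn
    have hdint : IntegrableOn (fun x => delta n (φ τ x)) O :=
      integrableOn_of_continuous hO ((continuous_delta n).comp hcφ)
    have h2 : ∫ x in O ∩ {x | φ τ x = 0}, delta n (φ τ x) ≤ C := by
      refine le_trans ?_ (hn τ hτ)
      exact setIntegral_mono_set hdint (Eventually.of_forall fun x => delta_nonneg _ _)
        (Eventually.of_forall inter_subset_left)
    rw [setIntegral_congr_fun (g := fun _ => delta n 0) hZm fun x hx => by
      have : φ τ x = 0 := hx.2
      simp only [this], setIntegral_const, smul_eq_mul] at h2
    have h3 := le_delta_zero n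
    have h4 : (0 : ℝ) < n + 1 := by positivity
    have h5 : volume.real (O ∩ {x | φ τ x = 0}) * (((n : ℝ) + 1) / 2) ≤ C := by
      refine le_trans ?_ h2
      gcongr
    rw [mul_one_div, le_div_iff₀ h4]
    linarith
  have h2 := ge_of_tendsto (tendsto_inv_nat_succ.const_mul (2 * C)) h1
  rw [mul_zero] at h2
  have h3 := le_antisymm h2 measureReal_nonneg
  exact (measureReal_eq_zero_iff hfin).1 h3

lemma abs_integral_delta_mul_le {f g : E3 → ℝ} {n : ℕ} {C M : ℝ} (hO : Bornology.IsBounded O)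
    (hf : Continuous f) (hM : 0 ≤ M) (hg : ∀ x ∈ O, |g x| ≤ M) (hg0 : ∀ x ∉ O, g x = 0)
    (hOm : MeasurableSet O) (hC : ∫ x in O, delta n (f x) ≤ C) :
    |∫ x, delta n (f x) * g x| ≤ C * M := by
  rw [← setIntegral_eq_integral_of_forall_compl_eq_zero (s := O)
    (fun x hx => by rw [hg0 x hx, mul_zero])]
  have hint : IntegrableOn (fun x => delta n (f x) * M) O :=
    integrableOn_of_continuous hO (((continuous_delta n).comp hf).mul continuous_const)
  calc |∫ x in O, delta n (f x) * g x| ≤ ∫ x in O, delta n (f x) * M := by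
        rw [← Real.norm_eq_abs]
        refine norm_integral_le_of_norm_le hint ((ae_restrict_iff' hOm).2
          (Eventually.of_forall fun x hx => ?_))
        rw [norm_mul, Real.norm_of_nonneg (delta_nonneg _ _)]
        exact mul_le_mul_of_nonneg_left (hg x hx) (delta_nonneg _ _)
    _ = (∫ x in O, delta n (f x)) * M := integral_mul_const _ _
    _ ≤ C * M := by gcongr

lemma tendsto_step_indicator (s : Phase) {y : ℝ} (hy : y ≠ 0) :
    Tendsto (fun n => step n (s.sgn * y)) atTop (𝓝 (if 0 < s.sgn * y then 1 else 0)) := by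
  have hne : s.sgn * y ≠ 0 := by cases s <;> simpa [Phase.sgn] using hy
  refine tendsto_const_nhds.congr' ?_
  filter_upwards [eventually_inv_lt (abs_pos.2 hne)] with n hn
  split_ifs with h
  · rw [abs_of_pos h] at hn; exact (step_eq_one hn.le).symm
  · rw [abs_of_nonpos (not_lt.1 h)] at hn; exact (step_eq_zero (by linarith)).symm

/-- Mollified Heaviside functions of the level set function localize to a phase. -/
lemma tendsto_integral_step {f : E3 → ℝ} (hf : Continuous f) (hOm : MeasurableSet O)
    (hnull : volume (O ∩ {x | f x = 0}) = 0) (s : Phase) {g : E3 → ℝ} (hg : IntegrableOn g O) :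
    Tendsto (fun n => ∫ x in O, step n (s.sgn * f x) * g x) atTop
      (𝓝 (∫ x in signRegion O f s, g x)) := by
  have hset : signRegion O f s = O ∩ {x | 0 < s.sgn * f x} := rfl
  have hpm : MeasurableSet {x | 0 < s.sgn * f x} :=
    (isOpen_lt continuous_const (by fun_prop)).measurableSet
  rw [hset, ← setIntegral_indicator hpm]
  refine tendsto_integral_filter_of_dominated_convergence (fun x => |g x|) ?_ ?_ hg.abs ?_
  · refine Eventually.of_forall fun n => ?_
    have hstep := (continuous_step n).comp (by fun_prop : Continuous fun x => s.sgn * f x)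
    exact hstep.aestronglyMeasurable.mul hg.aestronglyMeasurable
  · refine Eventually.of_forall fun n => Eventually.of_forall fun x => ?_
    rw [norm_mul, Real.norm_of_nonneg (step_nonneg _ _)]
    exact mul_le_of_le_one_left (norm_nonneg _) (step_le_one _ _)
  · have hae : ∀ᵐ x ∂volume.restrict O, f x ≠ 0 := by
      rw [ae_restrict_iff' hOm, ae_iff]
      refine measure_mono_null (fun x hx => ?_) hnull
      simpa using hx
    filter_upwards [hae] with x hx
    have h := (tendsto_step_indicator s hx).mul_const (g x)
    convert h using 2
    by_cases h0 : 0 < s.sgn * f x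
    · rw [indicator_of_mem (by exact h0), if_pos h0, one_mul]
    · rw [indicator_of_notMem (by exact h0), if_neg h0, zero_mul]

/-- Phase integrals of continuous densities depend continuously on time, since the interface is a
null set. -/
lemma continuousOn_integral_signRegion (hOo : IsOpen O) (hO : Bornology.IsBounded O)
    (hφ : ContDiff ℝ 2 fun q : ℝ × E3 => φ q.1 q.2)
    (hreg : ∀ τ ∈ Icc a b, ∀ x ∈ closure O, φ τ x = 0 → fderiv ℝ (φ τ) x ≠ 0) (s : Phase)
    {f : ℝ → E3 → ℝ} (hf : Continuous fun q : ℝ × E3 => f q.1 q.2) :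
    ContinuousOn (fun τ => ∫ x in signRegion O (φ τ) s, f τ x) (Icc a b) := by
  intro τ₀ hτ₀
  have hpm : ∀ τ, MeasurableSet {x | 0 < s.sgn * φ τ x} := fun τ => by
    have := (contDiff_slice hφ τ).continuous
    exact (isOpen_lt continuous_const (by fun_prop)).measurableSet
  have hset : ∀ τ, ∫ x in signRegion O (φ τ) s, f τ x
      = ∫ x in O, {x | 0 < s.sgn * φ τ x}.indicator (f τ) x := fun τ => by
    rw [setIntegral_indicator (hpm τ)]; rfl
  simp_rw [hset]
  obtain ⟨M, hM⟩ := ((isCompact_Icc (a := a) (b := b)).prod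
    hO.isCompact_closure).exists_bound_of_continuousOn hf.continuousOn
  refine tendsto_integral_filter_of_dominated_convergence (fun _ => M) ?_ ?_ ?_ ?_
  · refine Eventually.of_forall fun τ => AEStronglyMeasurable.indicator ?_ (hpm τ)
    exact (hf.comp (Continuous.prodMk_right τ)).aestronglyMeasurable
  · filter_upwards [self_mem_nhdsWithin] with τ hτ
    refine (ae_restrict_iff' hOo.measurableSet).2 (Eventually.of_forall fun x hx => ?_)
    exact (norm_indicator_le_norm_self _ _).trans (hM (τ, x) ⟨hτ, subset_closure hx⟩)
  · exact integrableOn_const hO.measure_lt_top.ne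
  · have hnull := volume_levelSet_eq_zero hOo hO hφ hreg hτ₀
    have hae : ∀ᵐ x ∂volume.restrict O, φ τ₀ x ≠ 0 := by
      rw [ae_restrict_iff' hOo.measurableSet, ae_iff]
      refine measure_mono_null (fun x hx => ?_) hnull
      simpa using hx
    filter_upwards [hae] with x hx
    have hφx : Continuous fun τ => s.sgn * φ τ x :=
      continuous_const.mul (hφ.continuous.comp (Continuous.prodMk_left x))
    have hfx : Continuous fun τ => f τ x := hf.comp (Continuous.prodMk_left x)
    have hne : s.sgn * φ τ₀ x ≠ 0 := by cases s <;> simpa [Phase.sgn] using hx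
    refine Tendsto.mono_left ?_ nhdsWithin_le_nhds
    rcases lt_or_gt_of_ne hne with h | h
    · rw [indicator_of_notMem (by simpa using h.le)]
      refine tendsto_const_nhds.congr' ?_
      filter_upwards [hφx.continuousAt.eventually_lt_const h] with τ hτ
      rw [indicator_of_notMem (by simpa using hτ.le)]
    · rw [indicator_of_mem (by exact h)]
      refine (hfx.tendsto τ₀).congr' ?_
      filter_upwards [hφx.continuousAt.eventually_const_lt h] with τ hτ
      rw [indicator_of_mem (by exact hτ)]

end Moving

/-! ### Cutoff functions near the wall -/

lemma delta_le (n : ℕ) (s : ℝ) : delta n s ≤ n + 1 := by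
  have h := (bumpAt n).normed_le_div_measure_closedBall_rIn volume s
  rw [Real.volume_real_closedBall (bumpAt n).rIn_pos.le] at h
  refine h.trans (le_of_eq ?_)
  simp only [bumpAt]
  field_simp

/-- Cutoff functions of the container `{wall < 0}`: they vanish where `wall ≥ -1/(n+1)` and equal
`1` where `wall ≤ -3/(n+1)`. -/
def cutoff (wall : E3 → ℝ) (n : ℕ) (x : E3) : ℝ := step n (-wall x - 2 * (1 / ((n : ℝ) + 1)))

/-- The size of the slope of `cutoff wall n` with respect to `wall`. -/
def cutoffSlope (wall : E3 → ℝ) (n : ℕ) (x : E3) : ℝ :=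
  delta n (-wall x - 2 * (1 / ((n : ℝ) + 1)))

section Wall

variable {wall : E3 → ℝ}

lemma cutoff_nonneg (n : ℕ) (x : E3) : 0 ≤ cutoff wall n x := step_nonneg _ _

lemma cutoff_le_one (n : ℕ) (x : E3) : cutoff wall n x ≤ 1 := step_le_one _ _

lemma cutoffSlope_nonneg (n : ℕ) (x : E3) : 0 ≤ cutoffSlope wall n x := delta_nonneg _ _

lemma cutoff_eq_zero {n : ℕ} {x : E3} (h : -(1 / ((n : ℝ) + 1)) ≤ wall x) : cutoff wall n x = 0 :=
  step_eq_zero (by linarith)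

lemma cutoff_eq_one {n : ℕ} {x : E3} (h : wall x ≤ -(3 * (1 / ((n : ℝ) + 1)))) :
    cutoff wall n x = 1 :=
  step_eq_one (by linarith)

/-- The slope is concentrated in the layer `-3/(n+1) < wall < -1/(n+1)`. -/
lemma mem_layer_of_cutoffSlope_ne_zero {n : ℕ} {x : E3} (h : cutoffSlope wall n x ≠ 0) :
    -(3 * (1 / ((n : ℝ) + 1))) < wall x ∧ wall x < -(1 / ((n : ℝ) + 1)) := by
  have h1 : |-wall x - 2 * (1 / ((n : ℝ) + 1))| < 1 / ((n : ℝ) + 1) := by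
    by_contra h'
    exact h (delta_eq_zero (not_lt.1 h'))
  obtain ⟨h2, h3⟩ := abs_lt.1 h1
  constructor <;> linarith

lemma wall_neg_of_cutoffSlope_ne_zero {n : ℕ} {x : E3} (h : cutoffSlope wall n x ≠ 0) :
    wall x < 0 := by
  have := (mem_layer_of_cutoffSlope_ne_zero h).2
  have h2 : 0 < 1 / ((n : ℝ) + 1) := by positivity
  linarith

/-- The cutoffs steepen only as fast as `1 / |wall|`. -/
lemma cutoffSlope_mul_abs_wall_le (n : ℕ) (x : E3) : cutoffSlope wall n x * |wall x| ≤ 3 := by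
  by_cases h : cutoffSlope wall n x = 0
  · rw [h, zero_mul]; norm_num
  · have h1 := (mem_layer_of_cutoffSlope_ne_zero h).1
    rw [abs_of_neg (wall_neg_of_cutoffSlope_ne_zero h)]
    have h2 : cutoffSlope wall n x ≤ n + 1 := delta_le _ _
    have h3 : (0 : ℝ) < n + 1 := by positivity
    calc cutoffSlope wall n x * -wall x ≤ (n + 1) * (3 * (1 / ((n : ℝ) + 1))) := by
          apply mul_le_mul h2 (by linarith) _ h3.le
          have := wall_neg_of_cutoffSlope_ne_zero h
          linarith
      _ = 3 := by field_simp

lemma contDiff_cutoff (hw : ContDiff ℝ 1 wall) (n : ℕ) : ContDiff ℝ 1 (cutoff wall n) :=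
  ((contDiff_step n).of_le one_le_two).comp (hw.neg.sub contDiff_const)

lemma continuous_cutoffSlope (hw : Continuous wall) (n : ℕ) : Continuous (cutoffSlope wall n) :=
  (continuous_delta n).comp (hw.neg.sub continuous_const)

lemma fderiv_cutoff (hw : ContDiff ℝ 1 wall) (n : ℕ) (x v : E3) :
    fderiv ℝ (cutoff wall n) x v = -(cutoffSlope wall n x * fderiv ℝ wall x v) := by
  have h1 : HasFDerivAt (fun x => -wall x - 2 * (1 / ((n : ℝ) + 1))) (-fderiv ℝ wall x) x :=
    (hw.differentiable one_ne_zero x).hasFDerivAt.neg.sub_const _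
  have h2 := ((hasDerivAt_step n _).comp_hasFDerivAt x h1).fderiv
  change fderiv ℝ (step n ∘ fun x => -wall x - 2 * (1 / ((n : ℝ) + 1))) x v = _
  rw [h2]
  simp [cutoffSlope]

lemma tsupport_cutoff_subset (hw : Continuous wall) (n : ℕ) :
    tsupport (cutoff wall n) ⊆ {x | wall x ≤ -(1 / ((n : ℝ) + 1))} := by
  refine closure_minimal (fun x hx => ?_) (isClosed_le hw continuous_const)
  by_contra h
  exact hx (cutoff_eq_zero (not_le.1 h).le)

lemma tsupport_cutoff_subset_container (hw : Continuous wall) (n : ℕ) :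
    tsupport (cutoff wall n) ⊆ {x | wall x < 0} := fun x hx => by
  have h := tsupport_cutoff_subset hw n hx
  have h2 : 0 < 1 / ((n : ℝ) + 1) := by positivity
  simp only [mem_ofPred_eq] at h ⊢
  linarith

lemma hasCompactSupport_cutoff (hw : Continuous wall)
    (hb : Bornology.IsBounded {x | wall x < 0}) (n : ℕ) : HasCompactSupport (cutoff wall n) :=
  Metric.isCompact_of_isClosed_isBounded (isClosed_tsupport _)
    (hb.subset (tsupport_cutoff_subset_container hw n))

lemma cutoff_eq_zero_of_notMem {n : ℕ} {x : E3} (h : x ∉ {x | wall x < 0}) :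
    cutoff wall n x = 0 := by
  have h2 : 0 < 1 / ((n : ℝ) + 1) := by positivity
  have h3 : 0 ≤ wall x := not_lt.1 h
  exact cutoff_eq_zero (by linarith)

lemma cutoffSlope_eq_zero_of_notMem {n : ℕ} {x : E3} (h : x ∉ {x | wall x < 0}) :
    cutoffSlope wall n x = 0 := by
  by_contra h'
  exact h (wall_neg_of_cutoffSlope_ne_zero h')

lemma eventually_layer_small {r : ℝ} (hr : 0 < r) :
    ∀ᶠ n : ℕ in atTop, 3 * (1 / ((n : ℝ) + 1)) < r := by
  filter_upwards [eventually_inv_lt (by positivity : 0 < r / 3)] with n hn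
  linarith

lemma eventually_cutoff_eq_one {x : E3} (hx : wall x < 0) :
    ∀ᶠ n in atTop, cutoff wall n x = 1 := by
  filter_upwards [eventually_layer_small (neg_pos.2 hx)] with n hn
  exact cutoff_eq_one (by linarith)

lemma eventually_cutoffSlope_eq_zero {x : E3} (hx : wall x < 0) :
    ∀ᶠ n in atTop, cutoffSlope wall n x = 0 := by
  filter_upwards [eventually_layer_small (neg_pos.2 hx)] with n hn
  by_contra h
  have := (mem_layer_of_cutoffSlope_ne_zero h).1
  linarith

/-- At a regular zero, a function takes negative values arbitrarily close by. -/
lemma mem_closure_neg {f : E3 → ℝ} {x : E3} (hx0 : f x = 0) (hf : DifferentiableAt ℝ f x)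
    (hreg : fderiv ℝ f x ≠ 0) : x ∈ closure {x | f x < 0} := by
  obtain ⟨v, hv⟩ : ∃ v, fderiv ℝ f x v < 0 := by
    by_contra! h
    apply hreg
    ext v
    have h1 := h v
    have h2 := h (-v)
    rw [map_neg] at h2
    exact le_antisymm (neg_nonneg.1 h2) h1
  have hd : HasDerivAt (fun s : ℝ => f (x + s • v)) (fderiv ℝ f x v) 0 := by
    have h1 : HasDerivAt (fun s : ℝ => x + s • v) v 0 := by
      simpa using ((hasDerivAt_id (0 : ℝ)).smul_const v).const_add x
    have h0 : HasFDerivAt f (fderiv ℝ f x) (x + (0 : ℝ) • v) := by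
      rw [zero_smul, add_zero]; exact hf.hasFDerivAt
    exact h0.comp_hasDerivAt 0 h1
  have hneg : ∀ᶠ s in 𝓝[>] (0 : ℝ), f (x + s • v) < 0 := by
    have h3 := (hasDerivWithinAt_iff_tendsto_slope' (by simp)).1 (hd.hasDerivWithinAt (s := Ioi 0))
    filter_upwards [h3.eventually_lt_const hv, self_mem_nhdsWithin] with s hs hs0
    rw [slope_def_field] at hs
    simp only [zero_smul, add_zero, hx0, sub_zero] at hs
    have h4 : (0 : ℝ) < s := hs0
    by_contra h5
    exact absurd hs (not_lt.2 (div_nonneg (not_lt.1 h5) h4.le))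
  have ht : Tendsto (fun s : ℝ => x + s • v) (𝓝[>] 0) (𝓝 x) := by
    have : Continuous fun s : ℝ => x + s • v := by fun_prop
    exact (this.tendsto' 0 x (by simp)).mono_left nhdsWithin_le_nhds
  exact mem_closure_of_tendsto ht hneg

lemma frontier_container (hw : ContDiff ℝ 1 wall) (hreg : ∀ x, wall x = 0 → fderiv ℝ wall x ≠ 0) :
    frontier {x | wall x < 0} = {x | wall x = 0} := by
  apply Subset.antisymm
  · exact frontier_lt_subset_eq hw.continuous continuous_const
  · intro x hx
    have hx0 : wall x = 0 := hx
    rw [(isOpen_lt hw.continuous continuous_const).frontier_eq]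
    exact ⟨mem_closure_neg hx0 (hw.differentiable one_ne_zero x) (hreg x hx), by simp [hx0]⟩

/-- A smooth field pointing strictly outwards along the wall. -/
lemma exists_outward_field (hw : ContDiff ℝ 1 wall)
    (hreg : ∀ x, wall x = 0 → fderiv ℝ wall x ≠ 0) :
    ∃ X : E3 → E3, ContDiff ℝ 1 X ∧ ∀ x, wall x = 0 → 0 < fderiv ℝ wall x (X x) := by
  have hd := hw.continuous_fderiv one_ne_zero
  obtain ⟨X, hX⟩ := exists_contMDiffMap_forall_mem_convex_of_local_const (n := 1)
    (modelWithCornersSelf ℝ E3) (M := E3) (F := E3)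
    (t := fun x => {v | wall x = 0 → 0 < fderiv ℝ wall x v}) (fun x => by
      intro v hv w hw' α β hα hβ hαβ h0
      have h1 := hv h0
      have h2 := hw' h0
      rw [map_add, map_smul, map_smul, smul_eq_mul, smul_eq_mul]
      rcases hα.eq_or_lt with rfl | hα'
      · rw [zero_add] at hαβ; rw [hαβ]; simpa using h2
      · nlinarith [mul_pos hα' h1, mul_nonneg hβ h2.le]) (fun x => by
      by_cases h0 : wall x = 0
      · refine ⟨gradient wall x, ?_⟩
        have hpos : 0 < fderiv ℝ wall x (gradient wall x) := by
          rw [← inner_gradient_eq, real_inner_self_eq_norm_sq, norm_gradient_eq]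
          have := norm_pos_iff.2 (hreg x h0)
          positivity
        have hc : Continuous fun y => fderiv ℝ wall y (gradient wall x) := by fun_prop
        filter_upwards [hc.continuousAt.eventually_const_lt hpos] with y hy _
        exact hy
      · refine ⟨0, ?_⟩
        filter_upwards [hw.continuous.continuousAt.eventually_ne h0] with y hy h
        exact absurd h hy)
  exact ⟨X, contMDiff_iff_contDiff.1 X.contMDiff, hX⟩

/-- The layer in which the cutoffs vary has volume `O(1/n)`. -/
lemma exists_integral_cutoffSlope_le (hw : ContDiff ℝ 1 wall)
    (hreg : ∀ x, wall x = 0 → fderiv ℝ wall x ≠ 0) (hb : Bornology.IsBounded {x | wall x < 0}) :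
    ∃ C, 0 ≤ C ∧ ∀ᶠ n in atTop, ∫ x in {x | wall x < 0}, cutoffSlope wall n x ≤ C := by
  obtain ⟨X, hX, hXpos⟩ := exists_outward_field hw hreg
  have hd := hw.continuous_fderiv one_ne_zero
  set O := {x | wall x < 0} with hO
  have hOm : MeasurableSet O := (isOpen_lt hw.continuous continuous_const).measurableSet
  obtain ⟨m, hm, h⟩ := hb.isCompact_closure.exists_forall_le' (f := fun x =>
    max (-wall x) (fderiv ℝ wall x (X x)))
    (hw.continuous.neg.max (hd.clm_apply hX.continuous)).continuousOn (a := 0) (by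
      intro x hx
      have hx' : wall x ≤ 0 := closure_minimal (fun y hy => (le_of_lt hy : wall y ≤ 0))
        (isClosed_le hw.continuous continuous_const) hx
      rcases hx'.lt_or_eq with h1 | h1
      · exact lt_max_of_lt_left (neg_pos.2 h1)
      · exact lt_max_of_lt_right (hXpos x h1))
  set D := ∫ x in O, |divergence X x| with hD
  have hD0 : 0 ≤ D := integral_nonneg fun x => abs_nonneg _
  refine ⟨D / m, by positivity, ?_⟩
  filter_upwards [eventually_layer_small hm] with n hn
  rw [le_div_iff₀ hm]
  have hslope := continuous_cutoffSlope hw.continuous n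
  have hibp : ∫ x, fderiv ℝ (cutoff wall n) x (X x) = -∫ x, cutoff wall n x * divergence X x := by
    have hc := hasCompactSupport_cutoff hw.continuous hb n
    have hs := contDiff_cutoff hw n
    have h1 := integral_divergence_eq_zero (hs.smul hX) (hc.smul_right (f' := X))
    have hpt : ∀ x, divergence (cutoff wall n • X) x
        = cutoff wall n x * divergence X x + fderiv ℝ (cutoff wall n) x (X x) := fun x =>
      divergence_smul (hs.differentiable one_ne_zero x) (hX.differentiable one_ne_zero x)
    have h2 : Integrable fun x => cutoff wall n x * divergence X x :=
      (hs.continuous.mul (continuous_divergence hX)).integrable_of_hasCompactSupport hc.mul_right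
    have h3 : Integrable fun x => fderiv ℝ (cutoff wall n) x (X x) := by
      refine Continuous.integrable_of_hasCompactSupport
        ((hs.continuous_fderiv one_ne_zero).clm_apply hX.continuous) ?_
      refine (hc.fderiv (𝕜 := ℝ)).mono fun x hx h => hx ?_
      simp [h]
    rw [integral_congr_ae (Eventually.of_forall hpt), integral_add h2 h3] at h1
    exact eq_neg_of_add_eq_zero_right h1
  have hibp' : ∫ x in O, cutoffSlope wall n x * fderiv ℝ wall x (X x)
      = ∫ x in O, cutoff wall n x * divergence X x := by
    rw [setIntegral_eq_integral_of_forall_compl_eq_zero (fun x hx => by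
        rw [cutoffSlope_eq_zero_of_notMem hx, zero_mul]),
      setIntegral_eq_integral_of_forall_compl_eq_zero (fun x hx => by
        rw [cutoff_eq_zero_of_notMem hx, zero_mul])]
    simp_rw [fderiv_cutoff hw n, integral_neg, neg_inj] at hibp
    exact hibp
  calc (∫ x in O, cutoffSlope wall n x) * m = ∫ x in O, cutoffSlope wall n x * m :=
        (integral_mul_const _ _).symm
    _ ≤ ∫ x in O, cutoffSlope wall n x * fderiv ℝ wall x (X x) := by
        refine setIntegral_mono_on
          (integrableOn_of_continuous hb (hslope.mul continuous_const))
          (integrableOn_of_continuous hb (hslope.mul (hd.clm_apply hX.continuous))) hOm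
          fun x hx => ?_
        by_cases h0 : cutoffSlope wall n x = 0
        · simp [h0]
        · have h1 := (mem_layer_of_cutoffSlope_ne_zero h0).1
          have h2 := (le_max_iff.1 (h x (subset_closure hx))).resolve_left (by linarith)
          exact mul_le_mul_of_nonneg_left h2 (cutoffSlope_nonneg _ _)
    _ = ∫ x in O, cutoff wall n x * divergence X x := hibp'
    _ ≤ D := by
        refine setIntegral_mono_on
          (integrableOn_of_continuous hb ((contDiff_cutoff hw n).continuous.mul
            (continuous_divergence hX)))
          (integrableOn_of_continuous hb (continuous_divergence hX).abs) hOm fun x _ => ?_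
        calc _ ≤ cutoff wall n x * |divergence X x| :=
              mul_le_mul_of_nonneg_left (le_abs_self _) (cutoff_nonneg _ _)
          _ ≤ _ := mul_le_of_le_one_left (abs_nonneg _) (cutoff_le_one _ _)

/-- Tangential fields do not cross the wall: their flux through the layers of the cutoffs tends
to zero. Mere continuity of the field suffices. -/
lemma tendsto_integral_fderiv_cutoff (hw : ContDiff ℝ 1 wall)
    (hreg : ∀ x, wall x = 0 → fderiv ℝ wall x ≠ 0) (hb : Bornology.IsBounded {x | wall x < 0})
    {R : Set E3} (hR : MeasurableSet R) (hRO : R ⊆ {x | wall x < 0}) {F : E3 → E3}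
    (hF : Continuous F) (hF0 : ∀ x ∈ closure R, wall x = 0 → fderiv ℝ wall x (F x) = 0) :
    Tendsto (fun n => ∫ x in R, fderiv ℝ (cutoff wall n) x (F x)) atTop (𝓝 0) := by
  obtain ⟨C, hC0, hC⟩ := exists_integral_cutoffSlope_le hw hreg hb
  have hd := hw.continuous_fderiv one_ne_zero
  rw [Metric.tendsto_atTop']
  intro ε hε
  set e := ε / (2 * (C + 1)) with he
  have he0 : 0 < e := by positivity
  have hKc : IsCompact (closure R ∩ {x | e ≤ |fderiv ℝ wall x (F x)|}) :=
    (hb.subset hRO).isCompact_closure.inter_right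
      (isClosed_le continuous_const (hd.clm_apply hF).abs)
  obtain ⟨m, hm, h⟩ := hKc.exists_forall_le' (f := fun x => -wall x)
    hw.continuous.neg.continuousOn (a := 0) (by
      rintro x ⟨hx, hxe⟩
      have hx' : wall x ≤ 0 := closure_minimal (fun y hy => (le_of_lt (hRO hy) : wall y ≤ 0))
        (isClosed_le hw.continuous continuous_const) hx
      rcases hx'.lt_or_eq with h1 | h1
      · exact neg_pos.2 h1
      · have h2 : e ≤ |fderiv ℝ wall x (F x)| := hxe
        rw [hF0 x hx h1, abs_zero] at h2
        exact absurd h2 (not_le.2 he0))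
  obtain ⟨N, hN⟩ := eventually_atTop.1 (hC.and (eventually_layer_small hm))
  refine ⟨N, fun n hn => ?_⟩
  obtain ⟨h1, h2⟩ := hN n hn.le
  have hslope := continuous_cutoffSlope hw.continuous n
  have hint : IntegrableOn (fun x => cutoffSlope wall n x * e) R :=
    (integrableOn_of_continuous hb (hslope.mul continuous_const)).mono_set hRO
  rw [dist_zero_right]
  calc ‖∫ x in R, fderiv ℝ (cutoff wall n) x (F x)‖ ≤ ∫ x in R, cutoffSlope wall n x * e := by
        refine norm_integral_le_of_norm_le hint ((ae_restrict_iff' hR).2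
          (Eventually.of_forall fun x hx => ?_))
        rw [fderiv_cutoff hw, norm_neg, norm_mul, Real.norm_of_nonneg (cutoffSlope_nonneg _ _)]
        by_cases h0 : cutoffSlope wall n x = 0
        · simp [h0]
        · refine mul_le_mul_of_nonneg_left ?_ (cutoffSlope_nonneg _ _)
          by_contra h3
          have h4 := h x ⟨subset_closure hx, (not_le.1 h3).le⟩
          have h5 := (mem_layer_of_cutoffSlope_ne_zero h0).1
          linarith
    _ ≤ ∫ x in {x | wall x < 0}, cutoffSlope wall n x * e :=
        setIntegral_mono_set (integrableOn_of_continuous hb (hslope.mul continuous_const))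
          (Eventually.of_forall fun x => mul_nonneg (cutoffSlope_nonneg _ _) he0.le)
          (Eventually.of_forall hRO)
    _ = (∫ x in {x | wall x < 0}, cutoffSlope wall n x) * e := integral_mul_const _ _
    _ ≤ C * e := by gcongr
    _ < ε := by
        rw [he, ← mul_div_assoc, div_lt_iff₀ (by positivity)]
        nlinarith

/-- A field that vanishes linearly at the wall has bounded flux density through the layers. -/
lemma abs_fderiv_cutoff_le (hw : ContDiff ℝ 1 wall) {n : ℕ} {x v : E3} {C M : ℝ} (hC : 0 ≤ C)
    (hM : ‖fderiv ℝ wall x‖ ≤ M) (hv : ‖v‖ ≤ C * |wall x|) :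
    |fderiv ℝ (cutoff wall n) x v| ≤ 3 * (C * M) := by
  rw [fderiv_cutoff hw, abs_neg, abs_mul, abs_of_nonneg (cutoffSlope_nonneg _ _)]
  have hM0 : 0 ≤ M := (norm_nonneg _).trans hM
  have h1 : |fderiv ℝ wall x v| ≤ M * (C * |wall x|) :=
    ((fderiv ℝ wall x).le_opNorm v).trans (mul_le_mul hM hv (norm_nonneg _) hM0)
  calc _ ≤ cutoffSlope wall n x * (M * (C * |wall x|)) :=
        mul_le_mul_of_nonneg_left h1 (cutoffSlope_nonneg _ _)
    _ = (cutoffSlope wall n x * |wall x|) * (C * M) := by ring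
    _ ≤ 3 * (C * M) := by
        have := cutoffSlope_mul_abs_wall_le (wall := wall) n x
        gcongr

end Wall

/-! ### Linear decay of the velocity at the wall -/

/-- The container `{wall < 0}` and the level set function `φ` of an interface moving during the
time interval `[a, b]`. -/
structure IsMovingDomain (wall : E3 → ℝ) (φ : ℝ → E3 → ℝ) (a b : ℝ) : Prop where
  bounded : Bornology.IsBounded {x | wall x < 0}
  wall_smooth : ContDiff ℝ 1 wall
  wall_regular : ∀ x, wall x = 0 → fderiv ℝ wall x ≠ 0
  φ_smooth : ContDiff ℝ 2 fun q : ℝ × E3 => φ q.1 q.2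
  φ_regular : ∀ τ ∈ Icc a b, ∀ x ∈ closure {x | wall x < 0}, φ τ x = 0 → fderiv ℝ (φ τ) x ≠ 0

/-- The other phase. -/
def Phase.other : Phase → Phase
  | .plus => .minus
  | .minus => .plus

lemma Phase.sgn_other (s : Phase) : s.other.sgn = -s.sgn := by
  cases s <;> simp [Phase.sgn, Phase.other]

/-- In `O`, the closure of a phase contains all points at which the sign condition holds weakly. -/
lemma mem_closure_signRegion {O : Set E3} (hO : IsOpen O) {f : E3 → ℝ} (hf : Differentiable ℝ f)
    {x : E3} (hx : x ∈ O) (hreg : f x = 0 → fderiv ℝ f x ≠ 0) {s : Phase} (hs : 0 ≤ s.sgn * f x) :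
    x ∈ closure (signRegion O f s) := by
  rcases hs.lt_or_eq with h | h
  · exact subset_closure ⟨hx, h⟩
  · have hsgn : s.sgn ≠ 0 := by cases s <;> simp [Phase.sgn]
    have h0 : f x = 0 := by simpa [hsgn] using h.symm
    have hd : fderiv ℝ (fun y => -s.sgn * f y) x = -s.sgn • fderiv ℝ f x :=
      fderiv_const_mul (hf x) _
    have h1 : x ∈ closure {y | -s.sgn * f y < 0} := by
      refine mem_closure_neg (by simp [h0]) ((hf x).const_mul _) ?_
      rw [hd]
      exact smul_ne_zero (neg_ne_zero.2 hsgn) (hreg h0)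
    have h2 : x ∈ closure (O ∩ {y | -s.sgn * f y < 0}) :=
      hO.inter_closure (mem_inter hx h1)
    have h3 : O ∩ {y | -s.sgn * f y < 0} ⊆ signRegion O f s := fun y hy => by
      have h4 : -s.sgn * f y < 0 := hy.2
      exact ⟨hy.1, by linarith⟩
    exact closure_mono h3 h2

/-- From a point near a regular point of the wall, the wall is reached along a segment of length
comparable to `|wall|`. -/
lemma exists_segment_to_wall {wall : E3 → ℝ} (hw : ContDiff ℝ 1 wall) {x₀ : E3}
    (h0 : wall x₀ = 0) (hreg : fderiv ℝ wall x₀ ≠ 0) :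
    ∃ C, 0 ≤ C ∧ ∀ᶠ x in 𝓝 x₀, wall x < 0 → ∃ y, wall y = 0 ∧ ‖y - x‖ ≤ C * |wall x| ∧
      ∀ θ ∈ Ico (0 : ℝ) 1, wall (x + θ • (y - x)) < 0 := by
  have hd := hw.continuous_fderiv one_ne_zero
  set v := gradient wall x₀ with hv
  have hvpos : 0 < fderiv ℝ wall x₀ v := by
    rw [← inner_gradient_eq, real_inner_self_eq_norm_sq, norm_gradient_eq]
    have := norm_pos_iff.2 hreg
    positivity
  set c := fderiv ℝ wall x₀ v / 2 with hc
  have hc0 : 0 < c := by positivity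
  have hcont : Continuous fun z => fderiv ℝ wall z v := by fun_prop
  obtain ⟨ρ, hρ, hball⟩ := Metric.eventually_nhds_iff_ball.1
    (hcont.continuousAt.eventually_const_lt (by linarith : c < fderiv ℝ wall x₀ v))
  set T := ρ / 2 / (‖v‖ + 1) with hT
  have hT0 : 0 < T := by positivity
  refine ⟨‖v‖ / c, by positivity, ?_⟩
  have hsmall : ∀ᶠ x in 𝓝 x₀, -(c * T) < wall x :=
    hw.continuous.continuousAt.eventually_const_lt (by rw [h0]; nlinarith)
  filter_upwards [hsmall, Metric.ball_mem_nhds x₀ (half_pos hρ)] with x hx hxball hneg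
  set f : ℝ → ℝ := fun t => wall (x + t • v) with hf
  have hder : ∀ t, HasDerivAt f (fderiv ℝ wall (x + t • v) v) t := fun t => by
    have h1 : HasDerivAt (fun s : ℝ => x + s • v) v t := by
      simpa using ((hasDerivAt_id t).smul_const v).const_add x
    exact (hw.differentiable one_ne_zero (x + t • v)).hasFDerivAt.comp_hasDerivAt t h1
  have hfc : Continuous f := continuous_iff_continuousAt.2 fun t => (hder t).continuousAt
  have hlow : ∀ t ∈ Icc 0 T, c ≤ fderiv ℝ wall (x + t • v) v := by
    intro t ht
    refine (hball _ ?_).le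
    rw [mem_ball_iff_norm]
    have h1 : ‖t • v‖ ≤ ρ / 2 := by
      rw [norm_smul, Real.norm_of_nonneg ht.1]
      calc t * ‖v‖ ≤ T * (‖v‖ + 1) := by
            apply mul_le_mul ht.2 (by linarith) (norm_nonneg _) hT0.le
        _ = ρ / 2 := by rw [hT]; field_simp
    have h2 := mem_ball_iff_norm.1 hxball
    calc ‖x + t • v - x₀‖ = ‖(x - x₀) + t • v‖ := by congr 1; abel
      _ ≤ ‖x - x₀‖ + ‖t • v‖ := norm_add_le _ _
      _ < ρ := by linarith
  have hmv : ∀ s ∈ Icc 0 T, ∀ t ∈ Icc 0 T, s ≤ t → c * (t - s) ≤ f t - f s := by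
    refine (convex_Icc 0 T).mul_sub_le_image_sub_of_le_deriv hfc.continuousOn ?_ ?_
    · exact fun t _ => (hder t).differentiableAt.differentiableWithinAt
    · intro t ht
      rw [(hder t).deriv]
      exact hlow t (interior_subset ht)
  have hf0 : f 0 = wall x := by simp [hf]
  have hfT : 0 < f T := by
    have := hmv 0 ⟨le_rfl, hT0.le⟩ T ⟨hT0.le, le_rfl⟩ hT0.le
    rw [hf0] at this
    linarith
  obtain ⟨t, ht, hft⟩ := intermediate_value_Ioo hT0.le hfc.continuousOn
    (show (0 : ℝ) ∈ Ioo (f 0) (f T) from ⟨by rw [hf0]; exact hneg, hfT⟩)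
  have ht' : t ∈ Icc 0 T := Ioo_subset_Icc_self ht
  refine ⟨x + t • v, hft, ?_, fun θ hθ => ?_⟩
  · rw [add_sub_cancel_left, norm_smul, Real.norm_of_nonneg ht.1.le, abs_of_neg hneg]
    have h1 := hmv 0 ⟨le_rfl, hT0.le⟩ t ht' ht.1.le
    rw [hf0, hft] at h1
    rw [div_mul_eq_mul_div, le_div_iff₀ hc0]
    nlinarith [norm_nonneg v]
  · rw [add_sub_cancel_left, smul_smul]
    have h1 : θ * t ∈ Icc 0 T :=
      ⟨mul_nonneg hθ.1 ht.1.le, (mul_le_of_le_one_left ht.1.le hθ.2.le).trans ht.2.le⟩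
    have h2 := hmv _ h1 t ht' (mul_le_of_le_one_left ht.1.le hθ.2.le)
    rw [hft] at h2
    change f (θ * t) < 0
    have h3 : 0 < c * (t - θ * t) := by
      have : t - θ * t = (1 - θ) * t := by ring
      rw [this]
      exact mul_pos hc0 (mul_pos (by linarith [hθ.2]) ht.1)
    linarith

/-- Integrating from the wall along a segment: the velocities of the two phases agree wherever the
segment crosses the interface. -/
lemma norm_le_of_segment {O : Set E3} {f : E3 → ℝ} (hf : Continuous f) {w : Phase → E3 → E3}
    {K : Set E3} {L : ℝ} (hK : Convex ℝ K)
    (hL : ∀ s, ∀ x ∈ K, ∀ y ∈ K, ‖w s y - w s x‖ ≤ L * ‖y - x‖)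
    (hjump : ∀ x ∈ O, f x = 0 → w .plus x = w .minus x)
    (hcl : ∀ s, ∀ x ∈ O, 0 ≤ s.sgn * f x → x ∈ closure (signRegion O f s))
    {x y : E3} (hx : x ∈ K) (hy : y ∈ K)
    (hslip : ∀ s, y ∈ closure (signRegion O f s) → w s y = 0)
    (hseg : ∀ θ ∈ Ico (0 : ℝ) 1, x + θ • (y - x) ∈ O) {s : Phase} (hs : 0 ≤ s.sgn * f x) :
    ‖w s x‖ ≤ L * ‖y - x‖ := by
  set z : ℝ → E3 := fun θ => x + θ • (y - x) with hz
  have hzc : Continuous z := by fun_prop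
  have hz0 : z 0 = x := by simp [hz]
  have hz1 : z 1 = y := by simp [hz]
  have hjump' : ∀ x ∈ O, f x = 0 → w s x = w s.other x := by
    intro x hx h
    cases s
    · exact hjump x hx h
    · exact (hjump x hx h).symm
  by_cases hcase : y ∈ closure {p | p ∈ O ∧ 0 ≤ s.sgn * f p}
  · have h1 : y ∈ closure (signRegion O f s) :=
      closure_minimal (fun p hp => hcl s p hp.1 hp.2) isClosed_closure hcase
    have h2 := hL s x hx y hy
    rwa [hslip s h1, zero_sub, norm_neg] at h2
  · have h1 : ∀ᶠ θ in 𝓝[<] (1 : ℝ), z θ ∉ {p | p ∈ O ∧ 0 ≤ s.sgn * f p} := by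
      have h2 : ∀ᶠ p in 𝓝 y, p ∉ {p | p ∈ O ∧ 0 ≤ s.sgn * f p} := by
        filter_upwards [isClosed_closure.isOpen_compl.mem_nhds hcase] with p hp hp'
        exact hp (subset_closure hp')
      exact ((hzc.tendsto' 1 y hz1).mono_left nhdsWithin_le_nhds).eventually h2
    have h2 : ∀ᶠ θ in 𝓝[<] (1 : ℝ), θ ∈ Ico (0 : ℝ) 1 :=
      Ico_mem_nhdsLT zero_lt_one
    have h3 : ∀ᶠ θ in 𝓝[<] (1 : ℝ), z θ ∈ O ∧ s.sgn * f (z θ) < 0 := by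
      filter_upwards [h1, h2] with θ hθ hθ'
      have hO := hseg θ hθ'
      refine ⟨hO, ?_⟩
      by_contra h
      exact hθ ⟨hO, not_lt.1 h⟩
    have h4 : y ∈ closure (signRegion O f s.other) := by
      refine mem_closure_of_tendsto (b := 𝓝[<] (1 : ℝ))
        ((hzc.tendsto' 1 y hz1).mono_left nhdsWithin_le_nhds) ?_
      filter_upwards [h3] with θ hθ
      refine ⟨hθ.1, ?_⟩
      rw [Phase.sgn_other]
      linarith [hθ.2]
    obtain ⟨θ₀, ⟨-, hθ₀⟩, hθ₀'⟩ := (h3.and h2).exists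
    have hfc : Continuous fun θ => s.sgn * f (z θ) := continuous_const.mul (hf.comp hzc)
    obtain ⟨θ, hθ, hfθ⟩ := intermediate_value_Icc' hθ₀'.1 hfc.continuousOn
      (show (0 : ℝ) ∈ Icc _ _ from ⟨hθ₀.le, by rw [hz0]; exact hs⟩)
    have hθ1 : θ ∈ Ico (0 : ℝ) 1 := ⟨hθ.1, hθ.2.trans_lt hθ₀'.2⟩
    have hfz : f (z θ) = 0 := by
      have hsgn : s.sgn ≠ 0 := by cases s <;> simp [Phase.sgn]
      simpa [hsgn] using hfθ
    have hzK : z θ ∈ K := hK.add_smul_sub_mem hx hy ⟨hθ1.1, hθ1.2.le⟩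
    have h5 := hL s _ hzK x hx
    have h6 := hL s.other _ hzK y hy
    rw [hslip _ h4, zero_sub, norm_neg, ← hjump' _ (hseg θ hθ1) hfz] at h6
    have h7 : ‖x - z θ‖ = θ * ‖y - x‖ := by
      rw [hz, sub_add_cancel_left, norm_neg, norm_smul, Real.norm_of_nonneg hθ1.1]
    have h8 : ‖y - z θ‖ = (1 - θ) * ‖y - x‖ := by
      have : y - z θ = (1 - θ) • (y - x) := by simp only [hz]; module
      rw [this, norm_smul, Real.norm_of_nonneg (by linarith [hθ1.2])]
    rw [h7] at h5
    rw [h8] at h6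
    calc ‖w s x‖ = ‖(w s x - w s (z θ)) + w s (z θ)‖ := by rw [sub_add_cancel]
      _ ≤ ‖w s x - w s (z θ)‖ + ‖w s (z θ)‖ := norm_add_le _ _
      _ ≤ L * (θ * ‖y - x‖) + L * ((1 - θ) * ‖y - x‖) := add_le_add h5 h6
      _ = L * ‖y - x‖ := by ring

variable {wall : E3 → ℝ} {φ : ℝ → E3 → ℝ} {a b : ℝ}

lemma IsMovingDomain.isOpen (h : IsMovingDomain wall φ a b) : IsOpen {x | wall x < 0} :=
  isOpen_lt h.wall_smooth.continuous continuous_const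

/-- No-slip velocities, continuous across the interface, are bounded by the distance to the wall,
in the form `|u| ≤ C |wall|`, uniformly in time. -/
lemma IsMovingDomain.exists_velocity_bound (h : IsMovingDomain wall φ a b)
    {u : Phase → ℝ → E3 → E3} (hu : ∀ s, ContDiff ℝ 1 fun q : ℝ × E3 => u s q.1 q.2)
    (hjump : ∀ τ ∈ Icc a b, ∀ x, wall x < 0 → φ τ x = 0 → u .plus τ x = u .minus τ x)
    (hslip : ∀ s, ∀ τ ∈ Icc a b, ∀ x, wall x = 0 →
      x ∈ closure (signRegion {x | wall x < 0} (φ τ) s) → u s τ x = 0) :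
    ∃ C, 0 ≤ C ∧ ∀ τ ∈ Icc a b, ∀ s, ∀ x, wall x < 0 → 0 ≤ s.sgn * φ τ x →
      ‖u s τ x‖ ≤ C * |wall x| := by
  have hw := h.wall_smooth
  obtain ⟨R, hR⟩ := h.bounded.closure.subset_closedBall (0 : E3)
  set K := Metric.closedBall (0 : E3) R with hKdef
  have hKc : IsCompact (Icc a b ×ˢ K) := isCompact_Icc.prod (isCompact_closedBall 0 R)
  have hex : ∃ L M : ℝ, 0 ≤ L ∧ 0 ≤ M ∧ ∀ s, ∀ τ ∈ Icc a b, ∀ x ∈ K,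
      ‖fderiv ℝ (u s τ) x‖ ≤ L ∧ ‖u s τ x‖ ≤ M := by
    obtain ⟨L1, hL1⟩ := hKc.exists_bound_of_continuousOn
      (continuous_fderiv_slice (hu .plus)).continuousOn
    obtain ⟨L2, hL2⟩ := hKc.exists_bound_of_continuousOn
      (continuous_fderiv_slice (hu .minus)).continuousOn
    obtain ⟨M1, hM1⟩ := hKc.exists_bound_of_continuousOn (hu .plus).continuous.continuousOn
    obtain ⟨M2, hM2⟩ := hKc.exists_bound_of_continuousOn (hu .minus).continuous.continuousOn
    refine ⟨|L1| + |L2|, |M1| + |M2|, by positivity, by positivity, fun s τ hτ x hx => ?_⟩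
    have e1 := hL1 (τ, x) ⟨hτ, hx⟩
    have e2 := hL2 (τ, x) ⟨hτ, hx⟩
    have e3 := hM1 (τ, x) ⟨hτ, hx⟩
    have e4 := hM2 (τ, x) ⟨hτ, hx⟩
    simp only at e1 e2 e3 e4
    have := le_abs_self L1
    have := le_abs_self L2
    have := le_abs_self M1
    have := le_abs_self M2
    have := abs_nonneg L1
    have := abs_nonneg L2
    have := abs_nonneg M1
    have := abs_nonneg M2
    cases s <;> constructor <;> linarith
  obtain ⟨L, M, hL0, hM0, hLM⟩ := hex
  have hloc : ∀ x₀ ∈ closure {x | wall x < 0}, ∃ C, 0 ≤ C ∧ ∀ᶠ x in 𝓝 x₀, wall x < 0 →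
      ∀ τ ∈ Icc a b, ∀ s : Phase, 0 ≤ s.sgn * φ τ x → ‖u s τ x‖ ≤ C * |wall x| := by
    intro x₀ hx₀
    by_cases h0 : wall x₀ = 0
    · obtain ⟨C, hC0, hC⟩ := exists_segment_to_wall hw h0 (h.wall_regular x₀ h0)
      refine ⟨L * C, by positivity, ?_⟩
      filter_upwards [hC] with x hx hneg τ hτ s hs
      obtain ⟨y, hy0, hyx, hseg⟩ := hx hneg
      have hyK : y ∈ K := hR (by
        have h1 : y ∈ frontier {x | wall x < 0} := by
          rw [frontier_container hw h.wall_regular]; exact hy0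
        exact frontier_subset_closure h1)
      have hφd := (contDiff_slice h.φ_smooth τ).differentiable two_ne_zero
      have key := norm_le_of_segment (O := {x | wall x < 0}) hφd.continuous (w := fun s => u s τ)
        (L := L) (convex_closedBall 0 R) (fun s p hp q hq =>
          (convex_closedBall (0 : E3) R).norm_image_sub_le_of_norm_fderiv_le
            (fun z _ => (contDiff_slice (hu s) τ).differentiable one_ne_zero z)
            (fun z hz => (hLM s τ hτ z hz).1) hp hq)
        (fun p hp => hjump τ hτ p hp)
        (fun s p hp => mem_closure_signRegion h.isOpen hφd hp
          (h.φ_regular τ hτ p (subset_closure hp)))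
        (hR (subset_closure hneg)) hyK (fun s hys => hslip s τ hτ y hy0 hys) hseg hs
      calc _ ≤ L * ‖y - x‖ := key
        _ ≤ L * (C * |wall x|) := by gcongr
        _ = L * C * |wall x| := by ring
    · have hpos : 0 < |wall x₀| / 2 := by positivity
      refine ⟨M / (|wall x₀| / 2), by positivity, ?_⟩
      filter_upwards [hw.continuous.abs.continuousAt.eventually_const_lt
        (by linarith : |wall x₀| / 2 < |wall x₀|)] with x hx hneg τ hτ s _
      refine (hLM s τ hτ x (hR (subset_closure hneg))).2.trans ?_
      rw [div_mul_eq_mul_div, le_div_iff₀ hpos]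
      gcongr
  have hglob := h.bounded.isCompact_closure.induction_on (p := fun S => ∃ C, 0 ≤ C ∧ ∀ x ∈ S,
      wall x < 0 → ∀ τ ∈ Icc a b, ∀ s : Phase, 0 ≤ s.sgn * φ τ x → ‖u s τ x‖ ≤ C * |wall x|)
    ⟨0, le_rfl, by simp⟩ (fun S S' hSS' ⟨C, h0, hC⟩ => ⟨C, h0, fun x hx => hC x (hSS' hx)⟩)
    (fun S S' ⟨C, h0, hC⟩ ⟨C', h0', hC'⟩ => ⟨C + C', by positivity, fun x hx hneg τ hτ s hs => by
      have habs := abs_nonneg (wall x)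
      rcases hx with hx | hx
      · exact (hC x hx hneg τ hτ s hs).trans (by gcongr; linarith)
      · exact (hC' x hx hneg τ hτ s hs).trans (by gcongr; linarith)⟩)
    (fun x hx => by
      obtain ⟨C, h0, hC⟩ := hloc x hx
      exact ⟨_, mem_nhdsWithin_of_mem_nhds hC, C, h0, fun y hy => hy⟩)
  obtain ⟨C, hC0, hC⟩ := hglob
  exact ⟨C, hC0, fun τ hτ s x hneg hs => hC x (subset_closure hneg) hneg τ hτ s hs⟩

/-! ### Transport of phase integrals -/

section Transport

variable {wall : E3 → ℝ} {φ : ℝ → E3 → ℝ} {a b : ℝ}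

lemma tsupport_subset_of_forall_notMem {G : E3 → ℝ} {K : Set E3} (hK : IsCompact K)
    (h0 : ∀ x ∉ K, G x = 0) : tsupport G ⊆ K :=
  closure_minimal (fun x hx => by by_contra h; exact hx (h0 x h)) hK.isClosed

lemma IsMovingDomain.tendsto_integral_delta (h : IsMovingDomain wall φ a b) {τ : ℝ}
    (hτ : τ ∈ Icc a b) {G : E3 → ℝ} (hG : Continuous G) {K : Set E3} (hK : IsCompact K)
    (hKO : K ⊆ {x | wall x < 0}) (h0 : ∀ x ∉ K, G x = 0) :
    IntegrableOn (fun x => G x / ‖fderiv ℝ (φ τ) x‖) {x | φ τ x = 0}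
      (Measure.euclideanHausdorffMeasure 2) ∧
    Tendsto (fun n => ∫ x, delta n (φ τ x) * G x) atTop
      (𝓝 (∫ x in {x | φ τ x = 0}, G x / ‖fderiv ℝ (φ τ) x‖
        ∂Measure.euclideanHausdorffMeasure 2)) :=
  tendsto_integral_delta_surface ((contDiff_slice h.φ_smooth τ).of_le one_le_two) hG
    (HasCompactSupport.intro hK h0) fun x hx =>
      h.φ_regular τ hτ x (subset_closure (hKO (tsupport_subset_of_forall_notMem hK h0 hx)))

lemma IsMovingDomain.continuous_delta_comp (h : IsMovingDomain wall φ a b) (n : ℕ) :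
    Continuous fun q : ℝ × E3 => delta n (φ q.1 q.2) :=
  (continuous_delta n).comp h.φ_smooth.continuous

lemma IsMovingDomain.continuous_step_comp (h : IsMovingDomain wall φ a b) (s : Phase) (n : ℕ) :
    Continuous fun q : ℝ × E3 => step n (s.sgn * φ q.1 q.2) :=
  (continuous_step n).comp (continuous_const.mul h.φ_smooth.continuous)

lemma IsMovingDomain.null_levelSet (h : IsMovingDomain wall φ a b) {τ : ℝ} (hτ : τ ∈ Icc a b) :
    volume ({x | wall x < 0} ∩ {x | φ τ x = 0}) = 0 :=
  volume_levelSet_eq_zero h.isOpen h.bounded h.φ_smooth h.φ_regular hτ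

/-- Time integrals of mollified surface integrals. -/
lemma IsMovingDomain.tendsto_intervalIntegral_delta (h : IsMovingDomain wall φ a b) (hab : a ≤ b)
    {G : ℝ → E3 → ℝ} (hG : Continuous fun q : ℝ × E3 => G q.1 q.2) {K : Set E3} (hK : IsCompact K)
    (hKO : K ⊆ {x | wall x < 0}) (h0 : ∀ τ, ∀ x ∉ K, G τ x = 0) :
    Tendsto (fun n => ∫ τ in a..b, ∫ x, delta n (φ τ x) * G τ x) atTop
      (𝓝 (∫ τ in a..b, ∫ x in {x | φ τ x = 0}, G τ x / ‖fderiv ℝ (φ τ) x‖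
        ∂Measure.euclideanHausdorffMeasure 2)) := by
  obtain ⟨C, hC0, hC⟩ := exists_integral_delta_le h.isOpen h.bounded h.φ_smooth h.φ_regular
  obtain ⟨M, hM⟩ := ((isCompact_Icc (a := a) (b := b)).prod
    h.bounded.isCompact_closure).exists_bound_of_continuousOn hG.continuousOn
  refine intervalIntegral.tendsto_integral_filter_of_dominated_convergence (fun _ => C * |M|)
    ?_ ?_ intervalIntegrable_const ?_
  · refine Eventually.of_forall fun n => Continuous.aestronglyMeasurable ?_
    exact continuous_integral_of_support ((h.continuous_delta_comp n).mul hG) hK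
      fun τ x hx => by rw [h0 τ x hx, mul_zero]
  · filter_upwards [hC] with n hn
    refine Eventually.of_forall fun τ hτ => ?_
    rw [uIoc_of_le hab] at hτ
    have hτ' := Ioc_subset_Icc_self hτ
    refine abs_integral_delta_mul_le h.bounded (contDiff_slice h.φ_smooth τ).continuous
      (abs_nonneg M) (fun x hx => ?_) (fun x hx => h0 τ x fun hx' => hx (hKO hx'))
      h.isOpen.measurableSet (hn τ hτ')
    exact (hM (τ, x) ⟨hτ', subset_closure hx⟩).trans (le_abs_self M)
  · refine Eventually.of_forall fun τ hτ => ?_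
    rw [uIoc_of_le hab] at hτ
    exact (h.tendsto_integral_delta (Ioc_subset_Icc_self hτ)
      (hG.comp (Continuous.prodMk_right τ)) hK hKO (h0 τ)).2

lemma IsMovingDomain.tendsto_integral_step (h : IsMovingDomain wall φ a b) {τ : ℝ}
    (hτ : τ ∈ Icc a b) (s : Phase) {H : E3 → ℝ} (hH : Continuous H)
    (h0 : ∀ x ∉ {x | wall x < 0}, H x = 0) :
    Tendsto (fun n => ∫ x, step n (s.sgn * φ τ x) * H x) atTop
      (𝓝 (∫ x in signRegion {x | wall x < 0} (φ τ) s, H x)) := by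
  refine (TwoPhaseMHD.tendsto_integral_step (contDiff_slice h.φ_smooth τ).continuous
    h.isOpen.measurableSet (h.null_levelSet hτ) s
    (integrableOn_of_continuous h.bounded hH)).congr fun n => ?_
  exact setIntegral_eq_integral_of_forall_compl_eq_zero fun x hx => by rw [h0 x hx, mul_zero]

/-- Time integrals of mollified phase integrals. -/
lemma IsMovingDomain.tendsto_intervalIntegral_step (h : IsMovingDomain wall φ a b) (hab : a ≤ b)
    (s : Phase) {H : ℝ → E3 → ℝ} (hH : Continuous fun q : ℝ × E3 => H q.1 q.2) {K : Set E3}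
    (hK : IsCompact K) (hKO : K ⊆ {x | wall x < 0}) (h0 : ∀ τ, ∀ x ∉ K, H τ x = 0) :
    Tendsto (fun n => ∫ τ in a..b, ∫ x, step n (s.sgn * φ τ x) * H τ x) atTop
      (𝓝 (∫ τ in a..b, ∫ x in signRegion {x | wall x < 0} (φ τ) s, H τ x)) := by
  obtain ⟨M, hM⟩ := ((isCompact_Icc (a := a) (b := b)).prod hK).exists_bound_of_continuousOn
    hH.continuousOn
  refine intervalIntegral.tendsto_integral_filter_of_dominated_convergence
    (fun _ => M * volume.real K) ?_ ?_ intervalIntegrable_const ?_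
  · refine Eventually.of_forall fun n => Continuous.aestronglyMeasurable ?_
    exact continuous_integral_of_support ((h.continuous_step_comp s n).mul hH) hK
      fun τ x hx => by rw [h0 τ x hx, mul_zero]
  · refine Eventually.of_forall fun n => Eventually.of_forall fun τ hτ => ?_
    rw [uIoc_of_le hab] at hτ
    have hτ' := Ioc_subset_Icc_self hτ
    rw [← setIntegral_eq_integral_of_forall_compl_eq_zero (s := K)
      fun x hx => by rw [h0 τ x hx, mul_zero]]
    refine norm_setIntegral_le_of_norm_le_const hK.measure_lt_top fun x hx => ?_
    rw [norm_mul, Real.norm_of_nonneg (step_nonneg _ _)]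
    exact (mul_le_of_le_one_left (norm_nonneg _) (step_le_one _ _)).trans (hM (τ, x) ⟨hτ', hx⟩)
  · refine Eventually.of_forall fun τ hτ => ?_
    rw [uIoc_of_le hab] at hτ
    exact h.tendsto_integral_step (Ioc_subset_Icc_self hτ) s (hH.comp (Continuous.prodMk_right τ))
      fun x hx => h0 τ x fun hx' => hx (hKO hx')

/-- Differentiation of a localized phase integral, in integrated form. The integral over the
interface disappears because the interface moves with the field `u`. -/
lemma IsMovingDomain.transport_cutoff (h : IsMovingDomain wall φ a b) (hab : a ≤ b) (s : Phase)
    {u : ℝ → E3 → E3} (hu : ContDiff ℝ 1 fun q : ℝ × E3 => u q.1 q.2)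
    (hkin : ∀ τ ∈ Icc a b, ∀ x, wall x < 0 → φ τ x = 0 →
      deriv (fun τ => φ τ x) τ + fderiv ℝ (φ τ) x (u τ x) = 0)
    {e : ℝ → E3 → ℝ} (he : ContDiff ℝ 1 fun q : ℝ × E3 => e q.1 q.2) (k : ℕ) :
    (∫ x in signRegion {x | wall x < 0} (φ b) s, cutoff wall k x * e b x)
      - ∫ x in signRegion {x | wall x < 0} (φ a) s, cutoff wall k x * e a x
      = ∫ τ in a..b, ∫ x in signRegion {x | wall x < 0} (φ τ) s,
        (cutoff wall k x * deriv (fun τ => e τ x) τ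
          + divergence (fun y => (cutoff wall k y * e τ y) • u τ y) x) := by
  set c := cutoff wall k with hc
  have hcs : ContDiff ℝ 1 c := contDiff_cutoff h.wall_smooth k
  have hcc : HasCompactSupport c := hasCompactSupport_cutoff h.wall_smooth.continuous h.bounded k
  have hKO := tsupport_cutoff_subset_container h.wall_smooth.continuous k
  have hc0 : ∀ x ∉ tsupport c, c x = 0 := fun x hx => image_eq_zero_of_notMem_tsupport hx
  have hcO : ∀ x ∉ {x | wall x < 0}, c x = 0 := fun x hx => cutoff_eq_zero_of_notMem hx
  have hφ1 : ContDiff ℝ 1 fun q : ℝ × E3 => φ q.1 q.2 := h.φ_smooth.of_le one_le_two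
  have hce : ContDiff ℝ 1 fun q : ℝ × E3 => c q.2 * e q.1 q.2 := (hcs.comp contDiff_snd).mul he
  set W : ℝ → E3 → E3 := fun τ y => (c y * e τ y) • u τ y with hW
  have hWs : ContDiff ℝ 1 fun q : ℝ × E3 => W q.1 q.2 := hce.smul hu
  have hW0 : ∀ τ, ∀ x ∉ tsupport c, divergence (W τ) x = 0 := by
    intro τ x hx
    have h1 : W τ =ᶠ[𝓝 x] fun _ => 0 := by
      filter_upwards [(isClosed_tsupport c).isOpen_compl.mem_nhds hx] with y hy
      simp only [hW, hc0 y hy, zero_mul, zero_smul]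
    simp only [divergence, pderiv, h1.fderiv_eq]
    simp
  set G : ℝ → E3 → ℝ := fun τ x => s.sgn * (deriv (fun τ => φ τ x) τ
    + fderiv ℝ (φ τ) x (u τ x)) * (c x * e τ x) with hGdef
  have hG : Continuous fun q : ℝ × E3 => G q.1 q.2 :=
    (continuous_const.mul ((continuous_deriv_slice hφ1).add
      ((continuous_fderiv_slice hφ1).clm_apply hu.continuous))).mul hce.continuous
  have hG0 : ∀ τ, ∀ x ∉ tsupport c, G τ x = 0 := fun τ x hx => by simp [hGdef, hc0 x hx]
  set H : ℝ → E3 → ℝ := fun τ x => c x * deriv (fun τ => e τ x) τ + divergence (W τ) x with hHdef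
  have hH : Continuous fun q : ℝ × E3 => H q.1 q.2 :=
    ((hcs.continuous.comp continuous_snd).mul (continuous_deriv_slice he)).add
      (continuous_divergence_slice hWs)
  have hH0 : ∀ τ, ∀ x ∉ tsupport c, H τ x = 0 := fun τ x hx => by
    simp only [hHdef, hc0 x hx, hW0 τ x hx]; ring
  -- the regularized identity
  have hstep : ∀ n, ContDiff ℝ 1 fun q : ℝ × E3 => step n (s.sgn * φ q.1 q.2) := fun n =>
    ((contDiff_step n).of_le one_le_two).comp (contDiff_const.mul hφ1)
  have hreg : ∀ n, (∫ x, step n (s.sgn * φ b x) * (c x * e b x))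
      - (∫ x, step n (s.sgn * φ a x) * (c x * e a x))
      = (∫ τ in a..b, ∫ x, delta n (φ τ x) * G τ x)
        + ∫ τ in a..b, ∫ x, step n (s.sgn * φ τ x) * H τ x := by
    intro n
    have h1 := integral_sub_integral_eq (F := fun τ x => step n (s.sgn * φ τ x) * (c x * e τ x))
      ((hstep n).mul hce) hcc (fun τ x hx => by simp [hc0 x hx]) a b
    rw [h1, ← intervalIntegral.integral_add]
    · refine intervalIntegral.integral_congr fun τ _ => ?_
      have hcont1 : Continuous fun x => delta n (φ τ x) * G τ x :=
        ((h.continuous_delta_comp n).mul hG).comp (Continuous.prodMk_right τ)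
      have hcont2 : Continuous fun x => step n (s.sgn * φ τ x) * H τ x :=
        ((h.continuous_step_comp s n).mul hH).comp (Continuous.prodMk_right τ)
      have hst := contDiff_slice (f := fun τ x => step n (s.sgn * φ τ x)) (hstep n) τ
      have hdφ : ∀ x, HasFDerivAt (φ τ) (fderiv ℝ (φ τ) x) x := fun x =>
        ((contDiff_slice hφ1 τ).differentiable one_ne_zero x).hasFDerivAt
      have hd1 : ∀ x, deriv (fun τ => step n (s.sgn * φ τ x) * (c x * e τ x)) τ
          = delta n (φ τ x) * (s.sgn * deriv (fun τ => φ τ x) τ * (c x * e τ x))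
            + step n (s.sgn * φ τ x) * (c x * deriv (fun τ => e τ x) τ) := by
        intro x
        have e1 := (deriv_slice (hφ1.differentiable one_ne_zero (τ, x))).differentiableAt.hasDerivAt
        have e2 := (deriv_slice (he.differentiable one_ne_zero (τ, x))).differentiableAt.hasDerivAt
        have e3 := (hasDerivAt_step n (s.sgn * φ τ x)).comp τ (e1.const_mul s.sgn)
        have e4 := (e3.mul (e2.const_mul (c x))).deriv
        rw [Phase.delta_sgn_mul] at e4
        refine e4.trans ?_
        simp only [Function.comp_apply]
        ring
      have hd2 : ∀ x, fderiv ℝ (fun x => step n (s.sgn * φ τ x)) x (W τ x)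
          = delta n (φ τ x) * (s.sgn * fderiv ℝ (φ τ) x (u τ x) * (c x * e τ x)) := by
        intro x
        have e3 := ((hasDerivAt_step n (s.sgn * φ τ x)).comp_hasFDerivAt x
          ((hdφ x).const_mul s.sgn)).fderiv
        rw [Phase.delta_sgn_mul] at e3
        change fderiv ℝ (step n ∘ fun x => s.sgn * φ τ x) x (W τ x) = _
        rw [e3]
        simp only [smul_apply, hW, map_smul, smul_eq_mul]
        ring
      have hibp := integral_fderiv_apply_field hst (contDiff_slice hWs τ)
        (HasCompactSupport.intro hcc fun x hx => by simp [hW, hc0 x hx])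
      have i1 : Integrable fun x => delta n (φ τ x) * G τ x :=
        hcont1.integrable_of_hasCompactSupport
          (HasCompactSupport.intro hcc fun x hx => by simp [hG0 τ x hx])
      have i2 : Integrable fun x => step n (s.sgn * φ τ x) * H τ x :=
        hcont2.integrable_of_hasCompactSupport
          (HasCompactSupport.intro hcc fun x hx => by simp [hH0 τ x hx])
      have i3 : Integrable fun x => fderiv ℝ (fun x => step n (s.sgn * φ τ x)) x (W τ x) := by
        refine ((hst.continuous_fderiv one_ne_zero).clm_apply
          (contDiff_slice hWs τ).continuous).integrable_of_hasCompactSupport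
          (HasCompactSupport.intro hcc fun x hx => by simp [hW, hc0 x hx])
      have i4 : Integrable fun x => step n (s.sgn * φ τ x) * divergence (W τ) x := by
        refine (hst.continuous.mul (continuous_divergence
          (contDiff_slice hWs τ))).integrable_of_hasCompactSupport
          (HasCompactSupport.intro hcc fun x hx => by simp [hW0 τ x hx])
      have hz : ∫ x, (fderiv ℝ (fun x => step n (s.sgn * φ τ x)) x (W τ x)
          + step n (s.sgn * φ τ x) * divergence (W τ) x) = 0 := by
        rw [integral_add i3 i4, hibp, neg_add_cancel]
      have hpt : ∀ x, deriv (fun τ => step n (s.sgn * φ τ x) * (c x * e τ x)) τ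
          = (delta n (φ τ x) * G τ x + step n (s.sgn * φ τ x) * H τ x)
            - (fderiv ℝ (fun x => step n (s.sgn * φ τ x)) x (W τ x)
              + step n (s.sgn * φ τ x) * divergence (W τ) x) := by
        intro x
        rw [hd1, hd2]
        simp only [hGdef, hHdef]
        ring
      change ∫ x, deriv (fun τ => step n (s.sgn * φ τ x) * (c x * e τ x)) τ = _
      have hsub := integral_sub (i1.add i2) (i3.add i4)
      have hadd := integral_add i1 i2
      rw [integral_congr_ae (Eventually.of_forall hpt)]
      refine hsub.trans ?_
      refine (congrArg₂ (· - ·) hadd hz).trans ?_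
      exact sub_zero _
    · exact (continuous_integral_of_support ((h.continuous_delta_comp n).mul hG) hcc
        fun τ x hx => by rw [hG0 τ x hx, mul_zero]).intervalIntegrable _ _
    · exact (continuous_integral_of_support ((h.continuous_step_comp s n).mul hH) hcc
        fun τ x hx => by rw [hH0 τ x hx, mul_zero]).intervalIntegrable _ _
  have hcee : ∀ τ, Continuous fun x => c x * e τ x := fun τ =>
    hce.continuous.comp (Continuous.prodMk_right τ)
  have l1 := (h.tendsto_integral_step (right_mem_Icc.2 hab) s (hcee b)
    (fun x hx => by rw [hcO x hx, zero_mul])).sub (h.tendsto_integral_step (left_mem_Icc.2 hab) s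
    (hcee a) (fun x hx => by rw [hcO x hx, zero_mul]))
  have l2 := (h.tendsto_intervalIntegral_delta hab hG hcc hKO hG0).add
    (h.tendsto_intervalIntegral_step hab s hH hcc hKO hH0)
  have hzero : ∫ τ in a..b, ∫ x in {x | φ τ x = 0}, G τ x / ‖fderiv ℝ (φ τ) x‖
      ∂Measure.euclideanHausdorffMeasure 2 = 0 := by
    refine (intervalIntegral.integral_congr (g := fun _ => 0) fun τ hτ => ?_).trans
      intervalIntegral.integral_zero
    rw [uIcc_of_le hab] at hτ
    refine setIntegral_eq_zero_of_forall_eq_zero fun x hx => ?_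
    by_cases hxO : wall x < 0
    · simp only [hGdef, hkin τ hτ x hxO hx, mul_zero, zero_mul, zero_div]
    · simp only [hGdef, hcO x hxO, mul_zero, zero_mul, zero_div]
  rw [hzero, zero_add] at l2
  exact tendsto_nhds_unique (l1.congr hreg) l2

/-- Reynolds' transport theorem for a phase carried by an incompressible field that vanishes
linearly at the wall. -/
theorem IsMovingDomain.transport (h : IsMovingDomain wall φ a b) (hab : a ≤ b) (s : Phase)
    {u : ℝ → E3 → E3} (hu : ContDiff ℝ 1 fun q : ℝ × E3 => u q.1 q.2)
    (hkin : ∀ τ ∈ Icc a b, ∀ x, wall x < 0 → φ τ x = 0 →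
      deriv (fun τ => φ τ x) τ + fderiv ℝ (φ τ) x (u τ x) = 0)
    (hdiv : ∀ τ ∈ Icc a b, ∀ x ∈ signRegion {x | wall x < 0} (φ τ) s, divergence (u τ) x = 0)
    {C : ℝ} (hC0 : 0 ≤ C) (hC : ∀ τ ∈ Icc a b, ∀ x ∈ signRegion {x | wall x < 0} (φ τ) s,
      ‖u τ x‖ ≤ C * |wall x|)
    {e : ℝ → E3 → ℝ} (he : ContDiff ℝ 1 fun q : ℝ × E3 => e q.1 q.2) :
    (∫ x in signRegion {x | wall x < 0} (φ b) s, e b x)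
      - ∫ x in signRegion {x | wall x < 0} (φ a) s, e a x
      = ∫ τ in a..b, ∫ x in signRegion {x | wall x < 0} (φ τ) s,
        (deriv (fun τ => e τ x) τ + fderiv ℝ (e τ) x (u τ x)) := by
  have hw := h.wall_smooth
  have hRm : ∀ τ, MeasurableSet (signRegion {x | wall x < 0} (φ τ) s) := fun τ =>
    (isOpen_signRegion h.isOpen (contDiff_slice h.φ_smooth τ).continuous s).measurableSet
  have hKc := (isCompact_Icc (a := a) (b := b)).prod h.bounded.isCompact_closure
  have hsub : ∀ τ, signRegion {x | wall x < 0} (φ τ) s ⊆ {x | wall x < 0} := fun τ =>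
    signRegion_subset _ _ _
  have hfin : ∀ τ, volume (signRegion {x | wall x < 0} (φ τ) s) < ⊤ := fun τ =>
    (measure_mono (hsub τ)).trans_lt h.bounded.measure_lt_top
  -- left-hand side
  have hleft : ∀ τ, Tendsto (fun k => ∫ x in signRegion {x | wall x < 0} (φ τ) s,
      cutoff wall k x * e τ x) atTop
      (𝓝 (∫ x in signRegion {x | wall x < 0} (φ τ) s, e τ x)) := by
    intro τ
    have hcτ : Continuous (e τ) := (contDiff_slice he τ).continuous
    refine tendsto_integral_filter_of_dominated_convergence (fun x => |e τ x|) ?_ ?_ ?_ ?_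
    · exact Eventually.of_forall fun k =>
        ((contDiff_cutoff hw k).continuous.mul hcτ).aestronglyMeasurable
    · refine Eventually.of_forall fun k => Eventually.of_forall fun x => ?_
      rw [norm_mul, Real.norm_of_nonneg (cutoff_nonneg _ _)]
      exact mul_le_of_le_one_left (norm_nonneg _) (cutoff_le_one _ _)
    · exact (integrableOn_of_continuous h.bounded hcτ.abs).mono_set (hsub τ)
    · refine (ae_restrict_iff' (hRm τ)).2 (Eventually.of_forall fun x hx => ?_)
      refine tendsto_const_nhds.congr' ?_
      filter_upwards [eventually_cutoff_eq_one (hsub τ hx)] with k hk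
      rw [hk, one_mul]
  -- the integrand after expanding the divergence
  have hexp : ∀ k, ∀ τ ∈ Icc a b, ∀ x ∈ signRegion {x | wall x < 0} (φ τ) s,
      cutoff wall k x * deriv (fun τ => e τ x) τ
        + divergence (fun y => (cutoff wall k y * e τ y) • u τ y) x
      = cutoff wall k x * (deriv (fun τ => e τ x) τ + fderiv ℝ (e τ) x (u τ x))
        + e τ x * fderiv ℝ (cutoff wall k) x (u τ x) := by
    intro k τ hτ x hx
    have d1 := (contDiff_cutoff hw k).differentiable one_ne_zero x
    have d2 := (contDiff_slice he τ).differentiable one_ne_zero x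
    rw [divergence_smul (ψ := fun y => cutoff wall k y * e τ y) (d1.mul d2)
      ((contDiff_slice hu τ).differentiable one_ne_zero x),
      hdiv τ hτ x hx, fderiv_fun_mul d1 d2]
    simp only [add_apply, smul_apply, smul_eq_mul]
    ring
  have hdec := continuous_deriv_slice he
  have hfec := (continuous_fderiv_slice he).clm_apply hu.continuous
  obtain ⟨M1, hM1⟩ := hKc.exists_bound_of_continuousOn (hdec.add hfec).continuousOn
  obtain ⟨M2, hM2⟩ := hKc.exists_bound_of_continuousOn he.continuous.continuousOn
  obtain ⟨M3, hM3⟩ := h.bounded.isCompact_closure.exists_bound_of_continuousOn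
    (hw.continuous_fderiv one_ne_zero).continuousOn
  set M := |M1| + |M2| * (3 * (C * |M3|)) with hMdef
  have hbound : ∀ k, ∀ τ ∈ Icc a b, ∀ x ∈ signRegion {x | wall x < 0} (φ τ) s,
      ‖cutoff wall k x * deriv (fun τ => e τ x) τ
        + divergence (fun y => (cutoff wall k y * e τ y) • u τ y) x‖ ≤ M := by
    intro k τ hτ x hx
    rw [hexp k τ hτ x hx]
    have hxc := subset_closure (hsub τ hx)
    have b1 := (hM1 (τ, x) ⟨hτ, hxc⟩).trans (le_abs_self M1)
    have b2 := (hM2 (τ, x) ⟨hτ, hxc⟩).trans (le_abs_self M2)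
    have b3 := (hM3 x hxc).trans (le_abs_self M3)
    have b4 := abs_fderiv_cutoff_le hw (n := k) hC0 b3 (hC τ hτ x hx)
    refine (norm_add_le _ _).trans (add_le_add ?_ ?_)
    · rw [norm_mul, Real.norm_of_nonneg (cutoff_nonneg _ _)]
      exact (mul_le_of_le_one_left (norm_nonneg _) (cutoff_le_one _ _)).trans b1
    · rw [norm_mul]
      exact mul_le_mul b2 b4 (norm_nonneg _) (abs_nonneg _)
  have hcontH : ∀ k, Continuous fun q : ℝ × E3 =>
      cutoff wall k q.2 * deriv (fun τ => e τ q.2) q.1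
        + divergence (fun y => (cutoff wall k y * e q.1 y) • u q.1 y) q.2 := by
    intro k
    have hcs := contDiff_cutoff hw k
    refine ((hcs.continuous.comp continuous_snd).mul hdec).add ?_
    exact continuous_divergence_slice (F := fun τ y => (cutoff wall k y * e τ y) • u τ y)
      (((hcs.comp contDiff_snd).mul he).smul hu)
  have hM0 : 0 ≤ M := by positivity
  have hright : Tendsto (fun k => ∫ τ in a..b, ∫ x in signRegion {x | wall x < 0} (φ τ) s,
      (cutoff wall k x * deriv (fun τ => e τ x) τ
        + divergence (fun y => (cutoff wall k y * e τ y) • u τ y) x)) atTop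
      (𝓝 (∫ τ in a..b, ∫ x in signRegion {x | wall x < 0} (φ τ) s,
        (deriv (fun τ => e τ x) τ + fderiv ℝ (e τ) x (u τ x)))) := by
    refine intervalIntegral.tendsto_integral_filter_of_dominated_convergence
      (fun _ => M * volume.real {x | wall x < 0}) ?_ ?_ intervalIntegrable_const ?_
    · refine Eventually.of_forall fun k => ?_
      rw [uIoc_of_le hab]
      exact ((continuousOn_integral_signRegion h.isOpen h.bounded h.φ_smooth h.φ_regular s
        (hcontH k)).mono Ioc_subset_Icc_self).aestronglyMeasurable measurableSet_Ioc
    · refine Eventually.of_forall fun k => Eventually.of_forall fun τ hτ => ?_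
      rw [uIoc_of_le hab] at hτ
      have hτ' := Ioc_subset_Icc_self hτ
      refine (norm_setIntegral_le_of_norm_le_const (hfin τ) (hbound k τ hτ')).trans ?_
      have : volume.real (signRegion {x | wall x < 0} (φ τ) s) ≤ volume.real {x | wall x < 0} :=
        measureReal_mono (hsub τ) h.bounded.measure_lt_top.ne
      gcongr
    · refine Eventually.of_forall fun τ hτ => ?_
      rw [uIoc_of_le hab] at hτ
      have hτ' := Ioc_subset_Icc_self hτ
      refine tendsto_integral_filter_of_dominated_convergence (fun _ => M) ?_ ?_ ?_ ?_
      · exact Eventually.of_forall fun k =>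
          ((hcontH k).comp (Continuous.prodMk_right τ)).aestronglyMeasurable
      · exact Eventually.of_forall fun k =>
          (ae_restrict_iff' (hRm τ)).2 (Eventually.of_forall fun x hx => hbound k τ hτ' x hx)
      · exact integrableOn_const (hfin τ).ne
      · refine (ae_restrict_iff' (hRm τ)).2 (Eventually.of_forall fun x hx => ?_)
        refine tendsto_const_nhds.congr' ?_
        filter_upwards [eventually_cutoff_eq_one (hsub τ hx),
          eventually_cutoffSlope_eq_zero (hsub τ hx)] with k hk1 hk2
        rw [hexp k τ hτ' x hx, hk1, fderiv_cutoff hw, hk2]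
        ring
  refine tendsto_nhds_unique ((hleft b).sub (hleft a)) (hright.congr fun k => ?_)
  exact (h.transport_cutoff hab s hu hkin he k).symm

end Transport

/-! ### The divergence theorem in the two phases -/

section Flux

variable {wall : E3 → ℝ} {φ : ℝ → E3 → ℝ} {a b : ℝ}

/-- The zero level set of `f` inside the container. -/
def levelSurface (wall f : E3 → ℝ) : Set E3 := {x | wall x < 0} ∩ {x | f x = 0}

lemma IsMovingDomain.measurableSet_levelSurface (h : IsMovingDomain wall φ a b) (τ : ℝ) :
    MeasurableSet (levelSurface wall (φ τ)) :=
  h.isOpen.measurableSet.inter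
    (isClosed_eq (contDiff_slice h.φ_smooth τ).continuous continuous_const).measurableSet

lemma IsMovingDomain.area_lt_top (h : IsMovingDomain wall φ a b) {τ : ℝ} (hτ : τ ∈ Icc a b) :
    Measure.euclideanHausdorffMeasure 2 (levelSurface wall (φ τ)) < ⊤ := by
  refine (measure_mono ?_).trans_lt (measure_levelSet_inter_compact_lt_top
    ((contDiff_slice h.φ_smooth τ).of_le one_le_two) h.bounded.isCompact_closure
    (fun x hx => h.φ_regular τ hτ x hx))
  rw [levelSurface, inter_comm]
  exact inter_subset_inter_right _ subset_closure

lemma IsMovingDomain.setIntegral_levelSet (h : IsMovingDomain wall φ a b) (τ : ℝ) {f : E3 → ℝ}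
    (hf : ∀ x, ¬ wall x < 0 → f x = 0) :
    ∫ x in {x | φ τ x = 0}, f x ∂Measure.euclideanHausdorffMeasure 2
      = ∫ x in levelSurface wall (φ τ), f x ∂Measure.euclideanHausdorffMeasure 2 :=
  setIntegral_eq_of_subset_of_forall_sdiff_eq_zero
    (isClosed_eq (contDiff_slice h.φ_smooth τ).continuous continuous_const).measurableSet
    inter_subset_right fun x hx => hf x fun hw => hx.2 ⟨hw, hx.1⟩

/-- The divergence theorem in a phase, localized by a cutoff near the wall. -/
lemma IsMovingDomain.divergence_cutoff (h : IsMovingDomain wall φ a b) {τ : ℝ} (hτ : τ ∈ Icc a b)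
    (s : Phase) {F : E3 → E3} (hF : ContDiff ℝ 1 F) (k : ℕ) :
    ∫ x in signRegion {x | wall x < 0} (φ τ) s,
      (cutoff wall k x * divergence F x + fderiv ℝ (cutoff wall k) x (F x))
      = -(s.sgn * ∫ x in levelSurface wall (φ τ), cutoff wall k x
        * (fderiv ℝ (φ τ) x (F x) / ‖fderiv ℝ (φ τ) x‖) ∂Measure.euclideanHausdorffMeasure 2) := by
  set c := cutoff wall k with hc
  have hcs : ContDiff ℝ 1 c := contDiff_cutoff h.wall_smooth k
  have hcc : HasCompactSupport c := hasCompactSupport_cutoff h.wall_smooth.continuous h.bounded k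
  have hKO := tsupport_cutoff_subset_container h.wall_smooth.continuous k
  have hc0 : ∀ x ∉ tsupport c, c x = 0 := fun x hx => image_eq_zero_of_notMem_tsupport hx
  have hcO : ∀ x, ¬ wall x < 0 → c x = 0 := fun x hx => cutoff_eq_zero_of_notMem hx
  have hφ1 : ContDiff ℝ 1 (φ τ) := (contDiff_slice h.φ_smooth τ).of_le one_le_two
  have hW : ContDiff ℝ 1 fun x => c x • F x := hcs.smul hF
  have hdW : ∀ x, divergence (fun x => c x • F x) x = c x * divergence F x + fderiv ℝ c x (F x) :=
    fun x => divergence_smul (hcs.differentiable one_ne_zero x) (hF.differentiable one_ne_zero x)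
  have hH : Continuous fun x => c x * divergence F x + fderiv ℝ c x (F x) :=
    (hcs.continuous.mul (continuous_divergence hF)).add
      ((hcs.continuous_fderiv one_ne_zero).clm_apply hF.continuous)
  have hdc0 : ∀ x, ¬ wall x < 0 → fderiv ℝ c x (F x) = 0 := fun x hx => by
    rw [hc, fderiv_cutoff h.wall_smooth, cutoffSlope_eq_zero_of_notMem hx]; ring
  have hG : Continuous fun x => c x * fderiv ℝ (φ τ) x (F x) :=
    hcs.continuous.mul ((hφ1.continuous_fderiv one_ne_zero).clm_apply hF.continuous)
  have l1 := h.tendsto_integral_step hτ s hH fun x hx => by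
    rw [hcO x hx, hdc0 x hx]; ring
  have l2 := ((h.tendsto_integral_delta hτ hG hcc hKO fun x hx => by
    rw [hc0 x hx, zero_mul]).2.const_mul s.sgn).neg
  rw [h.setIntegral_levelSet τ fun x hx => by rw [hcO x hx, zero_mul, zero_div]] at l2
  simp_rw [mul_div_assoc] at l2
  refine tendsto_nhds_unique l1 (l2.congr fun n => ?_)
  have hst : ContDiff ℝ 1 fun x => step n (s.sgn * φ τ x) :=
    ((contDiff_step n).of_le one_le_two).comp (contDiff_const.mul hφ1)
  have hibp := integral_fderiv_apply_field hst hW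
    (HasCompactSupport.intro hcc fun x hx => by rw [hc0 x hx, zero_smul])
  have hd : ∀ x, fderiv ℝ (fun x => step n (s.sgn * φ τ x)) x (c x • F x)
      = s.sgn * (delta n (φ τ x) * (c x * fderiv ℝ (φ τ) x (F x))) := by
    intro x
    have e3 := ((hasDerivAt_step n (s.sgn * φ τ x)).comp_hasFDerivAt x
      ((hφ1.differentiable one_ne_zero x).hasFDerivAt.const_mul s.sgn)).fderiv
    rw [Phase.delta_sgn_mul] at e3
    change fderiv ℝ (step n ∘ fun x => s.sgn * φ τ x) x (c x • F x) = _
    rw [e3]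
    simp only [smul_apply, map_smul, smul_eq_mul]
    ring
  rw [integral_congr_ae (Eventually.of_forall hd), integral_const_mul] at hibp
  rw [hibp, neg_neg]
  refine integral_congr_ae (Eventually.of_forall fun x => ?_)
  change step n (s.sgn * φ τ x) * divergence (fun x => c x • F x) x = _
  rw [hdW]

lemma abs_fderiv_div_norm_le (f : E3 → ℝ) (x v : E3) :
    |fderiv ℝ f x v / ‖fderiv ℝ f x‖| ≤ ‖v‖ := by
  rw [abs_div, abs_norm]
  exact div_le_of_le_mul₀ (norm_nonneg _) (norm_nonneg _)
    (by rw [mul_comm]; exact (fderiv ℝ f x).le_opNorm v)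

/-- The divergence theorem in a phase for a field tangential to the wall: only the interface
contributes. -/
theorem IsMovingDomain.integral_divergence (h : IsMovingDomain wall φ a b) {τ : ℝ}
    (hτ : τ ∈ Icc a b) (s : Phase) {F : E3 → E3} (hF : ContDiff ℝ 1 F)
    (hwall : ∀ x ∈ closure (signRegion {x | wall x < 0} (φ τ) s), wall x = 0 →
      fderiv ℝ wall x (F x) = 0) :
    ∫ x in signRegion {x | wall x < 0} (φ τ) s, divergence F x
      = -(s.sgn * ∫ x in levelSurface wall (φ τ),
        fderiv ℝ (φ τ) x (F x) / ‖fderiv ℝ (φ τ) x‖ ∂Measure.euclideanHausdorffMeasure 2) := by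
  have hw := h.wall_smooth
  have hφ1 : ContDiff ℝ 1 (φ τ) := (contDiff_slice h.φ_smooth τ).of_le one_le_two
  have hRm : MeasurableSet (signRegion {x | wall x < 0} (φ τ) s) :=
    (isOpen_signRegion h.isOpen hφ1.continuous s).measurableSet
  have hsub : signRegion {x | wall x < 0} (φ τ) s ⊆ {x | wall x < 0} := signRegion_subset _ _ _
  have hdF := continuous_divergence hF
  have l1 : Tendsto (fun k => ∫ x in signRegion {x | wall x < 0} (φ τ) s,
      cutoff wall k x * divergence F x) atTop
      (𝓝 (∫ x in signRegion {x | wall x < 0} (φ τ) s, divergence F x)) := by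
    refine tendsto_integral_filter_of_dominated_convergence (fun x => |divergence F x|) ?_ ?_ ?_ ?_
    · exact Eventually.of_forall fun k =>
        ((contDiff_cutoff hw k).continuous.mul hdF).aestronglyMeasurable
    · refine Eventually.of_forall fun k => Eventually.of_forall fun x => ?_
      rw [norm_mul, Real.norm_of_nonneg (cutoff_nonneg _ _)]
      exact mul_le_of_le_one_left (norm_nonneg _) (cutoff_le_one _ _)
    · exact (integrableOn_of_continuous h.bounded hdF.abs).mono_set hsub
    · refine (ae_restrict_iff' hRm).2 (Eventually.of_forall fun x hx => ?_)
      refine tendsto_const_nhds.congr' ?_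
      filter_upwards [eventually_cutoff_eq_one (hsub hx)] with k hk
      rw [hk, one_mul]
  have l2 := l1.add (tendsto_integral_fderiv_cutoff hw h.wall_regular h.bounded hRm hsub
    hF.continuous hwall)
  rw [add_zero] at l2
  have hfin : IsFiniteMeasure ((Measure.euclideanHausdorffMeasure 2).restrict
      (levelSurface wall (φ τ))) := isFiniteMeasure_restrict.2 (h.area_lt_top hτ).ne
  obtain ⟨M, hM⟩ := h.bounded.isCompact_closure.exists_bound_of_continuousOn
    hF.continuous.continuousOn
  have hΓm := h.measurableSet_levelSurface τ
  have hmeas : Measurable fun x => fderiv ℝ (φ τ) x (F x) / ‖fderiv ℝ (φ τ) x‖ :=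
    ((hφ1.continuous_fderiv one_ne_zero).clm_apply hF.continuous).measurable.div
      (hφ1.continuous_fderiv one_ne_zero).norm.measurable
  have l3 : Tendsto (fun k => ∫ x in levelSurface wall (φ τ), cutoff wall k x
        * (fderiv ℝ (φ τ) x (F x) / ‖fderiv ℝ (φ τ) x‖) ∂Measure.euclideanHausdorffMeasure 2) atTop
      (𝓝 (∫ x in levelSurface wall (φ τ), fderiv ℝ (φ τ) x (F x) / ‖fderiv ℝ (φ τ) x‖
        ∂Measure.euclideanHausdorffMeasure 2)) := by
    refine tendsto_integral_filter_of_dominated_convergence (fun _ => M) ?_ ?_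
      (integrable_const _) ?_
    · exact Eventually.of_forall fun k =>
        ((contDiff_cutoff hw k).continuous.measurable.mul hmeas).aestronglyMeasurable
    · refine Eventually.of_forall fun k => (ae_restrict_iff' hΓm).2
        (Eventually.of_forall fun x hx => ?_)
      rw [norm_mul, Real.norm_of_nonneg (cutoff_nonneg _ _)]
      exact (mul_le_of_le_one_left (norm_nonneg _) (cutoff_le_one _ _)).trans
        ((abs_fderiv_div_norm_le _ _ _).trans (hM x (subset_closure hx.1)))
    · refine (ae_restrict_iff' hΓm).2 (Eventually.of_forall fun x hx => ?_)
      refine tendsto_const_nhds.congr' ?_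
      filter_upwards [eventually_cutoff_eq_one hx.1] with k hk
      rw [hk, one_mul]
  refine tendsto_nhds_unique l2 ((l3.const_mul s.sgn).neg.congr fun k => ?_)
  rw [← h.divergence_cutoff hτ s hF k, integral_add]
  · exact (integrableOn_of_continuous h.bounded
      ((contDiff_cutoff hw k).continuous.mul hdF)).mono_set hsub
  · exact (integrableOn_of_continuous h.bounded (((contDiff_cutoff hw k).continuous_fderiv
      one_ne_zero).clm_apply hF.continuous)).mono_set hsub

lemma IsMovingDomain.tendsto_integral_cutoff (h : IsMovingDomain wall φ a b) {τ : ℝ}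
    (hτ : τ ∈ Icc a b) :
    Tendsto (fun k => ∫ x in levelSurface wall (φ τ), cutoff wall k x
      ∂Measure.euclideanHausdorffMeasure 2) atTop
      (𝓝 ((Measure.euclideanHausdorffMeasure 2).real (levelSurface wall (φ τ)))) := by
  have hw := h.wall_smooth
  have hfin : IsFiniteMeasure ((Measure.euclideanHausdorffMeasure 2).restrict
      (levelSurface wall (φ τ))) := isFiniteMeasure_restrict.2 (h.area_lt_top hτ).ne
  have hΓm := h.measurableSet_levelSurface τ
  have l1 : Tendsto (fun k => ∫ x in levelSurface wall (φ τ), cutoff wall k x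
      ∂Measure.euclideanHausdorffMeasure 2) atTop
      (𝓝 (∫ x in levelSurface wall (φ τ), 1 ∂Measure.euclideanHausdorffMeasure 2)) := by
    refine tendsto_integral_filter_of_dominated_convergence (fun _ => 1) ?_ ?_
      (integrable_const _) ?_
    · exact Eventually.of_forall fun k => (contDiff_cutoff hw k).continuous.aestronglyMeasurable
    · refine Eventually.of_forall fun k => Eventually.of_forall fun x => ?_
      rw [Real.norm_of_nonneg (cutoff_nonneg _ _)]
      exact cutoff_le_one _ _
    · refine (ae_restrict_iff' hΓm).2 (Eventually.of_forall fun x hx => ?_)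
      exact tendsto_const_nhds.congr' ((eventually_cutoff_eq_one hx.1).mono fun k hk => hk.symm)
  rw [setIntegral_const, smul_eq_mul, mul_one] at l1
  exact l1

/-- The areas of the interfaces are bounded uniformly in time. -/
lemma IsMovingDomain.exists_area_le (h : IsMovingDomain wall φ a b) :
    ∃ C, 0 ≤ C ∧ ∀ τ ∈ Icc a b,
      (Measure.euclideanHausdorffMeasure 2).real (levelSurface wall (φ τ)) ≤ C := by
  have hw := h.wall_smooth
  have hφ1 : ContDiff ℝ 1 fun q : ℝ × E3 => φ q.1 q.2 := h.φ_smooth.of_le one_le_two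
  obtain ⟨C, hC0, hC⟩ := exists_integral_delta_le h.isOpen h.bounded h.φ_smooth h.φ_regular
  obtain ⟨M, hM⟩ := ((isCompact_Icc (a := a) (b := b)).prod
    h.bounded.isCompact_closure).exists_bound_of_continuousOn
    (continuous_fderiv_slice hφ1).continuousOn
  refine ⟨C * |M|, by positivity, fun τ hτ => ?_⟩
  have hΓm := h.measurableSet_levelSurface τ
  have l1 := h.tendsto_integral_cutoff hτ
  refine le_of_tendsto l1 (Eventually.of_forall fun k => ?_)
  have hdφ := (contDiff_slice hφ1 τ).continuous_fderiv one_ne_zero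
  have hck := (contDiff_cutoff hw k).continuous
  have l2 := (h.tendsto_integral_delta hτ (G := fun x => cutoff wall k x * ‖fderiv ℝ (φ τ) x‖)
    (hck.mul hdφ.norm)
    (hasCompactSupport_cutoff hw.continuous h.bounded k)
    (tsupport_cutoff_subset_container hw.continuous k) fun x hx => by
      rw [image_eq_zero_of_notMem_tsupport hx, zero_mul]).2
  rw [h.setIntegral_levelSet τ fun x hx => by
    rw [cutoff_eq_zero_of_notMem hx, zero_mul, zero_div]] at l2
  have heq : ∫ x in levelSurface wall (φ τ), cutoff wall k x * ‖fderiv ℝ (φ τ) x‖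
      / ‖fderiv ℝ (φ τ) x‖ ∂Measure.euclideanHausdorffMeasure 2
      = ∫ x in levelSurface wall (φ τ), cutoff wall k x ∂Measure.euclideanHausdorffMeasure 2 := by
    refine setIntegral_congr_fun hΓm fun x hx => ?_
    have := norm_ne_zero_iff.2 (h.φ_regular τ hτ x (subset_closure hx.1) hx.2)
    exact mul_div_cancel_right₀ _ this
  rw [heq] at l2
  refine le_of_tendsto l2 (hC.mono fun n hn => ?_)
  refine (le_abs_self _).trans (abs_integral_delta_mul_le h.bounded
    (contDiff_slice hφ1 τ).continuous (abs_nonneg M) (fun x hx => ?_) (fun x hx => ?_)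
    h.isOpen.measurableSet (hn τ hτ))
  · rw [abs_mul, abs_of_nonneg (cutoff_nonneg _ _), abs_norm]
    exact (mul_le_of_le_one_left (norm_nonneg _) (cutoff_le_one _ _)).trans
      ((hM (τ, x) ⟨hτ, subset_closure hx⟩).trans (le_abs_self M))
  · rw [cutoff_eq_zero_of_notMem hx, zero_mul]

end Flux

/-! ### The first variation of area -/

section Area

lemma hasFDerivAt_norm_of_ne_zero {v : E3} (hv : v ≠ 0) :
    HasFDerivAt (fun w : E3 => ‖w‖) (innerSL ℝ (‖v‖⁻¹ • v)) v := by
  have h1 := (hasStrictFDerivAt_norm_sq v).hasFDerivAt.sqrt (pow_ne_zero 2 (norm_ne_zero_iff.2 hv))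
  have h2 : (fun w : E3 => √(‖w‖ ^ 2)) = fun w => ‖w‖ :=
    funext fun w => Real.sqrt_sq (norm_nonneg w)
  rw [h2, Real.sqrt_sq (norm_nonneg v)] at h1
  refine h1.congr_fderiv ?_
  ext w
  have := norm_ne_zero_iff.2 hv
  simp
  field_simp

/-- A smooth function that agrees with the Euclidean norm away from the origin. -/
lemma exists_smooth_norm {c : ℝ} (hc : 0 < c) :
    ∃ N : E3 → ℝ, ContDiff ℝ 2 N ∧ ∀ v, c < ‖v‖ → N v = ‖v‖ := by
  let f : ContDiffBump (0 : E3) := ⟨c / 2, c, by positivity, by linarith⟩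
  refine ⟨fun v => (1 - f v) * ‖v‖, contDiff_iff_contDiffAt.2 fun v => ?_, fun v hv => ?_⟩
  · by_cases h0 : v = 0
    · have h1 : (fun v => (1 - f v) * ‖v‖) =ᶠ[𝓝 v] fun _ => 0 := by
        rw [h0]
        filter_upwards [f.eventuallyEq_one] with w hw
        rw [hw]; simp
      exact contDiffAt_const.congr_of_eventuallyEq h1
    · exact (contDiffAt_const.sub f.contDiffAt).mul (contDiffAt_norm ℝ h0)
  · have : f v = 0 := f.zero_of_le_dist (by rw [dist_zero_right]; exact hv.le)
    change (1 - f v) * ‖v‖ = ‖v‖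
    rw [this, sub_zero, one_mul]

/-- The gradient of the norm is the normalization map `v ↦ v / ‖v‖`. -/
lemma gradient_eq_of_eq_norm {N : E3 → ℝ} {c : ℝ} (hN : ∀ v, c < ‖v‖ → N v = ‖v‖) {v : E3}
    (hc : 0 < c) (hv : c < ‖v‖) : gradient N v = ‖v‖⁻¹ • v := by
  have h0 : v ≠ 0 := norm_pos_iff.1 (hc.trans hv)
  have h1 : N =ᶠ[𝓝 v] fun w => ‖w‖ := by
    filter_upwards [(isOpen_lt continuous_const continuous_norm).mem_nhds hv] with w hw
    exact hN w hw
  refine ext_inner_right ℝ fun w => ?_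
  rw [inner_gradient_eq, h1.fderiv_eq, (hasFDerivAt_norm_of_ne_zero h0).fderiv, innerSL_apply_apply]

variable {wall : E3 → ℝ} {φ : ℝ → E3 → ℝ} {a b : ℝ}

lemma hasDerivAt_fderiv_slice {f : ℝ × E3 → ℝ} (hf : ContDiff ℝ 2 f) (τ : ℝ) (x : E3)
    (v : ℝ × E3) :
    HasDerivAt (fun τ => fderiv ℝ f (τ, x) v) (fderiv ℝ (fderiv ℝ f) (τ, x) (1, 0) v) τ := by
  have hD : HasFDerivAt (fderiv ℝ f) (fderiv ℝ (fderiv ℝ f) (τ, x)) (τ, x) :=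
    ((hf.fderiv_right (m := 1) (by norm_num)).differentiable one_ne_zero (τ, x)).hasFDerivAt
  have e1 : HasDerivAt (fun τ : ℝ => (τ, x)) ((1 : ℝ), (0 : E3)) τ :=
    (hasDerivAt_id τ).prodMk (hasDerivAt_const τ x)
  have e2 := hD.comp_hasDerivAt τ e1
  exact (ContinuousLinearMap.apply ℝ ℝ v).hasFDerivAt.comp_hasDerivAt τ e2

lemma fderiv_fderiv_slice {f : ℝ × E3 → ℝ} (hf : ContDiff ℝ 2 f) (τ : ℝ) (x : E3)
    (v : ℝ × E3) :
    fderiv ℝ (fun y => fderiv ℝ f (τ, y) v) x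
      = ((ContinuousLinearMap.apply ℝ ℝ v).comp (fderiv ℝ (fderiv ℝ f) (τ, x))).comp
        (ContinuousLinearMap.inr ℝ ℝ E3) := by
  have hD : HasFDerivAt (fderiv ℝ f) (fderiv ℝ (fderiv ℝ f) (τ, x)) (τ, x) :=
    ((hf.fderiv_right (m := 1) (by norm_num)).differentiable one_ne_zero (τ, x)).hasFDerivAt
  have e2 : HasFDerivAt (fun y : E3 => (τ, y)) (ContinuousLinearMap.inr ℝ ℝ E3) x :=
    hasFDerivAt_prodMk_right τ x
  exact (((ContinuousLinearMap.apply ℝ ℝ v).hasFDerivAt.comp (τ, x) hD).comp x e2).fderiv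

/-- Time derivative and spatial gradient commute. -/
lemma inner_deriv_gradient (hφ : ContDiff ℝ 2 fun q : ℝ × E3 => φ q.1 q.2) (τ : ℝ) (x w : E3) :
    inner ℝ (deriv (fun τ => gradient (φ τ) x) τ) w
      = fderiv ℝ (fun y => deriv (fun τ => φ τ y) τ) x w := by
  have hd := hφ.differentiable two_ne_zero
  have hsymm : IsSymmSndFDerivAt ℝ (fun q : ℝ × E3 => φ q.1 q.2) (τ, x) :=
    hφ.contDiffAt.isSymmSndFDerivAt (by simp)
  have hg : HasDerivAt (fun τ => gradient (φ τ) x) (deriv (fun τ => gradient (φ τ) x) τ) τ :=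
    (deriv_slice (f := fun τ x => gradient (φ τ) x)
      ((contDiff_gradient_slice hφ).differentiable one_ne_zero
      (τ, x))).differentiableAt.hasDerivAt
  have h1 := (hg.inner ℝ (hasDerivAt_const τ w)).deriv
  rw [inner_zero_right, zero_add] at h1
  rw [← h1]
  have h2 : (fun τ => inner ℝ (gradient (φ τ) x) w)
      = fun τ => fderiv ℝ (fun q : ℝ × E3 => φ q.1 q.2) (τ, x) (0, w) := by
    funext σ
    rw [inner_gradient_eq, (fderiv_slice (f := φ) (hd (σ, x))).fderiv]
    rfl
  have h3 : (fun y => deriv (fun τ => φ τ y) τ)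
      = fun y => fderiv ℝ (fun q : ℝ × E3 => φ q.1 q.2) (τ, y) (1, 0) := by
    funext y
    exact (deriv_slice (f := φ) (hd (τ, y))).deriv
  rw [h2, h3, (hasDerivAt_fderiv_slice hφ τ x _).deriv, fderiv_fderiv_slice hφ τ x,
    hsymm (1, 0) (0, w)]
  rfl

/-- The regularized area with weight `c`, differentiated in time: the second derivatives of `φ`
are absorbed by one integration by parts along the normal field. -/
lemma integral_deriv_delta_norm (hφ : ContDiff ℝ 2 fun q : ℝ × E3 => φ q.1 q.2) {N : E3 → ℝ}
    (hN : ContDiff ℝ 2 N) {c₀ r : ℝ} (hc₀ : 0 < c₀) (hNn : ∀ v, c₀ < ‖v‖ → N v = ‖v‖) {c : E3 → ℝ}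
    (hc : ContDiff ℝ 1 c) (hcc : HasCompactSupport c) {τ : ℝ}
    (hlow : ∀ x, c x ≠ 0 → |φ τ x| ≤ r → c₀ < ‖fderiv ℝ (φ τ) x‖) {n : ℕ}
    (hn : 1 / ((n : ℝ) + 1) < r) :
    ∫ x, deriv (fun τ => delta n (φ τ x) * (c x * N (gradient (φ τ) x))) τ
      = ∫ x, delta n (φ τ x) * (-deriv (fun τ => φ τ x) τ
        * divergence (fun y => c y • gradient N (gradient (φ τ) y)) x) := by
  have hφ1 : ContDiff ℝ 1 fun q : ℝ × E3 => φ q.1 q.2 := hφ.of_le one_le_two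
  have hg := contDiff_gradient_slice hφ
  have hpt : ContDiff ℝ 1 fun q : ℝ × E3 => deriv (fun τ => φ τ q.2) q.1 :=
    contDiff_deriv_slice hφ (by norm_num)
  have hptτ : ContDiff ℝ 1 fun x : E3 => deriv (fun τ => φ τ x) τ :=
    contDiff_slice (f := fun τ x => deriv (fun τ => φ τ x) τ) hpt τ
  have hφτ := contDiff_slice hφ1 τ
  have hδ : ContDiff ℝ 1 (delta n) := contDiff_delta n (m := 1)
  have hgN : ContDiff ℝ 1 (gradient N) :=
    (InnerProductSpace.toDual ℝ E3).symm.contDiff.comp (hN.fderiv_right (by norm_num))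
  have hW : ContDiff ℝ 1 fun y => c y • gradient N (gradient (φ τ) y) :=
    hc.smul (hgN.comp (contDiff_slice (f := fun τ x => gradient (φ τ) x) hg τ))
  have hWc : HasCompactSupport fun y => c y • gradient N (gradient (φ τ) y) := hcc.smul_right
  have ha : ContDiff ℝ 1 fun x => delta n (φ τ x) * deriv (fun τ => φ τ x) τ :=
    (hδ.comp hφτ).mul hptτ
  have hibp := integral_fderiv_apply_field ha hW hWc
  have hpoint : ∀ x, deriv (fun τ => delta n (φ τ x) * (c x * N (gradient (φ τ) x))) τ
      = fderiv ℝ (fun x => delta n (φ τ x) * deriv (fun τ => φ τ x) τ) x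
        (c x • gradient N (gradient (φ τ) x)) := by
    intro x
    have d1 : HasDerivAt (fun τ => φ τ x) (deriv (fun τ => φ τ x) τ) τ :=
      (deriv_slice (hφ1.differentiable one_ne_zero (τ, x))).differentiableAt.hasDerivAt
    have d2 : HasDerivAt (fun τ => gradient (φ τ) x) (deriv (fun τ => gradient (φ τ) x) τ) τ :=
      (deriv_slice (f := fun τ x => gradient (φ τ) x)
        (hg.differentiable one_ne_zero (τ, x))).differentiableAt.hasDerivAt
    have dδ : HasDerivAt (delta n) (deriv (delta n) (φ τ x)) (φ τ x) :=
      (hδ.differentiable one_ne_zero _).hasDerivAt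
    have d3 := (dδ.comp τ d1).mul (((hN.differentiable two_ne_zero
      (gradient (φ τ) x)).hasFDerivAt.comp_hasDerivAt τ d2).const_mul (c x))
    have d4 := (dδ.comp_hasFDerivAt x (hφτ.differentiable one_ne_zero x).hasFDerivAt).mul
      (hptτ.differentiable one_ne_zero x).hasFDerivAt
    refine d3.deriv.trans ?_
    refine Eq.trans ?_ (congrArg (fun L : E3 →L[ℝ] ℝ =>
      L (c x • gradient N (gradient (φ τ) x))) d4.fderiv).symm
    simp only [Function.comp_apply, add_apply, smul_apply, smul_eq_mul, map_smul]
    by_cases hcx : c x = 0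
    · rw [hcx]; ring
    by_cases hr : |φ τ x| ≤ r
    · have hv : c₀ < ‖gradient (φ τ) x‖ := by rw [norm_gradient_eq]; exact hlow x hcx hr
      have hv0 : ‖gradient (φ τ) x‖ ≠ 0 := (hc₀.trans hv).ne'
      rw [← inner_gradient_eq N, ← inner_deriv_gradient hφ, hNn _ hv,
        gradient_eq_of_eq_norm hNn hc₀ hv, ← inner_gradient_eq (φ τ),
        real_inner_comm (‖gradient (φ τ) x‖⁻¹ • gradient (φ τ) x) (deriv _ τ),
        inner_smul_right, real_inner_self_eq_norm_sq]
      field_simp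
      ring
    · have hr' : 1 / ((n : ℝ) + 1) < |φ τ x| := hn.trans (not_le.1 hr)
      have hev : delta n =ᶠ[𝓝 (φ τ x)] fun _ => 0 := by
        filter_upwards [continuous_abs.continuousAt.eventually_const_lt hr'] with y hy
        exact delta_eq_zero hy.le
      rw [hev.deriv_eq, hev.eq_of_nhds, deriv_const]
      ring
  rw [integral_congr_ae (Eventually.of_forall hpoint), hibp, ← integral_neg]
  refine integral_congr_ae (Eventually.of_forall fun x => ?_)
  change -(delta n (φ τ x) * deriv (fun τ => φ τ x) τ * _) = _
  ring

end Area

section Area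

variable {wall : E3 → ℝ} {φ : ℝ → E3 → ℝ} {a b : ℝ}

/-- Surface integrals are measurable in time, as limits of integrals of mollified Dirac masses. -/
lemma IsMovingDomain.aestronglyMeasurable_integral_levelSurface (h : IsMovingDomain wall φ a b)
    {G : ℝ → E3 → ℝ} (hG : Continuous fun q : ℝ × E3 => G q.1 q.2) {K : Set E3} (hK : IsCompact K)
    (hKO : K ⊆ {x | wall x < 0}) (h0 : ∀ τ, ∀ x ∉ K, G τ x = 0) :
    AEStronglyMeasurable (fun τ => ∫ x in levelSurface wall (φ τ), G τ x / ‖fderiv ℝ (φ τ) x‖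
      ∂Measure.euclideanHausdorffMeasure 2) (volume.restrict (Ioc a b)) := by
  refine aestronglyMeasurable_of_tendsto_ae atTop
    (f := fun n τ => ∫ x, delta n (φ τ x) * G τ x) (fun n => ?_) ?_
  · exact (continuous_integral_of_support ((h.continuous_delta_comp n).mul hG) hK
      fun τ x hx => by rw [h0 τ x hx, mul_zero]).aestronglyMeasurable
  · refine (ae_restrict_iff' measurableSet_Ioc).2 (Eventually.of_forall fun τ hτ => ?_)
    rw [← h.setIntegral_levelSet τ fun x hx => by rw [h0 τ x fun hx' => hx (hKO hx'), zero_div]]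
    exact (h.tendsto_integral_delta (Ioc_subset_Icc_self hτ)
      (hG.comp (Continuous.prodMk_right τ)) hK hKO (h0 τ)).2

/-- First variation of area for an interface whose normal velocity vanishes linearly at the wall,
in integrated form. -/
theorem IsMovingDomain.area_evolution (h : IsMovingDomain wall φ a b) (hab : a ≤ b) {C : ℝ}
    (hC0 : 0 ≤ C) (hV : ∀ τ ∈ Icc a b, ∀ x ∈ levelSurface wall (φ τ),
      |deriv (fun τ => φ τ x) τ| ≤ C * |wall x| * ‖fderiv ℝ (φ τ) x‖) :
    (Measure.euclideanHausdorffMeasure 2).real (levelSurface wall (φ b))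
      - (Measure.euclideanHausdorffMeasure 2).real (levelSurface wall (φ a))
      = ∫ τ in a..b, ∫ x in levelSurface wall (φ τ),
        -deriv (fun τ => φ τ x) τ / ‖fderiv ℝ (φ τ) x‖ * divergence (unitGradient (φ τ)) x
        ∂Measure.euclideanHausdorffMeasure 2 := by
  have hw := h.wall_smooth
  have hφ := h.φ_smooth
  have hφ1 : ContDiff ℝ 1 fun q : ℝ × E3 => φ q.1 q.2 := hφ.of_le one_le_two
  obtain ⟨c₁, hc₁, r, hr, hlow₁⟩ := exists_gradient_lower_bound h.bounded hφ h.φ_regular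
  have hc₀ : 0 < c₁ / 2 := by positivity
  obtain ⟨N, hN, hNn⟩ := exists_smooth_norm hc₀
  have hg := contDiff_gradient_slice hφ
  have hgN : ContDiff ℝ 1 (gradient N) :=
    (InnerProductSpace.toDual ℝ E3).symm.contDiff.comp (hN.fderiv_right (by norm_num))
  have hnorm : ContDiff ℝ 1 fun q : ℝ × E3 => gradient N (gradient (φ q.1) q.2) := hgN.comp hg
  have hlow : ∀ τ ∈ Icc a b, ∀ x, wall x < 0 → |φ τ x| ≤ r → c₁ / 2 < ‖fderiv ℝ (φ τ) x‖ :=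
    fun τ hτ x hx hr => (by linarith : c₁ / 2 < c₁).trans_le (hlow₁ τ hτ x (subset_closure hx) hr)
  have hΓlow : ∀ τ ∈ Icc a b, ∀ x ∈ levelSurface wall (φ τ), c₁ / 2 < ‖fderiv ℝ (φ τ) x‖ :=
    fun τ hτ x hx => hlow τ hτ x hx.1 (by
      have : φ τ x = 0 := hx.2
      rw [this, abs_zero]; exact hr.le)
  have hdpt := continuous_deriv_slice hφ1
  have hcO : ∀ k x, ¬ wall x < 0 → cutoff wall k x = 0 :=
    fun k x hx => cutoff_eq_zero_of_notMem hx
  -- on the interface the regularized normal is the normal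
  have hnormal : ∀ τ ∈ Icc a b, ∀ x ∈ levelSurface wall (φ τ),
      (fun y => gradient N (gradient (φ τ) y)) =ᶠ[𝓝 x] unitGradient (φ τ) := by
    intro τ hτ x hx
    have hcn : Continuous fun y => ‖fderiv ℝ (φ τ) y‖ :=
      ((contDiff_slice hφ1 τ).continuous_fderiv one_ne_zero).norm
    filter_upwards [hcn.continuousAt.eventually_const_lt (hΓlow τ hτ x hx)] with y hy
    rw [← norm_gradient_eq] at hy
    exact gradient_eq_of_eq_norm hNn hc₀ hy
  have hdivN : ∀ τ ∈ Icc a b, ∀ x ∈ levelSurface wall (φ τ),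
      divergence (fun y => gradient N (gradient (φ τ) y)) x
        = divergence (unitGradient (φ τ)) x := by
    intro τ hτ x hx
    simp only [divergence, pderiv, (hnormal τ hτ x hx).fderiv_eq]
  have hW0 : ∀ k τ, ∀ x ∉ tsupport (cutoff wall k),
      divergence (fun y => cutoff wall k y • gradient N (gradient (φ τ) y)) x = 0 := by
    intro k τ x hx
    have h1 : (fun y => cutoff wall k y • gradient N (gradient (φ τ) y)) =ᶠ[𝓝 x] fun _ => 0 := by
      filter_upwards [(isClosed_tsupport (cutoff wall k)).isOpen_compl.mem_nhds hx] with y hy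
      rw [image_eq_zero_of_notMem_tsupport hy, zero_smul]
    simp only [divergence, pderiv, h1.fderiv_eq]
    simp
  -- localized first variation
  have hcut : ∀ k,
      (∫ x in levelSurface wall (φ b), cutoff wall k x ∂Measure.euclideanHausdorffMeasure 2)
      - ∫ x in levelSurface wall (φ a), cutoff wall k x ∂Measure.euclideanHausdorffMeasure 2
      = ∫ τ in a..b, ∫ x in levelSurface wall (φ τ), -deriv (fun τ => φ τ x) τ
        * divergence (fun y => cutoff wall k y • gradient N (gradient (φ τ) y)) x
        / ‖fderiv ℝ (φ τ) x‖ ∂Measure.euclideanHausdorffMeasure 2 := by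
    intro k
    set c := cutoff wall k with hc
    have hcs : ContDiff ℝ 1 c := contDiff_cutoff hw k
    have hcc : HasCompactSupport c := hasCompactSupport_cutoff hw.continuous h.bounded k
    have hKO := tsupport_cutoff_subset_container hw.continuous k
    have hc0 : ∀ x ∉ tsupport c, c x = 0 := fun x hx => image_eq_zero_of_notMem_tsupport hx
    have hWs : ContDiff ℝ 1 fun q : ℝ × E3 => c q.2 • gradient N (gradient (φ q.1) q.2) :=
      (hcs.comp contDiff_snd).smul hnorm
    have hGc : Continuous fun q : ℝ × E3 => -deriv (fun τ => φ τ q.2) q.1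
        * divergence (fun y => c y • gradient N (gradient (φ q.1) y)) q.2 :=
      hdpt.neg.mul (continuous_divergence_slice
        (F := fun τ y => c y • gradient N (gradient (φ τ) y)) hWs)
    have hG0 : ∀ τ, ∀ x ∉ tsupport c, -deriv (fun τ => φ τ x) τ
        * divergence (fun y => c y • gradient N (gradient (φ τ) y)) x = 0 := fun τ x hx => by
      rw [hW0 k τ x hx, mul_zero]
    have hcN : ContDiff ℝ 1 fun q : ℝ × E3 => c q.2 * N (gradient (φ q.1) q.2) :=
      (hcs.comp contDiff_snd).mul ((hN.of_le one_le_two).comp hg)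
    have hleft : ∀ τ ∈ Icc a b, Tendsto (fun n => ∫ x, delta n (φ τ x)
        * (c x * N (gradient (φ τ) x))) atTop
        (𝓝 (∫ x in levelSurface wall (φ τ), c x ∂Measure.euclideanHausdorffMeasure 2)) := by
      intro τ hτ
      have l1 := (h.tendsto_integral_delta hτ (G := fun x => c x * N (gradient (φ τ) x))
        (hcN.continuous.comp (Continuous.prodMk_right τ)) hcc hKO
        fun x hx => by rw [hc0 x hx, zero_mul]).2
      rw [h.setIntegral_levelSet τ fun x hx => by
        rw [show c x = 0 from hcO k x hx, zero_mul, zero_div]] at l1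
      rw [setIntegral_congr_fun (g := c) (h.measurableSet_levelSurface τ) fun x hx => ?_] at l1
      · exact l1
      have h1 := hΓlow τ hτ x hx
      have h2 : ‖fderiv ℝ (φ τ) x‖ ≠ 0 := (hc₀.trans h1).ne'
      change c x * N (gradient (φ τ) x) / ‖fderiv ℝ (φ τ) x‖ = c x
      rw [hNn _ (by rw [norm_gradient_eq]; exact h1), norm_gradient_eq, mul_div_cancel_right₀ _ h2]
    have hright := h.tendsto_intervalIntegral_delta hab (G := fun τ x => -deriv (fun τ => φ τ x) τ
        * divergence (fun y => c y • gradient N (gradient (φ τ) y)) x) hGc hcc hKO hG0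
    have hΓ : ∀ τ, ∫ x in {x | φ τ x = 0}, -deriv (fun τ => φ τ x) τ
          * divergence (fun y => c y • gradient N (gradient (φ τ) y)) x / ‖fderiv ℝ (φ τ) x‖
          ∂Measure.euclideanHausdorffMeasure 2
        = ∫ x in levelSurface wall (φ τ), -deriv (fun τ => φ τ x) τ
          * divergence (fun y => c y • gradient N (gradient (φ τ) y)) x / ‖fderiv ℝ (φ τ) x‖
          ∂Measure.euclideanHausdorffMeasure 2 := fun τ =>
      h.setIntegral_levelSet τ fun x hx => by
        rw [hG0 τ x fun hx' => hx (hKO hx'), zero_div]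
    simp only [hΓ] at hright
    refine tendsto_nhds_unique ((hleft b (right_mem_Icc.2 hab)).sub (hleft a (left_mem_Icc.2 hab)))
      (hright.congr' ?_)
    filter_upwards [eventually_inv_lt hr] with n hn
    have hF : ContDiff ℝ 1 fun q : ℝ × E3 => delta n (φ q.1 q.2)
        * (c q.2 * N (gradient (φ q.1) q.2)) :=
      ((contDiff_delta n (m := 1)).comp hφ1).mul hcN
    refine Eq.symm ((integral_sub_integral_eq (F := fun τ x => delta n (φ τ x)
      * (c x * N (gradient (φ τ) x))) hF hcc (fun τ x hx => by
        rw [hc0 x hx, zero_mul, mul_zero]) a b).trans ?_)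
    refine intervalIntegral.integral_congr fun τ hτ => ?_
    rw [uIcc_of_le hab] at hτ
    exact integral_deriv_delta_norm hφ hN hc₀ hNn hcs hcc
      (fun x hx => hlow τ hτ x (by by_contra h'; exact hx (hcO k x h'))) hn
  -- removal of the cutoff
  have hdivc : Continuous fun q : ℝ × E3 =>
      divergence (fun y => gradient N (gradient (φ q.1) y)) q.2 :=
    continuous_divergence_slice (F := fun τ y => gradient N (gradient (φ τ) y)) hnorm
  have hKc := (isCompact_Icc (a := a) (b := b)).prod h.bounded.isCompact_closure
  obtain ⟨M1, hM1⟩ := hKc.exists_bound_of_continuousOn hdpt.continuousOn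
  obtain ⟨M2, hM2⟩ := hKc.exists_bound_of_continuousOn hdivc.continuousOn
  obtain ⟨M3, hM3⟩ := h.bounded.isCompact_closure.exists_bound_of_continuousOn
    (hw.continuous_fderiv one_ne_zero).continuousOn
  obtain ⟨A, hA0, hA⟩ := h.exists_area_le
  set M := |M1| / (c₁ / 2) * |M2| + 3 * (C * |M3|) with hM
  have hM0 : 0 ≤ M := by positivity
  have hfin : ∀ τ ∈ Icc a b, IsFiniteMeasure ((Measure.euclideanHausdorffMeasure 2).restrict
      (levelSurface wall (φ τ))) := fun τ hτ => isFiniteMeasure_restrict.2 (h.area_lt_top hτ).ne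
  have hΓm := h.measurableSet_levelSurface
  have hexp : ∀ k, ∀ τ ∈ Icc a b, ∀ x ∈ levelSurface wall (φ τ), -deriv (fun τ => φ τ x) τ
        * divergence (fun y => cutoff wall k y • gradient N (gradient (φ τ) y)) x
        / ‖fderiv ℝ (φ τ) x‖
      = cutoff wall k x * (-deriv (fun τ => φ τ x) τ / ‖fderiv ℝ (φ τ) x‖
          * divergence (unitGradient (φ τ)) x)
        + fderiv ℝ (cutoff wall k) x ((-deriv (fun τ => φ τ x) τ / ‖fderiv ℝ (φ τ) x‖)
          • unitGradient (φ τ) x) := by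
    intro k τ hτ x hx
    have hd : DifferentiableAt ℝ (fun y => gradient N (gradient (φ τ) y)) x :=
      (contDiff_slice (f := fun τ y => gradient N (gradient (φ τ) y)) hnorm τ).differentiable
        one_ne_zero x
    rw [divergence_smul ((contDiff_cutoff hw k).differentiable one_ne_zero x) hd, hdivN τ hτ x hx,
      (hnormal τ hτ x hx).eq_of_nhds, map_smul, smul_eq_mul]
    ring
  have hunit : ∀ τ ∈ Icc a b, ∀ x ∈ levelSurface wall (φ τ), ‖unitGradient (φ τ) x‖ = 1 := by
    intro τ hτ x hx
    have := (hc₀.trans (hΓlow τ hτ x hx)).ne'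
    rw [unitGradient, norm_smul, norm_inv, norm_norm, norm_gradient_eq, inv_mul_cancel₀ this]
  have hbound : ∀ k, ∀ τ ∈ Icc a b, ∀ x ∈ levelSurface wall (φ τ),
      ‖-deriv (fun τ => φ τ x) τ
        * divergence (fun y => cutoff wall k y • gradient N (gradient (φ τ) y)) x
        / ‖fderiv ℝ (φ τ) x‖‖ ≤ M := by
    intro k τ hτ x hx
    have hxc : x ∈ closure {x | wall x < 0} := subset_closure hx.1
    have b0 := hΓlow τ hτ x hx
    have b1 := (hM1 (τ, x) ⟨hτ, hxc⟩).trans (le_abs_self M1)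
    have b2 := (hM2 (τ, x) ⟨hτ, hxc⟩).trans (le_abs_self M2)
    have b3 := (hM3 x hxc).trans (le_abs_self M3)
    have b4 : ‖-deriv (fun τ => φ τ x) τ / ‖fderiv ℝ (φ τ) x‖‖ ≤ |M1| / (c₁ / 2) := by
      rw [norm_div, norm_neg, norm_norm]
      exact div_le_div₀ (abs_nonneg _) b1 hc₀ b0.le
    have b5 : ‖(-deriv (fun τ => φ τ x) τ / ‖fderiv ℝ (φ τ) x‖) • unitGradient (φ τ) x‖
        ≤ C * |wall x| := by
      rw [norm_smul, hunit τ hτ x hx, mul_one, norm_div, norm_neg, norm_norm]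
      exact div_le_of_le_mul₀ (norm_nonneg _) (by positivity) (hV τ hτ x hx)
    rw [hexp k τ hτ x hx]
    refine (norm_add_le _ _).trans (add_le_add ?_ (abs_fderiv_cutoff_le hw hC0 b3 b5))
    rw [norm_mul, Real.norm_of_nonneg (cutoff_nonneg _ _)]
    refine (mul_le_of_le_one_left (norm_nonneg _) (cutoff_le_one _ _)).trans ?_
    rw [norm_mul]
    refine mul_le_mul b4 ?_ (norm_nonneg _) (by positivity)
    rw [← hdivN τ hτ x hx]
    exact b2
  have hleft : ∀ τ ∈ Icc a b, Tendsto (fun k => ∫ x in levelSurface wall (φ τ), cutoff wall k x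
      ∂Measure.euclideanHausdorffMeasure 2) atTop
      (𝓝 ((Measure.euclideanHausdorffMeasure 2).real (levelSurface wall (φ τ)))) :=
    fun τ hτ => h.tendsto_integral_cutoff hτ
  have hcontk : ∀ k, Continuous fun q : ℝ × E3 => -deriv (fun τ => φ τ q.2) q.1
      * divergence (fun y => cutoff wall k y • gradient N (gradient (φ q.1) y)) q.2 := fun k =>
    hdpt.neg.mul (continuous_divergence_slice
      (F := fun τ y => cutoff wall k y • gradient N (gradient (φ τ) y))
      (((contDiff_cutoff hw k).comp contDiff_snd).smul hnorm))
  have hright : Tendsto (fun k => ∫ τ in a..b, ∫ x in levelSurface wall (φ τ),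
        -deriv (fun τ => φ τ x) τ
        * divergence (fun y => cutoff wall k y • gradient N (gradient (φ τ) y)) x
        / ‖fderiv ℝ (φ τ) x‖ ∂Measure.euclideanHausdorffMeasure 2) atTop
      (𝓝 (∫ τ in a..b, ∫ x in levelSurface wall (φ τ),
        -deriv (fun τ => φ τ x) τ / ‖fderiv ℝ (φ τ) x‖ * divergence (unitGradient (φ τ)) x
        ∂Measure.euclideanHausdorffMeasure 2)) := by
    refine intervalIntegral.tendsto_integral_filter_of_dominated_convergence
      (fun _ => M * A) ?_ ?_ intervalIntegrable_const ?_
    · refine Eventually.of_forall fun k => ?_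
      rw [uIoc_of_le hab]
      exact (h.aestronglyMeasurable_integral_levelSurface (hcontk k)
        (hasCompactSupport_cutoff hw.continuous h.bounded k)
        (tsupport_cutoff_subset_container hw.continuous k) fun τ x hx => by
          rw [hW0 k τ x hx, mul_zero])
    · refine Eventually.of_forall fun k => Eventually.of_forall fun τ hτ => ?_
      rw [uIoc_of_le hab] at hτ
      have hτ' := Ioc_subset_Icc_self hτ
      refine (norm_setIntegral_le_of_norm_le_const (h.area_lt_top hτ')
        (hbound k τ hτ')).trans ?_
      exact mul_le_mul_of_nonneg_left (hA τ hτ') hM0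
    · refine Eventually.of_forall fun τ hτ => ?_
      rw [uIoc_of_le hab] at hτ
      have hτ' := Ioc_subset_Icc_self hτ
      have := hfin τ hτ'
      refine tendsto_integral_filter_of_dominated_convergence (fun _ => M) ?_ ?_
        (integrable_const _) ?_
      · refine Eventually.of_forall fun k => Measurable.aestronglyMeasurable ?_
        exact ((hcontk k).comp (Continuous.prodMk_right τ)).measurable.div
          ((contDiff_slice hφ1 τ).continuous_fderiv one_ne_zero).norm.measurable
      · exact Eventually.of_forall fun k =>
          (ae_restrict_iff' (hΓm τ)).2 (Eventually.of_forall fun x hx => hbound k τ hτ' x hx)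
      · refine (ae_restrict_iff' (hΓm τ)).2 (Eventually.of_forall fun x hx => ?_)
        refine tendsto_const_nhds.congr' ?_
        filter_upwards [eventually_cutoff_eq_one hx.1,
          eventually_cutoffSlope_eq_zero hx.1] with k hk1 hk2
        rw [hexp k τ hτ' x hx, hk1, fderiv_cutoff hw, hk2]
        ring
  exact tendsto_nhds_unique ((hleft b (right_mem_Icc.2 hab)).sub (hleft a (left_mem_Icc.2 hab)))
    (hright.congr fun k => (hcut k).symm)

end Area

/-! ### The local energy balance -/

section Balance

lemma pderiv_coord {F : E3 → E3} {x : E3} (hF : DifferentiableAt ℝ F x) (i j : Fin 3) :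
    pderiv j F x i = pderiv j (fun y => F y i) x :=
  (fderiv_coord hF i _).symm

lemma pderiv_mul {f g : E3 → ℝ} {x : E3} (hf : DifferentiableAt ℝ f x)
    (hg : DifferentiableAt ℝ g x) (i : Fin 3) :
    pderiv i (fun y => f y * g y) x = pderiv i f x * g x + f x * pderiv i g x := by
  simp only [pderiv, fderiv_fun_mul hf hg, add_apply, smul_apply, smul_eq_mul]
  ring

lemma applyTensor_apply (A : Matrix (Fin 3) (Fin 3) ℝ) (v : E3) (i : Fin 3) :
    applyTensor A v i = ∑ j, A i j * v j := rfl

lemma inner_applyTensor_comm {A : Matrix (Fin 3) (Fin 3) ℝ} (hA : ∀ i j, A i j = A j i) (v w : E3) :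
    inner ℝ v (applyTensor A w) = inner ℝ (applyTensor A v) w := by
  simp only [PiLp.inner_apply, applyTensor_apply, Fin.sum_univ_three, RCLike.inner_apply,
    conj_trivial, hA 1 0, hA 2 0, hA 2 1]
  ring

lemma applyTensor_zero (A : Matrix (Fin 3) (Fin 3) ℝ) : applyTensor A 0 = 0 := by
  ext i; simp [applyTensor_apply]

lemma applyTensor_sub_left (A A' : Matrix (Fin 3) (Fin 3) ℝ) (v : E3) :
    applyTensor (A - A') v = applyTensor A v - applyTensor A' v := by
  ext i
  simp [applyTensor_apply, sub_mul]

/-- The product rule for the work of a symmetric stress tensor. -/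
lemma divergence_applyTensor {A : E3 → Matrix (Fin 3) (Fin 3) ℝ} {u : E3 → E3} {x : E3}
    (hA : ∀ i j, DifferentiableAt ℝ (fun y => A y i j) x) (hsymm : ∀ y i j, A y i j = A y j i)
    (hu : DifferentiableAt ℝ u x) :
    divergence (fun y => applyTensor (A y) (u y)) x
      = inner ℝ (u x) (tensorDivergence A x) + ∑ i, ∑ j, A x i j * pderiv i u x j := by
  have huj : ∀ j, DifferentiableAt ℝ (fun y => u y j) x := fun j => by fun_prop
  have hd : DifferentiableAt ℝ (fun y => applyTensor (A y) (u y)) x := by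
    refine differentiableAt_euclidean.2 fun i => ?_
    simp only [applyTensor_apply]
    fun_prop
  have h1 : ∀ i, pderiv i (fun y => applyTensor (A y) (u y)) x i
      = ∑ j, (pderiv i (fun y => A y i j) x * u x j + A x i j * pderiv i u x j) := by
    intro i
    rw [pderiv_coord hd]
    have h := fderiv_fun_sum (u := Finset.univ) (A := fun j y => A y i j * u y j) (x := x)
      fun j _ => (hA i j).mul (huj j)
    refine (congrArg (fun L : E3 →L[ℝ] ℝ => L (EuclideanSpace.single i 1)) h).trans ?_
    rw [sum_apply]
    refine Finset.sum_congr rfl fun j _ => ?_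
    rw [pderiv_coord hu]
    exact pderiv_mul (hA i j) (huj j) i
  have h2 : ∀ i j, (fun y => A y i j) = fun y => A y j i := fun i j => funext fun y => hsymm y i j
  rw [divergence, Finset.sum_congr rfl fun i _ => h1 i]
  simp only [Finset.sum_add_distrib, tensorDivergence, PiLp.inner_apply, RCLike.inner_apply,
    conj_trivial]
  congr 1
  rw [Finset.sum_comm]
  refine Finset.sum_congr rfl fun j _ => ?_
  rw [Finset.sum_mul]
  exact Finset.sum_congr rfl fun i _ => by rw [h2]

/-- The antisymmetry of the triple product, by which the work of the Lorentz force is minus the work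
of the motional electric field. -/
lemma inner_cross_comm (a b c : E3) : inner ℝ a (cross b c) = -inner ℝ b (cross a c) := by
  simp [PiLp.inner_apply, cross, crossProduct, Fin.sum_univ_three]
  ring

lemma deformation_symm (u : E3 → E3) (x : E3) (i j : Fin 3) :
    deformation u x i j = deformation u x j i := by
  simp [deformation, add_comm]

variable (S : Data)

lemma Data.stress_apply (s : Phase) (t : ℝ) (x : E3) (i j : Fin 3) :
    S.stress s t x i j = 2 * S.η s * deformation (S.u s t) x i j
      - S.p s t x * (1 : Matrix (Fin 3) (Fin 3) ℝ) i j := rfl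

lemma Data.stress_symm (s : Phase) (t : ℝ) (x : E3) (i j : Fin 3) :
    S.stress s t x i j = S.stress s t x j i := by
  rw [S.stress_apply, S.stress_apply, deformation_symm, Matrix.one_apply, Matrix.one_apply]
  simp only [eq_comm]

/-- The energy flux: the power of the stress minus the electric power transported by the
current. -/
def Data.flux (s : Phase) (t : ℝ) (x : E3) : E3 :=
  applyTensor (S.stress s t x) (S.u s t x) - S.V s t x • S.J s t x

/-- The dissipated power per unit volume. -/
def Data.dissipation (s : Phase) (t : ℝ) (x : E3) : ℝ :=
  2 * S.η s * frobeniusSq (deformation (S.u s t) x) + (S.σ s)⁻¹ * ‖S.J s t x‖ ^ 2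

/-- The kinetic and gravitational energy per unit volume. -/
def Data.energyDensity (s : Phase) (t : ℝ) (x : E3) : ℝ :=
  1 / 2 * S.ρ s * ‖S.u s t x‖ ^ 2 + S.ρ s * S.g * x 2

variable {S} {s : Phase} {t : ℝ}

lemma contDiff_pderiv {u : E3 → E3} (hu : ContDiff ℝ 2 u) (i j : Fin 3) :
    ContDiff ℝ 1 fun x => pderiv i u x j := by
  have h1 : ContDiff ℝ 1 fun x => fderiv ℝ u x (EuclideanSpace.single i 1) :=
    (hu.fderiv_right (m := 1) (by norm_num)).clm_apply contDiff_const
  exact contDiff_euclidean.1 h1 j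

lemma Data.contDiff_stress (hu : ContDiff ℝ 2 (S.u s t)) (hp : ContDiff ℝ 1 (S.p s t))
    (i j : Fin 3) : ContDiff ℝ 1 fun x => S.stress s t x i j := by
  simp only [S.stress_apply, deformation, Matrix.of_apply]
  have h1 := contDiff_pderiv hu i j
  have h2 := contDiff_pderiv hu j i
  fun_prop

lemma Data.contDiff_flux (hu : ContDiff ℝ 2 (S.u s t)) (hp : ContDiff ℝ 1 (S.p s t))
    (hJ : ContDiff ℝ 1 (S.J s t)) (hV : ContDiff ℝ 1 (S.V s t)) : ContDiff ℝ 1 (S.flux s t) := by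
  refine ContDiff.sub ?_ (hV.smul hJ)
  refine contDiff_euclidean.2 fun i => ?_
  simp only [applyTensor_apply]
  exact ContDiff.sum fun j _ =>
    (S.contDiff_stress hu hp i j).mul (contDiff_euclidean.1 (hu.of_le one_le_two) j)

/-- The divergence of the energy flux accounts for the power of the forces and the
dissipation: the Lorentz force does no work besides the transfer of electric power. -/
lemma Data.divergence_flux {x : E3} (hu : ContDiff ℝ 2 (S.u s t)) (hp : ContDiff ℝ 1 (S.p s t))
    (hJ : ContDiff ℝ 1 (S.J s t)) (hV : ContDiff ℝ 1 (S.V s t)) {a : E3} (hσ : S.σ s ≠ 0)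
    (hmom : S.ρ s • a = tensorDivergence (S.stress s t) x + cross (S.J s t x) (S.B x)
      + S.ρ s • S.gravity)
    (hdiv : divergence (S.u s t) x = 0)
    (hohm : S.J s t x = S.σ s • (-gradient (S.V s t) x + cross (S.u s t x) (S.B x)))
    (hcharge : divergence (S.J s t) x = 0) :
    S.ρ s * inner ℝ (S.u s t x) a + S.ρ s * S.g * S.u s t x 2
      = divergence (S.flux s t) x - S.dissipation s t x := by
  have hud := hu.differentiable two_ne_zero x
  have hJd := hJ.differentiable one_ne_zero x
  have hVd := hV.differentiable one_ne_zero x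
  have hSd : ∀ i j, DifferentiableAt ℝ (fun y => S.stress s t y i j) x := fun i j =>
    (S.contDiff_stress hu hp i j).differentiable one_ne_zero x
  have h1 : divergence (S.flux s t) x
      = divergence (fun y => applyTensor (S.stress s t y) (S.u s t y)) x
        - divergence (fun y => S.V s t y • S.J s t y) x := by
    refine divergence_sub ?_ (hVd.smul hJd)
    refine differentiableAt_euclidean.2 fun i => ?_
    simp only [applyTensor_apply]
    have huj : ∀ j, DifferentiableAt ℝ (fun y => S.u s t y j) x := fun j => by fun_prop
    fun_prop
  have h2 : ∑ i, ∑ j, S.stress s t x i j * pderiv i (S.u s t) x j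
      = 2 * S.η s * frobeniusSq (deformation (S.u s t) x)
        - S.p s t x * divergence (S.u s t) x := by
    simp only [S.stress_apply, frobeniusSq, divergence, deformation, Matrix.of_apply,
      Fin.sum_univ_three, Matrix.one_apply]
    simp
    ring
  have h3 := congrArg (fun v => inner ℝ (S.u s t x) v) hmom
  simp only [inner_add_right, inner_smul_right] at h3
  have h4 : inner ℝ (S.u s t x) S.gravity = -S.g * S.u s t x 2 := by
    simp [Data.gravity, EuclideanSpace.inner_single_right]
  have h5 : inner ℝ (S.J s t x) (cross (S.u s t x) (S.B x))
      = (S.σ s)⁻¹ * ‖S.J s t x‖ ^ 2 + inner ℝ (gradient (S.V s t) x) (S.J s t x) := by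
    have h6 : cross (S.u s t x) (S.B x) = (S.σ s)⁻¹ • S.J s t x + gradient (S.V s t) x := by
      conv_rhs => rw [hohm]
      rw [inv_smul_smul₀ hσ]
      abel
    rw [h6, inner_add_right, inner_smul_right, real_inner_self_eq_norm_sq, real_inner_comm]
  rw [h1, divergence_applyTensor hSd (S.stress_symm s t) hud, h2, hdiv,
    divergence_smul hVd hJd, hcharge, ← inner_gradient_eq, Data.dissipation, h3, h4,
    inner_cross_comm, h5]
  ring

lemma fderiv_div_norm_eq_inner (f : E3 → ℝ) (x v : E3) :
    fderiv ℝ f x v / ‖fderiv ℝ f x‖ = inner ℝ (unitGradient f x) v := by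
  rw [unitGradient, inner_smul_left, inner_gradient_eq, norm_gradient_eq, div_eq_inv_mul]
  rfl

/-- The jump of the normal energy flux is the power of the surface tension. -/
lemma Data.inner_normal_flux_sub {x : E3}
    (hst : applyTensor (Data.jump S.stress t x) (S.normal t x)
      = -(S.surfTension * S.curvature t x) • S.normal t x)
    (hu : Data.jump S.u t x = 0)
    (hkin : S.normalVelocity t x = inner ℝ (S.u .plus t x) (S.normal t x))
    (hJ : Data.jump (fun s τ y => inner ℝ (S.J s τ y) (S.normal τ y)) t x = 0)
    (hV : Data.jump S.V t x = 0) :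
    inner ℝ (S.normal t x) (S.flux .plus t x) - inner ℝ (S.normal t x) (S.flux .minus t x)
      = -(S.surfTension * S.curvature t x * S.normalVelocity t x) := by
  have hu' : S.u .minus t x = S.u .plus t x := (sub_eq_zero.1 hu).symm
  have hV' : S.V .minus t x = S.V .plus t x := (sub_eq_zero.1 hV).symm
  have hJ' : inner ℝ (S.J .plus t x) (S.normal t x) = inner ℝ (S.J .minus t x) (S.normal t x) :=
    sub_eq_zero.1 hJ
  have h1 := congrArg (fun v => inner ℝ v (S.u .plus t x)) hst
  rw [Data.jump, applyTensor_sub_left] at h1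
  simp only [inner_sub_left, inner_smul_left, conj_trivial] at h1
  simp only [Data.flux, inner_sub_right, inner_smul_right, hu', hV']
  rw [inner_applyTensor_comm (S.stress_symm _ _ _), inner_applyTensor_comm (S.stress_symm _ _ _),
    real_inner_comm (S.J .plus t x), real_inner_comm (S.J .minus t x), hJ', hkin,
    real_inner_comm (S.normal t x) (S.u .plus t x)]
  linarith

end Balance

/-! ### Conservation of mass and the energy identity on a time interval -/

/-- The two-phase system on the compact time interval `[a, b]`, for fields that are smooth on the
whole space-time. Of the physical constants, only `σ ≠ 0` is required. -/
structure Data.IsSolutionOn (S : Data) (a b : ℝ) : Prop where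
  domain : IsMovingDomain S.wall S.φ a b
  conductivity_ne_zero : ∀ s, S.σ s ≠ 0
  u_smooth : ∀ s, ContDiff ℝ 2 fun q : ℝ × E3 => S.u s q.1 q.2
  p_smooth : ∀ s, ContDiff ℝ 1 fun q : ℝ × E3 => S.p s q.1 q.2
  J_smooth : ∀ s, ContDiff ℝ 1 fun q : ℝ × E3 => S.J s q.1 q.2
  V_smooth : ∀ s, ContDiff ℝ 1 fun q : ℝ × E3 => S.V s q.1 q.2
  momentum : ∀ s, ∀ t ∈ Icc a b, ∀ x ∈ S.region s t,
    S.ρ s • (deriv (fun τ => S.u s τ x) t + fderiv ℝ (S.u s t) x (S.u s t x))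
      = tensorDivergence (S.stress s t) x + cross (S.J s t x) (S.B x) + S.ρ s • S.gravity
  incompressible : ∀ s, ∀ t ∈ Icc a b, ∀ x ∈ S.region s t, divergence (S.u s t) x = 0
  ohm : ∀ s, ∀ t ∈ Icc a b, ∀ x ∈ S.region s t,
    S.J s t x = S.σ s • (-gradient (S.V s t) x + cross (S.u s t x) (S.B x))
  charge : ∀ s, ∀ t ∈ Icc a b, ∀ x ∈ S.region s t, divergence (S.J s t) x = 0
  jump_stress : ∀ t ∈ Icc a b, ∀ x ∈ S.Γ t,
    applyTensor (Data.jump S.stress t x) (S.normal t x)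
      = -(S.surfTension * S.curvature t x) • S.normal t x
  jump_velocity : ∀ t ∈ Icc a b, ∀ x ∈ S.Γ t, Data.jump S.u t x = 0
  kinematic : ∀ s, ∀ t ∈ Icc a b, ∀ x ∈ S.Γ t,
    S.normalVelocity t x = inner ℝ (S.u s t x) (S.normal t x)
  jump_current : ∀ t ∈ Icc a b, ∀ x ∈ S.Γ t,
    Data.jump (fun s τ y => inner ℝ (S.J s τ y) (S.normal τ y)) t x = 0
  jump_potential : ∀ t ∈ Icc a b, ∀ x ∈ S.Γ t, Data.jump S.V t x = 0
  no_slip : ∀ s, ∀ t ∈ Icc a b, ∀ x ∈ frontier S.Ω ∩ closure (S.region s t), S.u s t x = 0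
  insulating : ∀ s, ∀ t ∈ Icc a b, ∀ x ∈ frontier S.Ω ∩ closure (S.region s t),
    inner ℝ (S.J s t x) (S.wallNormal x) = 0

section Energy

variable {S : Data} {a b : ℝ}

lemma Data.region_eq (S : Data) (s : Phase) (t : ℝ) :
    S.region s t = signRegion {x | S.wall x < 0} (S.φ t) s := by
  cases s <;> ext x <;> simp [Data.region, signRegion, Phase.sgn, Data.Ω]

/-- The interface is the zero level set of `φ`. -/
lemma Data.Γ_eq (hO : IsOpen {x | S.wall x < 0}) {t : ℝ} (hφ : Differentiable ℝ (S.φ t))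
    (hreg : ∀ x ∈ closure {x | S.wall x < 0}, S.φ t x = 0 → fderiv ℝ (S.φ t) x ≠ 0) :
    S.Γ t = levelSurface S.wall (S.φ t) := by
  have hop : ∀ s, IsOpen (S.region s t) := fun s => by
    rw [S.region_eq]; exact isOpen_signRegion hO hφ.continuous s
  ext x
  constructor
  · rintro ⟨hx, h1, h2⟩
    rw [(hop _).frontier_eq] at h1 h2
    refine ⟨hx, le_antisymm (not_lt.1 fun h => h1.2 ⟨hx, h⟩) (not_lt.1 fun h => h2.2 ⟨hx, h⟩)⟩
  · rintro ⟨hx, h0⟩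
    have h0' : S.φ t x = 0 := h0
    have hmem : ∀ s, x ∈ closure (S.region s t) := fun s => by
      rw [S.region_eq]
      exact mem_closure_signRegion hO hφ hx (hreg x (subset_closure hx))
        (by rw [h0', mul_zero])
    refine ⟨hx, ?_, ?_⟩
    · rw [(hop _).frontier_eq]
      exact ⟨hmem _, fun h => h.2.ne' h0'⟩
    · rw [(hop _).frontier_eq]
      exact ⟨hmem _, fun h => h.2.ne h0'⟩

namespace Data.IsSolutionOn

lemma mono (h : S.IsSolutionOn a b) {a' b' : ℝ} (hs : Icc a' b' ⊆ Icc a b) :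
    S.IsSolutionOn a' b' where
  domain := ⟨h.domain.bounded, h.domain.wall_smooth, h.domain.wall_regular, h.domain.φ_smooth,
    fun τ hτ => h.domain.φ_regular τ (hs hτ)⟩
  conductivity_ne_zero := h.conductivity_ne_zero
  u_smooth := h.u_smooth
  p_smooth := h.p_smooth
  J_smooth := h.J_smooth
  V_smooth := h.V_smooth
  momentum s t ht := h.momentum s t (hs ht)
  incompressible s t ht := h.incompressible s t (hs ht)
  ohm s t ht := h.ohm s t (hs ht)
  charge s t ht := h.charge s t (hs ht)
  jump_stress t ht := h.jump_stress t (hs ht)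
  jump_velocity t ht := h.jump_velocity t (hs ht)
  kinematic s t ht := h.kinematic s t (hs ht)
  jump_current t ht := h.jump_current t (hs ht)
  jump_potential t ht := h.jump_potential t (hs ht)
  no_slip s t ht := h.no_slip s t (hs ht)
  insulating s t ht := h.insulating s t (hs ht)

lemma Γ_eq (h : S.IsSolutionOn a b) {t : ℝ} (ht : t ∈ Icc a b) :
    S.Γ t = levelSurface S.wall (S.φ t) :=
  Data.Γ_eq h.domain.isOpen ((contDiff_slice h.domain.φ_smooth t).differentiable two_ne_zero)
    (h.domain.φ_regular t ht)

lemma isOpen_region (h : S.IsSolutionOn a b) (s : Phase) (t : ℝ) : IsOpen (S.region s t) := by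
  rw [S.region_eq]
  exact isOpen_signRegion h.domain.isOpen (contDiff_slice h.domain.φ_smooth t).continuous s

/-- The interface is carried along by the velocity field of either phase. -/
lemma normal_velocity_eq (h : S.IsSolutionOn a b) (s : Phase) {t : ℝ} (ht : t ∈ Icc a b) {x : E3}
    (hx : x ∈ levelSurface S.wall (S.φ t)) :
    deriv (fun τ => S.φ τ x) t + fderiv ℝ (S.φ t) x (S.u s t x) = 0 := by
  have h1 := h.kinematic s t ht x (by rw [h.Γ_eq ht]; exact hx)
  have h0 : ‖fderiv ℝ (S.φ t) x‖ ≠ 0 :=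
    norm_ne_zero_iff.2 (h.domain.φ_regular t ht x (subset_closure hx.1) hx.2)
  rw [Data.normal, real_inner_comm, ← fderiv_div_norm_eq_inner, Data.normalVelocity,
    norm_gradient_eq, div_left_inj' h0] at h1
  rw [← h1, add_neg_cancel]

/-- No slip, in the quantitative form used near the wall and at contact lines. -/
lemma exists_velocity_bound (h : S.IsSolutionOn a b) :
    ∃ C, 0 ≤ C ∧ ∀ τ ∈ Icc a b, ∀ s, ∀ x, S.wall x < 0 → 0 ≤ s.sgn * S.φ τ x →
      ‖S.u s τ x‖ ≤ C * |S.wall x| := by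
  refine h.domain.exists_velocity_bound (fun s => (h.u_smooth s).of_le one_le_two)
    (fun τ hτ x hx h0 => ?_) fun s τ hτ x hx hxc => ?_
  · exact sub_eq_zero.1 (h.jump_velocity τ hτ x (by rw [h.Γ_eq hτ]; exact ⟨hx, h0⟩))
  · refine h.no_slip s τ hτ x ⟨?_, ?_⟩
    · rw [Data.Ω, frontier_container h.domain.wall_smooth h.domain.wall_regular]
      exact hx
    · rw [S.region_eq]
      exact hxc

/-- Transport of a smooth density with the fluid of one phase. -/
lemma transport (h : S.IsSolutionOn a b) (hab : a ≤ b) (s : Phase) {e : ℝ → E3 → ℝ}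
    (he : ContDiff ℝ 1 fun q : ℝ × E3 => e q.1 q.2) :
    (∫ x in S.region s b, e b x) - ∫ x in S.region s a, e a x
      = ∫ τ in a..b, ∫ x in S.region s τ,
        (deriv (fun τ => e τ x) τ + fderiv ℝ (e τ) x (S.u s τ x)) := by
  obtain ⟨C, hC0, hC⟩ := h.exists_velocity_bound
  simp only [S.region_eq]
  refine h.domain.transport hab s ((h.u_smooth s).of_le one_le_two)
    (fun τ hτ x hx h0 => h.normal_velocity_eq s hτ ⟨hx, h0⟩) (fun τ hτ x hx => ?_) hC0
    (fun τ hτ x hx => hC τ hτ s x hx.1 hx.2.le) he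
  rw [← S.region_eq] at hx
  exact h.incompressible s τ hτ x hx

lemma continuousOn_integral_region (h : S.IsSolutionOn a b) (s : Phase) {f : ℝ → E3 → ℝ}
    (hf : Continuous fun q : ℝ × E3 => f q.1 q.2) :
    ContinuousOn (fun τ => ∫ x in S.region s τ, f τ x) (Icc a b) := by
  simp only [S.region_eq]
  exact continuousOn_integral_signRegion h.domain.isOpen h.domain.bounded h.domain.φ_smooth
    h.domain.φ_regular s hf

/-- Conservation of the mass of each phase. -/
theorem mass_eq (h : S.IsSolutionOn a b) (hab : a ≤ b) (s : Phase) : S.mass s b = S.mass s a := by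
  have h1 := h.transport hab s (e := fun _ _ => S.ρ s) contDiff_const
  refine sub_eq_zero.1 (h1.trans ?_)
  simp

lemma contDiff_energyDensity (h : S.IsSolutionOn a b) (s : Phase) :
    ContDiff ℝ 1 fun q : ℝ × E3 => S.energyDensity s q.1 q.2 := by
  have h2 : ContDiff ℝ 1 fun q : ℝ × E3 => q.2 2 := contDiff_euclidean.1 contDiff_snd 2
  exact (contDiff_const.mul (((h.u_smooth s).of_le one_le_two).norm_sq ℝ)).add
    (contDiff_const.mul h2)

lemma continuous_energyRate (h : S.IsSolutionOn a b) (s : Phase) :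
    Continuous fun q : ℝ × E3 => deriv (fun τ => S.energyDensity s τ q.2) q.1
      + fderiv ℝ (S.energyDensity s q.1) q.2 (S.u s q.1 q.2) :=
  (continuous_deriv_slice (h.contDiff_energyDensity s)).add
    ((continuous_fderiv_slice (h.contDiff_energyDensity s)).clm_apply (h.u_smooth s).continuous)

lemma continuous_dissipation (h : S.IsSolutionOn a b) (s : Phase) :
    Continuous fun q : ℝ × E3 => S.dissipation s q.1 q.2 := by
  have hd := continuous_fderiv_slice ((h.u_smooth s).of_le one_le_two)
  have hp : ∀ i j, Continuous fun q : ℝ × E3 => pderiv i (S.u s q.1) q.2 j := fun i j => by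
    have := hd.clm_apply (continuous_const (y := (EuclideanSpace.single i 1 : E3)))
    unfold pderiv
    fun_prop
  have hJ := (h.J_smooth s).continuous
  have hD : ∀ i j, Continuous fun q : ℝ × E3 => deformation (S.u s q.1) q.2 i j ^ 2 := fun i j =>
    (((hp j i).add (hp i j)).div_const 2).pow 2
  refine Continuous.add ?_ (continuous_const.mul (hJ.norm.pow 2))
  exact continuous_const.mul
    (continuous_finsetSum _ fun i _ => continuous_finsetSum _ fun j _ => hD i j)

/-- The local energy balance: the energy carried along with the fluid changes by the energy flux
and the dissipation. -/
lemma energyRate_eq (h : S.IsSolutionOn a b) (s : Phase) {t : ℝ} (ht : t ∈ Icc a b) {x : E3}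
    (hx : x ∈ S.region s t) :
    deriv (fun τ => S.energyDensity s τ x) t + fderiv ℝ (S.energyDensity s t) x (S.u s t x)
      = divergence (S.flux s t) x - S.dissipation s t x := by
  have hu1 := (h.u_smooth s).of_le one_le_two
  rw [← Data.divergence_flux (contDiff_slice (h.u_smooth s) t) (contDiff_slice (h.p_smooth s) t)
    (contDiff_slice (h.J_smooth s) t) (contDiff_slice (h.V_smooth s) t) (h.conductivity_ne_zero s)
    (h.momentum s t ht x hx) (h.incompressible s t ht x hx) (h.ohm s t ht x hx)
    (h.charge s t ht x hx)]
  have d1 : HasDerivAt (fun τ => S.u s τ x) (deriv (fun τ => S.u s τ x) t) t :=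
    (deriv_slice (hu1.differentiable one_ne_zero (t, x))).differentiableAt.hasDerivAt
  have d2 : HasFDerivAt (S.u s t) (fderiv ℝ (S.u s t) x) x :=
    ((contDiff_slice hu1 t).differentiable one_ne_zero x).hasFDerivAt
  have d3 := ((d1.norm_sq.const_mul (1 / 2 * S.ρ s)).add_const (S.ρ s * S.g * x 2)).deriv
  have d5 : HasFDerivAt (fun y : E3 => y 2) (EuclideanSpace.proj 2 : E3 →L[ℝ] ℝ) x :=
    (EuclideanSpace.proj 2 : E3 →L[ℝ] ℝ).hasFDerivAt
  have d4 := ((d2.norm_sq.const_mul (1 / 2 * S.ρ s)).add (d5.const_mul (S.ρ s * S.g))).fderiv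
  have e3 : deriv (fun τ => S.energyDensity s τ x) t = _ := d3
  have e4 : fderiv ℝ (S.energyDensity s t) x = _ := d4
  rw [e3, e4]
  simp only [inner_add_right, add_apply, smul_apply, smul_eq_mul, ContinuousLinearMap.comp_apply,
    innerSL_apply_apply]
  simp
  ring

lemma integrableOn_region (h : S.IsSolutionOn a b) (s : Phase) (t : ℝ) {f : E3 → ℝ}
    (hf : Continuous f) : IntegrableOn f (S.region s t) := by
  rw [S.region_eq]
  exact (integrableOn_of_continuous h.domain.bounded hf).mono_set (signRegion_subset _ _ _)

/-- The divergence theorem for the energy flux of one phase: the walls do not contribute. -/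
lemma integral_divergence_flux (h : S.IsSolutionOn a b) (s : Phase) {t : ℝ} (ht : t ∈ Icc a b) :
    ∫ x in S.region s t, divergence (S.flux s t) x
      = -(s.sgn * ∫ x in levelSurface S.wall (S.φ t), inner ℝ (S.normal t x) (S.flux s t x)
        ∂Measure.euclideanHausdorffMeasure 2) := by
  have hF := Data.contDiff_flux (contDiff_slice (h.u_smooth s) t) (contDiff_slice (h.p_smooth s) t)
    (contDiff_slice (h.J_smooth s) t) (contDiff_slice (h.V_smooth s) t)
  rw [S.region_eq, h.domain.integral_divergence ht s hF]
  · simp only [fderiv_div_norm_eq_inner, Data.normal]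
  · intro x hx hw
    have hmem : x ∈ frontier S.Ω ∩ closure (S.region s t) := by
      rw [Data.Ω, frontier_container h.domain.wall_smooth h.domain.wall_regular, S.region_eq]
      exact ⟨hw, hx⟩
    have hu := h.no_slip s t ht x hmem
    have hJ := h.insulating s t ht x hmem
    rw [Data.wallNormal, real_inner_comm, ← fderiv_div_norm_eq_inner, div_eq_zero_iff,
      norm_eq_zero, or_iff_left (h.domain.wall_regular x hw)] at hJ
    rw [Data.flux, hu, applyTensor_zero, zero_sub, map_neg, map_smul, hJ, smul_zero, neg_zero]

lemma integrableOn_normal_flux (h : S.IsSolutionOn a b) (s : Phase) {t : ℝ} (ht : t ∈ Icc a b) :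
    IntegrableOn (fun x => inner ℝ (S.normal t x) (S.flux s t x)) (levelSurface S.wall (S.φ t))
      (Measure.euclideanHausdorffMeasure 2) := by
  have hF := (Data.contDiff_flux (contDiff_slice (h.u_smooth s) t)
    (contDiff_slice (h.p_smooth s) t) (contDiff_slice (h.J_smooth s) t)
    (contDiff_slice (h.V_smooth s) t)).continuous
  have hdφ := (contDiff_slice h.domain.φ_smooth t).continuous_fderiv two_ne_zero
  obtain ⟨M, hM⟩ := h.domain.bounded.isCompact_closure.exists_bound_of_continuousOn
    hF.continuousOn
  simp only [Data.normal, ← fderiv_div_norm_eq_inner]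
  refine Measure.integrableOn_of_bounded (M := M) (h.domain.area_lt_top ht).ne
    ((hdφ.clm_apply hF).measurable.div hdφ.norm.measurable).aestronglyMeasurable ?_
  refine (ae_restrict_iff' (h.domain.measurableSet_levelSurface t)).2
    (Eventually.of_forall fun x hx => ?_)
  exact (abs_fderiv_div_norm_le _ _ _).trans (hM x (subset_closure hx.1))

/-- The total energy flux out of the two phases is the power of the surface tension. -/
lemma integral_divergence_flux_add (h : S.IsSolutionOn a b) {t : ℝ} (ht : t ∈ Icc a b) :
    (∫ x in S.region .plus t, divergence (S.flux .plus t) x)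
      + ∫ x in S.region .minus t, divergence (S.flux .minus t) x
      = -(S.surfTension * ∫ x in levelSurface S.wall (S.φ t),
        -deriv (fun τ => S.φ τ x) t / ‖fderiv ℝ (S.φ t) x‖ * divergence (unitGradient (S.φ t)) x
        ∂Measure.euclideanHausdorffMeasure 2) := by
  rw [h.integral_divergence_flux _ ht, h.integral_divergence_flux _ ht,
    ← integral_const_mul S.surfTension]
  simp only [Phase.sgn, one_mul, neg_mul, neg_neg]
  rw [neg_add_eq_sub, ← neg_sub, ← integral_sub (h.integrableOn_normal_flux _ ht)
    (h.integrableOn_normal_flux _ ht), neg_inj]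
  refine setIntegral_congr_fun (h.domain.measurableSet_levelSurface t) fun x hx => ?_
  have hx' : x ∈ S.Γ t := by rw [h.Γ_eq ht]; exact hx
  refine (Data.inner_normal_flux_sub (h.jump_stress t ht x hx') (h.jump_velocity t ht x hx')
    (h.kinematic _ t ht x hx') (h.jump_current t ht x hx')
    (h.jump_potential t ht x hx')).trans ?_
  rw [Data.curvature, Data.normalVelocity, norm_gradient_eq]
  change _ = S.surfTension * (_ * divergence (S.normal t) x)
  ring

lemma area_eq (h : S.IsSolutionOn a b) {t : ℝ} (ht : t ∈ Icc a b) :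
    S.area t = (Measure.euclideanHausdorffMeasure 2).real (levelSurface S.wall (S.φ t)) := by
  rw [Data.area, h.Γ_eq ht]
  rfl

/-- The first variation of area for the interface. -/
lemma area_sub (h : S.IsSolutionOn a b) (hab : a ≤ b) :
    S.area b - S.area a = ∫ τ in a..b, ∫ x in levelSurface S.wall (S.φ τ),
        -deriv (fun σ => S.φ σ x) τ / ‖fderiv ℝ (S.φ τ) x‖ * divergence (unitGradient (S.φ τ)) x
        ∂Measure.euclideanHausdorffMeasure 2 := by
  obtain ⟨C, hC0, hC⟩ := h.exists_velocity_bound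
  rw [h.area_eq (right_mem_Icc.2 hab), h.area_eq (left_mem_Icc.2 hab)]
  refine h.domain.area_evolution hab hC0 fun τ hτ x hx => ?_
  have h0 : S.φ τ x = 0 := hx.2
  have h1 := h.normal_velocity_eq .plus hτ hx
  rw [eq_neg_of_add_eq_zero_left h1, abs_neg, mul_comm]
  exact (ContinuousLinearMap.le_opNorm _ _).trans (mul_le_mul_of_nonneg_left
    (hC τ hτ .plus x hx.1 (by rw [h0, mul_zero])) (norm_nonneg (fderiv ℝ (S.φ τ) x)))

/-- The energy identity in integrated form: the power of the surface tension in the balance of the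
bulk energies is compensated by the first variation of area. -/
theorem bulkEnergy_add_area_sub (h : S.IsSolutionOn a b) (hab : a ≤ b) :
    ((∫ x in S.region .plus b, S.energyDensity .plus b x)
        + (∫ x in S.region .minus b, S.energyDensity .minus b x) + S.surfTension * S.area b)
      - ((∫ x in S.region .plus a, S.energyDensity .plus a x)
        + (∫ x in S.region .minus a, S.energyDensity .minus a x) + S.surfTension * S.area a)
      = -∫ τ in a..b, ((∫ x in S.region .plus τ, S.dissipation .plus τ x)
        + ∫ x in S.region .minus τ, S.dissipation .minus τ x) := by
  set f : Phase → ℝ → ℝ := fun s τ => ∫ x in S.region s τ,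
    (deriv (fun τ => S.energyDensity s τ x) τ
      + fderiv ℝ (S.energyDensity s τ) x (S.u s τ x)) with hf
  set d : Phase → ℝ → ℝ := fun s τ => ∫ x in S.region s τ, S.dissipation s τ x with hd
  have ht : ∀ s, _ := fun s => h.transport hab s (h.contDiff_energyDensity s)
  have hfc : ∀ s, IntervalIntegrable (f s) volume a b := fun s =>
    ((h.continuousOn_integral_region s (h.continuous_energyRate s)).mono
      (uIcc_of_le hab).subset).intervalIntegrable
  have hdc : ∀ s, IntervalIntegrable (d s) volume a b := fun s =>
    ((h.continuousOn_integral_region s (h.continuous_dissipation s)).mono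
      (uIcc_of_le hab).subset).intervalIntegrable
  have hbal : ∀ s, ∀ τ ∈ Icc a b,
      f s τ = (∫ x in S.region s τ, divergence (S.flux s τ) x) - d s τ := by
    intro s τ hτ
    have hF := Data.contDiff_flux (contDiff_slice (h.u_smooth s) τ)
      (contDiff_slice (h.p_smooth s) τ) (contDiff_slice (h.J_smooth s) τ)
      (contDiff_slice (h.V_smooth s) τ)
    rw [hf, hd]
    change ∫ x in S.region s τ, _ = _ - ∫ x in S.region s τ, _
    have hsub := integral_sub (h.integrableOn_region s τ (continuous_divergence hF))
      (h.integrableOn_region s τ ((h.continuous_dissipation s).comp (Continuous.prodMk_right τ)))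
    exact (setIntegral_congr_fun (h.isOpen_region s τ).measurableSet fun x hx =>
      h.energyRate_eq s hτ hx).trans hsub
  have harea : S.surfTension * (S.area b - S.area a)
      = -(∫ τ in a..b, f .plus τ) - (∫ τ in a..b, f .minus τ)
        - ∫ τ in a..b, (d .plus τ + d .minus τ) := by
    have hsub := intervalIntegral.integral_sub ((hfc .plus).neg.sub (hfc .minus))
      ((hdc .plus).add (hdc .minus))
    rw [h.area_sub hab, ← intervalIntegral.integral_const_mul, ← intervalIntegral.integral_neg]
    refine Eq.trans ?_ (hsub.trans (congrArg (· - _)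
      (intervalIntegral.integral_sub (hfc .plus).neg (hfc .minus))))
    refine intervalIntegral.integral_congr fun τ hτ => ?_
    rw [uIcc_of_le hab] at hτ
    have h1 := h.integral_divergence_flux_add hτ
    have h2 := hbal .plus τ hτ
    have h3 := hbal .minus τ hτ
    change _ = -f .plus τ - f .minus τ - (d .plus τ + d .minus τ)
    linarith
  have h1 := ht .plus
  have h2 := ht .minus
  change _ = ∫ τ in a..b, f .plus τ at h1
  change _ = ∫ τ in a..b, f .minus τ at h2
  linarith

end Data.IsSolutionOn

end Energy

/-! ### Differentiability of mass and energy -/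

section Derivative

variable {S : Data} {a b : ℝ}

lemma Data.notMem_region {s s' : Phase} (hs : s ≠ s') {t : ℝ} {x : E3} (hx : x ∈ S.region s t) :
    x ∉ S.region s' t := by
  intro hx'
  cases s <;> cases s' <;> first | exact hs rfl | exact lt_asymm hx.2 hx'.2

lemma Data.glue_eq {F : Type*} [AddMonoid F] (f : Phase → ℝ → E3 → F) {s : Phase} {t : ℝ} {x : E3}
    (hx : x ∈ S.region s t) : S.glue f t x = f s t x := by
  cases s
  · rw [Data.glue, indicator_of_mem hx, indicator_of_notMem (Data.notMem_region (by simp) hx),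
      add_zero]
  · rw [Data.glue, indicator_of_mem hx, indicator_of_notMem (Data.notMem_region (by simp) hx),
      zero_add]

lemma Data.glue_nonneg {f : Phase → ℝ → E3 → ℝ} (hf : ∀ s t x, 0 ≤ f s t x) (t : ℝ) (x : E3) :
    0 ≤ S.glue f t x :=
  add_nonneg (indicator_nonneg (fun x _ => hf _ t x) x) (indicator_nonneg (fun x _ => hf _ t x) x)

namespace Data.IsSolutionOn

/-- An integral over the container is the sum of the integrals over the phases. -/
lemma setIntegral_container (h : S.IsSolutionOn a b) {t : ℝ} (ht : t ∈ Icc a b) {g : E3 → ℝ}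
    {f : Phase → E3 → ℝ} (hf : ∀ s, Continuous (f s))
    (hg : ∀ s, ∀ x ∈ S.region s t, g x = f s x) :
    ∫ x in S.Ω, g x = (∫ x in S.region .plus t, f .plus x)
      + ∫ x in S.region .minus t, f .minus x := by
  have hm : ∀ s, MeasurableSet (S.region s t) := fun s => (h.isOpen_region s t).measurableSet
  have hi : ∀ s, IntegrableOn g (S.region s t) := fun s =>
    (h.integrableOn_region s t (hf s)).congr_fun (fun x hx => (hg s x hx).symm) (hm s)
  have hae : S.Ω =ᵐ[volume] (S.region .plus t ∪ S.region .minus t : Set E3) := by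
    have hsub : S.region .plus t ∪ S.region .minus t ⊆ S.Ω := by
      rintro x (hx | hx) <;> exact hx.1
    refine (Filter.EventuallyLE.antisymm ?_ hsub.eventuallyLE)
    refine ae_le_set.2 (measure_mono_null ?_ (h.domain.null_levelSet ht))
    rintro x ⟨hx, hn⟩
    refine ⟨hx, ?_⟩
    by_contra h0
    rcases lt_or_gt_of_ne h0 with h1 | h1
    · exact hn (Or.inr ⟨hx, h1⟩)
    · exact hn (Or.inl ⟨hx, h1⟩)
  rw [setIntegral_congr_set hae, setIntegral_union (disjoint_left.2 fun x hx =>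
    Data.notMem_region (by simp) hx) (hm _) (hi _) (hi _),
    setIntegral_congr_fun (hm _) (hg _), setIntegral_congr_fun (hm _) (hg _)]

lemma energy_eq (h : S.IsSolutionOn a b) {t : ℝ} (ht : t ∈ Icc a b) :
    S.energy t = (∫ x in S.region .plus t, S.energyDensity .plus t x)
      + (∫ x in S.region .minus t, S.energyDensity .minus t x) + S.surfTension * S.area t := by
  have hu : ∀ s, Continuous (S.u s t) := fun s => (contDiff_slice (h.u_smooth s) t).continuous
  have hk : ∀ s, Continuous fun x => 1 / 2 * S.ρ s * ‖S.u s t x‖ ^ 2 := fun s =>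
    continuous_const.mul ((hu s).norm.pow 2)
  have hp : ∀ s, Continuous fun x : E3 => S.ρ s * S.g * x 2 := fun s => by fun_prop
  have h1 := h.setIntegral_container ht (g := fun x => 1 / 2 * S.density t x * ‖S.velocity t x‖ ^ 2)
    hk fun s x hx => by
      change 1 / 2 * S.glue _ t x * ‖S.glue _ t x‖ ^ 2 = _
      rw [Data.glue_eq _ hx, Data.glue_eq _ hx]
  have h2 := h.setIntegral_container ht (g := fun x => S.density t x * S.g * x 2) hp
    fun s x hx => by
      change S.glue _ t x * S.g * x 2 = _
      rw [Data.glue_eq _ hx]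
  have h3 : ∀ s, ∫ x in S.region s t, S.energyDensity s t x
      = (∫ x in S.region s t, 1 / 2 * S.ρ s * ‖S.u s t x‖ ^ 2)
        + ∫ x in S.region s t, S.ρ s * S.g * x 2 := fun s =>
    integral_add (h.integrableOn_region s t (hk s)) (h.integrableOn_region s t (hp s))
  rw [Data.energy, h1, h2, h3, h3]
  ring

lemma dissipation_eq (h : S.IsSolutionOn a b) {t : ℝ} (ht : t ∈ Icc a b) :
    S.viscousDissipation t + S.jouleDissipation t
      = (∫ x in S.region .plus t, S.dissipation .plus t x)
        + ∫ x in S.region .minus t, S.dissipation .minus t x := by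
  have hv : ∀ s, Continuous fun x => 2 * S.η s * frobeniusSq (deformation (S.u s t) x) := by
    intro s
    have hp := contDiff_pderiv (contDiff_slice (h.u_smooth s) t)
    have hD : ∀ i j, Continuous fun x => deformation (S.u s t) x i j ^ 2 := fun i j =>
      (((hp j i).continuous.add (hp i j).continuous).div_const 2).pow 2
    exact continuous_const.mul
      (continuous_finsetSum _ fun i _ => continuous_finsetSum _ fun j _ => hD i j)
  have hj : ∀ s, Continuous fun x => (S.σ s)⁻¹ * ‖S.J s t x‖ ^ 2 := fun s =>
    continuous_const.mul ((contDiff_slice (h.J_smooth s) t).continuous.norm.pow 2)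
  have h1 := h.setIntegral_container ht
    (g := fun x => 2 * S.viscosity t x * frobeniusSq (S.strain t x)) hv fun s x hx => by
      change 2 * S.glue _ t x * frobeniusSq (S.glue _ t x) = _
      rw [Data.glue_eq _ hx, Data.glue_eq _ hx]
  have h2 := h.setIntegral_container ht
    (g := fun x => (S.conductivity t x)⁻¹ * ‖S.current t x‖ ^ 2) hj fun s x hx => by
      change (S.glue _ t x)⁻¹ * ‖S.glue _ t x‖ ^ 2 = _
      rw [Data.glue_eq _ hx, Data.glue_eq _ hx]
  have h3 : ∀ s, ∫ x in S.region s t, S.dissipation s t x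
      = (∫ x in S.region s t, 2 * S.η s * frobeniusSq (deformation (S.u s t) x))
        + ∫ x in S.region s t, (S.σ s)⁻¹ * ‖S.J s t x‖ ^ 2 := fun s =>
    integral_add (h.integrableOn_region s t (hv s)) (h.integrableOn_region s t (hj s))
  rw [Data.viscousDissipation, Data.jouleDissipation, h1, h2, h3, h3]
  ring

lemma hasDerivAt_mass (h : S.IsSolutionOn a b) {t : ℝ} (ht : t ∈ Ioo a b) (s : Phase) :
    HasDerivAt (S.mass s) 0 t := by
  refine (hasDerivAt_const t (S.mass s a)).congr_of_eventuallyEq ?_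
  filter_upwards [Ioo_mem_nhds ht.1 ht.2] with τ hτ
  exact (h.mono (Icc_subset_Icc_right hτ.2.le)).mass_eq hτ.1.le s

theorem hasDerivAt_energy (h : S.IsSolutionOn a b) {t : ℝ} (ht : t ∈ Ioo a b) :
    HasDerivAt S.energy (-S.viscousDissipation t - S.jouleDissipation t) t := by
  set D : ℝ → ℝ := fun τ => (∫ x in S.region .plus τ, S.dissipation .plus τ x)
    + ∫ x in S.region .minus τ, S.dissipation .minus τ x with hD
  have hDc : ContinuousOn D (Icc a b) :=
    (h.continuousOn_integral_region .plus (h.continuous_dissipation .plus)).add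
      (h.continuousOn_integral_region .minus (h.continuous_dissipation .minus))
  have hder : HasDerivAt (fun τ => ∫ σ in a..τ, D σ) (D t) t := by
    refine intervalIntegral.integral_hasDerivAt_right ?_ ?_ ?_
    · refine (hDc.mono ?_).intervalIntegrable
      rw [uIcc_of_le ht.1.le]
      exact Icc_subset_Icc_right ht.2.le
    · exact (hDc.mono Ioo_subset_Icc_self).stronglyMeasurableAtFilter isOpen_Ioo t ht
    · exact hDc.continuousAt (Icc_mem_nhds ht.1 ht.2)
  have hval : -S.viscousDissipation t - S.jouleDissipation t = -D t := by
    have := h.dissipation_eq (Ioo_subset_Icc_self ht)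
    change _ = -((∫ x in S.region .plus t, S.dissipation .plus t x)
      + ∫ x in S.region .minus t, S.dissipation .minus t x)
    linarith
  rw [hval]
  refine (hder.neg.const_add (S.energy a)).congr_of_eventuallyEq ?_
  filter_upwards [Ioo_mem_nhds ht.1 ht.2] with τ hτ
  have h1 := (h.mono (Icc_subset_Icc_right hτ.2.le)).bulkEnergy_add_area_sub hτ.1.le
  rw [← h.energy_eq (Ioo_subset_Icc_self hτ), ← h.energy_eq ⟨le_rfl, (hτ.1.trans hτ.2).le⟩] at h1
  change S.energy τ = S.energy a + -∫ σ in a..τ, D σ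
  linarith

end Data.IsSolutionOn

end Derivative

/-! ### Reparametrization of time -/

section Reparametrization

/-- A smooth map of the line into `(0, T)` that is the identity near a given time. -/
lemma exists_time_map {T t : ℝ} (ht : t ∈ Ioo 0 T) :
    ∃ θ : ℝ → ℝ, ContDiff ℝ 2 θ ∧ (∀ τ, θ τ ∈ Ioo 0 T) ∧
      ∃ a b, t ∈ Ioo a b ∧ ∀ τ ∈ Icc a b, θ =ᶠ[𝓝 τ] id := by
  obtain ⟨δ, hδ, hball⟩ := Metric.isOpen_iff.1 isOpen_Ioo t ht
  let f : ContDiffBump t := ⟨δ / 3, δ / 2, by positivity, by linarith⟩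
  refine ⟨fun τ => t + f τ * (τ - t), ?_, fun τ => hball ?_, t - δ / 4, t + δ / 4,
    ⟨by linarith, by linarith⟩, fun τ hτ => ?_⟩
  · exact contDiff_const.add (f.contDiff.mul (contDiff_id.sub contDiff_const))
  · rw [Metric.mem_ball, Real.dist_eq, add_sub_cancel_left, abs_mul, abs_of_nonneg f.nonneg]
    by_cases hτ : |τ - t| < δ / 2
    · exact (mul_le_of_le_one_left (abs_nonneg _) f.le_one).trans_lt (by linarith)
    · have h0 : f τ = 0 := f.zero_of_le_dist (by rw [Real.dist_eq]; exact not_lt.1 hτ)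
      rw [h0, zero_mul]
      exact hδ
  · have h1 : τ ∈ Metric.ball t (δ / 3) := by
      rw [Metric.mem_ball, Real.dist_eq, abs_lt]
      constructor <;> linarith [hτ.1, hτ.2]
    filter_upwards [Metric.isOpen_ball.mem_nhds h1] with σ hσ
    have h2 : f σ = 1 := f.one_of_mem_closedBall (Metric.ball_subset_closedBall hσ)
    change t + f σ * (σ - t) = σ
    rw [h2]
    ring

/-- The fields with time `τ` replaced by `θ τ`. If `θ` takes values in `(0, T)`, fields that are
smooth on `(0, T) × ℝ³` become smooth on the whole space-time. -/
def Data.reparam (S : Data) (θ : ℝ → ℝ) : Data :=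
  { S with
    φ := fun τ => S.φ (θ τ)
    u := fun s τ => S.u s (θ τ)
    p := fun s τ => S.p s (θ τ)
    J := fun s τ => S.J s (θ τ)
    V := fun s τ => S.V s (θ τ) }

variable {S : Data} {θ : ℝ → ℝ}

lemma Data.region_reparam (s : Phase) (τ : ℝ) : (S.reparam θ).region s τ = S.region s (θ τ) := by
  cases s <;> rfl

lemma Data.Γ_reparam (τ : ℝ) : (S.reparam θ).Γ τ = S.Γ (θ τ) := rfl

lemma contDiff_reparam {F : Type*} [NormedAddCommGroup F] [NormedSpace ℝ F] {T : ℝ} {n : ℕ∞}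
    {f : ℝ → E3 → F} (hf : ContDiffOn ℝ n (fun q : ℝ × E3 => f q.1 q.2) (Ioo 0 T ×ˢ univ))
    (hθ : ContDiff ℝ n θ) (hmaps : ∀ τ, θ τ ∈ Ioo 0 T) :
    ContDiff ℝ n fun q : ℝ × E3 => f (θ q.1) q.2 :=
  hf.comp_contDiff (f := fun q : ℝ × E3 => (θ q.1, q.2))
    ((hθ.comp contDiff_fst).prodMk contDiff_snd) fun q => ⟨hmaps q.1, mem_univ _⟩

lemma deriv_reparam {F : Type*} [NormedAddCommGroup F] [NormedSpace ℝ F] (f : ℝ → F) {τ : ℝ}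
    (hθ : θ =ᶠ[𝓝 τ] id) : deriv (fun τ => f (θ τ)) τ = deriv f (θ τ) := by
  have h1 : (fun τ => f (θ τ)) =ᶠ[𝓝 τ] f := hθ.mono fun σ hσ => congrArg f hσ
  rw [h1.deriv_eq, hθ.eq_of_nhds, id]

lemma gradient_ne_zero_iff {f : E3 → ℝ} {x : E3} : gradient f x ≠ 0 ↔ fderiv ℝ f x ≠ 0 := by
  rw [← norm_ne_zero_iff, norm_gradient_eq, norm_ne_zero_iff]

/-- Where the reparametrization is the identity, the system is preserved; the reparametrized fields
are smooth on the whole space-time. -/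
lemma Data.IsSmoothSolution.isSolutionOn_reparam (hS : S.IsSmoothSolution) {a b : ℝ}
    (hθ : ContDiff ℝ 2 θ) (hmaps : ∀ τ, θ τ ∈ Ioo 0 S.T)
    (hid : ∀ τ ∈ Icc a b, θ =ᶠ[𝓝 τ] id) : (S.reparam θ).IsSolutionOn a b where
  domain :=
    { bounded := hS.bounded
      wall_smooth := hS.wall_smooth
      wall_regular := fun x hx => gradient_ne_zero_iff.1 (hS.wall_regular x hx)
      φ_smooth := contDiff_reparam (n := 2) hS.φ_smooth hθ hmaps
      φ_regular := fun τ _ x hx h0 =>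
        gradient_ne_zero_iff.1 (hS.φ_regular (θ τ) (hmaps τ) x hx h0) }
  conductivity_ne_zero s := (hS.conductivity_pos s).ne'
  u_smooth s := contDiff_reparam (n := 2) (hS.u_smooth s) hθ hmaps
  p_smooth s := contDiff_reparam (n := 1) (hS.p_smooth s) (hθ.of_le one_le_two) hmaps
  J_smooth s := contDiff_reparam (n := 1) (hS.J_smooth s) (hθ.of_le one_le_two) hmaps
  V_smooth s := contDiff_reparam (n := 1) (hS.V_smooth s) (hθ.of_le one_le_two) hmaps
  momentum s τ hτ x hx := by
    rw [Data.region_reparam] at hx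
    have h1 := hS.momentum s (θ τ) (hmaps τ) x hx
    rw [← deriv_reparam (fun σ => S.u s σ x) (hid τ hτ)] at h1
    exact h1
  incompressible s τ _ x hx := by
    rw [Data.region_reparam] at hx
    exact hS.incompressible s (θ τ) (hmaps τ) x hx
  ohm s τ _ x hx := by
    rw [Data.region_reparam] at hx
    exact hS.ohm s (θ τ) (hmaps τ) x hx
  charge s τ _ x hx := by
    rw [Data.region_reparam] at hx
    exact hS.charge s (θ τ) (hmaps τ) x hx
  jump_stress τ _ x hx := hS.jump_stress (θ τ) (hmaps τ) x hx
  jump_velocity τ _ x hx := hS.jump_velocity (θ τ) (hmaps τ) x hx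
  kinematic s τ hτ x hx := by
    have h1 := hS.kinematic s (θ τ) (hmaps τ) x hx
    rw [Data.normalVelocity, ← deriv_reparam (fun σ => S.φ σ x) (hid τ hτ)] at h1
    exact h1
  jump_current τ _ x hx := hS.jump_current (θ τ) (hmaps τ) x hx
  jump_potential τ _ x hx := hS.jump_potential (θ τ) (hmaps τ) x hx
  no_slip s τ _ x hx := by
    rw [Data.region_reparam] at hx
    exact hS.no_slip s (θ τ) (hmaps τ) x hx
  insulating s τ _ x hx := by
    rw [Data.region_reparam] at hx
    exact hS.insulating s (θ τ) (hmaps τ) x hx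

lemma Data.IsSmoothSolution.viscousDissipation_nonneg (hS : S.IsSmoothSolution) (t : ℝ) :
    0 ≤ S.viscousDissipation t :=
  integral_nonneg fun x => mul_nonneg (mul_nonneg zero_le_two
    (Data.glue_nonneg (fun s _ _ => (hS.viscosity_pos s).le) t x))
    (Finset.sum_nonneg fun _ _ => Finset.sum_nonneg fun _ _ => sq_nonneg _)

lemma Data.IsSmoothSolution.jouleDissipation_nonneg (hS : S.IsSmoothSolution) (t : ℝ) :
    0 ≤ S.jouleDissipation t :=
  integral_nonneg fun x => mul_nonneg (inv_nonneg.2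
    (Data.glue_nonneg (fun s _ _ => (hS.conductivity_pos s).le) t x)) (sq_nonneg _)

end Reparametrization

end TwoPhaseMHD

end

theorem theorem2p1 (S : TwoPhaseMHD.Data) (hS : S.IsSmoothSolution) (t : ℝ)
    (ht : t ∈ Set.Ioo 0 S.T) :
    (∀ s : TwoPhaseMHD.Phase, HasDerivAt (S.mass s) 0 t) ∧
    MeasureTheory.Measure.euclideanHausdorffMeasure 2 (S.Γ t) < ⊤ ∧
    HasDerivAt S.energy (-S.viscousDissipation t - S.jouleDissipation t) t ∧
    -S.viscousDissipation t - S.jouleDissipation t ≤ 0 := by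
  obtain ⟨θ, hθ, hmaps, a, b, htab, hid⟩ := TwoPhaseMHD.exists_time_map ht
  have h := hS.isSolutionOn_reparam hθ hmaps hid
  have ht' := Ioo_subset_Icc_self htab
  have hev := hid t ht'
  have hθt : θ t = t := hev.eq_of_nhds
  refine ⟨fun s => ?_, ?_, ?_, ?_⟩
  · refine (h.hasDerivAt_mass htab s).congr_of_eventuallyEq (hev.mono fun τ hτ => ?_)
    have hτ' : θ τ = τ := hτ
    rw [TwoPhaseMHD.Data.mass, TwoPhaseMHD.Data.mass, TwoPhaseMHD.Data.region_reparam, hτ']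
    rfl
  · have h1 := h.domain.area_lt_top ht'
    rw [← h.Γ_eq ht', TwoPhaseMHD.Data.Γ_reparam, hθt] at h1
    exact h1
  · have h1 := h.hasDerivAt_energy htab
    have hv : (S.reparam θ).viscousDissipation t = S.viscousDissipation (θ t) := rfl
    have hj : (S.reparam θ).jouleDissipation t = S.jouleDissipation (θ t) := rfl
    rw [hv, hj, hθt] at h1
    refine h1.congr_of_eventuallyEq (hev.mono fun τ hτ => ?_)
    have hτ' : θ τ = τ := hτ
    have he : (S.reparam θ).energy τ = S.energy (θ τ) := rfl
    rw [he, hτ']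
  · linarith [hS.viscousDissipation_nonneg t, hS.jouleDissipation_nonneg t]
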